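/- **Setting.** Let $k\ge 1$, $\mathbf n=(n_1,\dots,n_k)$ with all $n_i\ge 1$, and let $\mathcal E$ be a complex Hilbert space; all Hilbert spaces are complex, and $\mathcal E\otimes\mathcal H$ is the Hilbert tensor product. For tuples $\mathbf X=(X_1,\dots,X_k)$, $X_i=(X_{i,1},\dots,X_{i,n_i})$, of operators in $B(\mathcal H)$ put $\Phi_{X_i}(Y)=\sum_j X_{i,j}YX_{i,j}^*$ and $\mathbf\Delta_{\mathbf X}=(\mathrm{id}-\Phi_{X_1})\circ\cdots\circ(\mathrm{id}-\Phi_{X_k})$. The regular polyball $\mathbf B_{\mathbf n}(\mathcal H)$ consists of all $\mathbf X$ such that the entries of $X_s$ commute with those of $X_t$ for $s\ne t$, $\|\sum_j X_{i,j}X_{i,j}^*\|<1$ for all $i$, and $\mathbf\Delta_{\mathbf X}(I)$ is positive and invertible; $\mathbf B_{\mathbf n}(\mathcal H)^-$ is its norm closure. Let $\mathbb F_{n_i}^+$ be the free monoid on $n_i$ generators, $F^2(H_{n_i})$ the full Fock space with orthonormal basis $\{e^i_\alpha\}_{\alpha\in\mathbb F_{n_i}^+}$, $\mathbf S=\{\mathbf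 S_{i,j}\}$ the left creation operators on $\mathcal F:=\bigotimes_{i=1}^kF^2(H_{n_i})$, and $\mathcal A_{\mathbf n}$ the norm closed (non-selfadjoint) algebra generated by the $\mathbf S_{i,j}$ and $I$. Write $X_{i,\alpha}=X_{i,j_1}\cdots X_{i,j_p}$ for a word $\alpha=g_{j_1}\cdots g_{j_p}$. $\otimes_{min}$ denotes the norm closed span of elementary tensors of operators. For $\mathbf X\in\mathbf B_{\mathbf n}(\mathcal H)$ let $\mathbf K_{\mathbf X}:\mathcal H\to\mathcal F\otimes\mathcal H$, $$\mathbf K_{\mathbf X}h=\sum_{\beta_i\in\mathbb F_{n_i}^+}e^1_{\beta_1}\otimes\cdots\otimes e^k_{\beta_k}\otimes\mathbf\Delta_{\mathbf X}(I)^{1/2}X_{1,\beta_1}^*\cdots X_{k,\beta_k}^*h ,$$ and for $A\in B(\mathcal E\otimes\mathcal F)$ let $\mathcal B^{ext}_{\mathbf X}[A]=(I_{\mathcal E}\otimes\mathbf K_{\mathbf X}^*)(A\otimes I_{\mathcal H})(I_{\mathcal E}\otimes\mathbf K_{\mathbf X})$. Let $$\mathcal P:=\overline{\operatorname{span}}^{\|\cdot\|}\{f^*g:\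 f,g\in B(\mathcal E)\otimes_{min}\mathcal A_{\mathbf n}\}\subset B(\mathcal E\otimes\mathcal F).$$ A free $k$-pluriharmonic function with coefficients in $B(\mathcal E)$ is a function of the form $$F(\mathbf X)=\sum_{m_1\in\mathbb Z}\cdots\sum_{m_k\in\mathbb Z}\ \sum_{|\alpha_i|=m_i^-,\,|\beta_i|=m_i^+}A_{(\alpha_1,\dots,\alpha_k;\beta_1,\dots,\beta_k)}\otimes X_{1,\alpha_1}\cdots X_{k,\alpha_k}X_{1,\beta_1}^*\cdots X_{k,\beta_k}^*,$$ with coefficients in $B(\mathcal E)$ for which the iterated series converges in operator norm for every $\mathbf X\in\mathbf B_{\mathbf n}(\mathcal H')$ and every Hilbert space $\mathcal H'$ (a series over $\mathbb Z$ converges if its parts over $m\ge0$ and over $m<0$ both converge). $F(r\mathbf S)$ denotes the value of this series at $r\mathbf S$, $0\le r<1$. Let $\mathbf{PH}^c_{\mathcal E}(\mathbf B_{\mathbf n})$ be the space of all free $k$-pluriharmonic functions on $\mathbf B_{\mathbf n}=\{\mathbf B_{\mathbf n}(\mathcal H)\}_{\mathcal H}$ with coefficients in $B(\mathcal E)$ which,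 for every Hilbert space $\mathcal H$, extend norm-continuously to $\mathbf B_{\mathbf n}(\mathcal H)^-$. It is an operator space with the matrix norms $\|[F_{ij}]_m\|=\sup\|[F_{ij}(\mathbf X)]_m\|$, the supremum being over all $\mathbf X\in\mathbf B_{\mathbf n}(\mathcal H)$ and all Hilbert spaces $\mathcal H$. **Theorem.** Let $\mathcal H$ be an infinite dimensional Hilbert space and let $F:\mathbf B_{\mathbf n}(\mathcal H)\to B(\mathcal E)\otimes_{min}B(\mathcal H)$. The following are equivalent: (i) $F$ is a free $k$-pluriharmonic function on $\mathbf B_{\mathbf n}(\mathcal H)$ such that $F(r\mathbf S)$ converges in the operator norm as $r\to1$; (ii) there exists $A\in\mathcal P$ such that $F(\mathbf X)=\mathcal B^{ext}_{\mathbf X}[A]$ for all $\mathbf X\in\mathbf B_{\mathbf n}(\mathcal H)$; (iii) $F$ is a free $k$-pluriharmonic function on $\mathbf B_{\mathbf n}(\mathcal H)$ which has a continuous extension, in the operator norm topology, to $\mathbf B_{\mathbf n}(\mathcal H)^-$. In this case $A=\lim_{r\to1}F(r\mathbf S)$ in the operator norm. Moreover, the map $\Phi:\mathbf{PH}^c_{\mathcal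 E}(\mathbf B_{\mathbf n})\to\mathcal P$, $\Phi(F):=A$ (so that $F(\mathbf X)=\mathcal B^{ext}_{\mathbf X}[\Phi(F)]$ and $\Phi(F)=\lim_{r\to1}F(r\mathbf S)$), is a completely isometric isomorphism of operator spaces: it is linear, bijective, and $\|[F_{ij}]_m\|=\|[\Phi(F_{ij})]_m\|$ for all $m$. -/

import Mathlib

open scoped TensorProduct Topology
open Filter

universe u v

namespace RegularPolyball

noncomputable section

/-! ### Hilbert tensor products -/

section HilbertTensor

/-- The Hilbert space tensor product: the completion of the algebraic tensor product with respect
to the inner product `⟪x ⊗ y, x' ⊗ y'⟫ = ⟪x, x'⟫ ⟪y, y'⟫`. -/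
def HTensor (E F : Type*) [NormedAddCommGroup E] [InnerProductSpace ℂ E]
    [NormedAddCommGroup F] [InnerProductSpace ℂ F] : Type _ :=
  UniformSpace.Completion (E ⊗[ℂ] F)

variable {E F G E' F' : Type*}
  [NormedAddCommGroup E] [InnerProductSpace ℂ E] [NormedAddCommGroup F] [InnerProductSpace ℂ F]
  [NormedAddCommGroup G] [InnerProductSpace ℂ G]
  [NormedAddCommGroup E'] [InnerProductSpace ℂ E'] [NormedAddCommGroup F'] [InnerProductSpace ℂ F']

instance : NormedAddCommGroup (HTensor E F) :=
  inferInstanceAs (NormedAddCommGroup (UniformSpace.Completion (E ⊗[ℂ] F)))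

instance : InnerProductSpace ℂ (HTensor E F) :=
  inferInstanceAs (InnerProductSpace ℂ (UniformSpace.Completion (E ⊗[ℂ] F)))

instance : CompleteSpace (HTensor E F) :=
  inferInstanceAs (CompleteSpace (UniformSpace.Completion (E ⊗[ℂ] F)))

/-- The inclusion of the algebraic tensor product into the Hilbert tensor product. -/
def inclT (E F : Type*) [NormedAddCommGroup E] [InnerProductSpace ℂ E]
    [NormedAddCommGroup F] [InnerProductSpace ℂ F] : E ⊗[ℂ] F →ₗᵢ[ℂ] HTensor E F :=
  UniformSpace.Completion.toComplₗᵢ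

lemma denseRange_inclT : DenseRange (inclT E F) :=
  UniformSpace.Completion.denseRange_coe

/-- The operator `S ⊗ T` between Hilbert tensor products. -/
def opTensor (S : E →L[ℂ] E') (T : F →L[ℂ] F') : HTensor E F →L[ℂ] HTensor E' F' :=
  (TensorProduct.mapL S T).completion

lemma opTensor_inclT (S : E →L[ℂ] E') (T : F →L[ℂ] F') (x : E ⊗[ℂ] F) :
    opTensor S T (inclT E F x) = inclT E' F' (TensorProduct.mapL S T x) :=
  ContinuousLinearMap.completion_apply_coe _ _

lemma opTensor_add_left (S S' : E →L[ℂ] E') (T : F →L[ℂ] F') :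
    opTensor (S + S') T = opTensor S T + opTensor S' T := by
  apply ContinuousLinearMap.coeFn_injective
  refine denseRange_inclT.equalizer (by fun_prop) (by fun_prop) (funext fun x => ?_)
  simp only [Function.comp_apply, _root_.add_apply, opTensor_inclT,
    TensorProduct.mapL_add_left, map_add]

lemma opTensor_smul_left (c : ℂ) (S : E →L[ℂ] E') (T : F →L[ℂ] F') :
    opTensor (c • S) T = c • opTensor S T := by
  apply ContinuousLinearMap.coeFn_injective
  refine denseRange_inclT.equalizer (opTensor (c • S) T).continuous
    (c • opTensor S T).continuous (funext fun x => ?_)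
  have h : (c • opTensor S T) (inclT E F x) = c • opTensor S T (inclT E F x) := rfl
  rw [Function.comp_apply, Function.comp_apply, h, opTensor_inclT, opTensor_inclT,
    TensorProduct.mapL_smul_left, ← map_smul]
  rfl

/-- The operator `y ↦ x ⊗ y`. -/
def tensorLeft (F : Type*) [NormedAddCommGroup F] [InnerProductSpace ℂ F] (x : E) :
    F →L[ℂ] HTensor E F :=
  (inclT E F).toContinuousLinearMap ∘L TensorProduct.mkL ℂ E F x

lemma denseRange_of_tmul {M : Type*} [AddCommGroup M] [Module ℂ M]
    (f : M →ₗ[ℂ] HTensor E F)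
    (h : ∀ x y, inclT E F (x ⊗ₜ[ℂ] y) ∈ closure (Set.range f)) : DenseRange f := by
  have h1 : ∀ z : E ⊗[ℂ] F, inclT E F z ∈ (LinearMap.range f).topologicalClosure := by
    intro z
    induction z with
    | zero => simp
    | tmul x y => exact h x y
    | add a b ha hb => rw [map_add]; exact add_mem ha hb
  have h2 : closure (Set.range (inclT E F)) ⊆ closure (Set.range f) := by
    apply closure_minimal _ isClosed_closure
    rintro _ ⟨z, rfl⟩
    exact h1 z
  intro z
  exact h2 (denseRange_inclT z)

lemma denseRange_assoc_left : DenseRange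
    ((inclT (HTensor E F) G).toLinearMap ∘ₗ
      TensorProduct.map (inclT E F).toLinearMap (LinearMap.id (R := ℂ) (M := G))) := by
  refine denseRange_of_tmul _ fun x y => ?_
  refine denseRange_inclT.induction_on (p := fun x => inclT (HTensor E F) G (x ⊗ₜ[ℂ] y) ∈
    closure (Set.range _)) x ?_ fun a => subset_closure ⟨a ⊗ₜ y, rfl⟩
  refine isClosed_closure.preimage ((inclT (HTensor E F) G).continuous.comp ?_)
  exact TensorProduct.continuous_tmul.comp (by fun_prop : Continuous fun x => (x, y))

lemma denseRange_assoc_right : DenseRange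
    ((inclT E (HTensor F G)).toLinearMap ∘ₗ
      TensorProduct.map (LinearMap.id (R := ℂ) (M := E)) (inclT F G).toLinearMap) := by
  refine denseRange_of_tmul _ fun x y => ?_
  refine denseRange_inclT.induction_on (p := fun y => inclT E (HTensor F G) (x ⊗ₜ[ℂ] y) ∈
    closure (Set.range _)) y ?_ fun a => subset_closure ⟨x ⊗ₜ a, rfl⟩
  refine isClosed_closure.preimage ((inclT E (HTensor F G)).continuous.comp ?_)
  exact TensorProduct.continuous_tmul.comp (by fun_prop : Continuous fun y => (x, y))

/-- The canonical unitary `(E ⊗ F) ⊗ G ≃ E ⊗ (F ⊗ G)`. -/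
def assocU (E F G : Type*) [NormedAddCommGroup E] [InnerProductSpace ℂ E]
    [NormedAddCommGroup F] [InnerProductSpace ℂ F] [NormedAddCommGroup G] [InnerProductSpace ℂ G] :
    HTensor (HTensor E F) G ≃ₗᵢ[ℂ] HTensor E (HTensor F G) :=
  (TensorProduct.assoc ℂ E F G).extendOfIsometry _ _
    (denseRange_assoc_left (E := E) (F := F) (G := G))
    (denseRange_assoc_right (E := E) (F := F) (G := G)) (by
      intro x
      have h1 := TensorProduct.norm_map (LinearIsometry.id (R := ℂ) (E := E)) (inclT F G)
        (TensorProduct.assoc ℂ E F G x)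
      have h2 := TensorProduct.norm_map (inclT E F) (LinearIsometry.id (R := ℂ) (E := G)) x
      have h3 := TensorProduct.norm_assoc x
      have e1 := (inclT E (HTensor F G)).norm_map (TensorProduct.map
        (LinearIsometry.id (R := ℂ) (E := E)).toLinearMap (inclT F G).toLinearMap
        (TensorProduct.assoc ℂ E F G x))
      have e2 := (inclT (HTensor E F) G).norm_map (TensorProduct.map
        (inclT E F).toLinearMap (LinearIsometry.id (R := ℂ) (E := G)).toLinearMap x)
      exact e1.trans (h1.trans (h3.trans (h2.symm.trans e2.symm))))

end HilbertTensor

/-! ### The regular polyball -/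

section Polyball

variable {k : ℕ} (n : Fin k → ℕ)

/-- `k`-tuples `X = (X_1, …, X_k)`, `X_i = (X_{i,1}, …, X_{i,n_i})`, of bounded operators on `H`.
The (supremum) norm of the product induces the operator norm topology. -/
abbrev Tuple (H : Type*) [NormedAddCommGroup H] [InnerProductSpace ℂ H] : Type _ :=
  ∀ i : Fin k, Fin (n i) → (H →L[ℂ] H)

/-- The direct product of the free semigroups on `n_i` generators; a word is a list of letters. -/
abbrev Word : Type := ∀ i : Fin k, List (Fin (n i))

variable {n} {H : Type*} [NormedAddCommGroup H] [InnerProductSpace ℂ H] [CompleteSpace H]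

/-- The map `Φ_{X_i}(Y) = ∑ j, X_{i,j} Y X_{i,j}^*`. -/
def Phi (X : Tuple n H) (i : Fin k) : Module.End ℂ (H →L[ℂ] H) :=
  ∑ j : Fin (n i), LinearMap.mulLeftRight ℂ (X i j, star (X i j))

/-- The defect mapping `Δ_X = (id - Φ_{X_1}) ∘ ⋯ ∘ (id - Φ_{X_k})`. -/
def defectMap (X : Tuple n H) : Module.End ℂ (H →L[ℂ] H) :=
  (List.ofFn fun i => 1 - Phi X i).prod

variable (n H) in
/-- The regular polyball `B_n(H)`: entries of different `X_s`, `X_t` commute, each `X_i` is a strict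
row contraction, and `Δ_X(I)` is positive and invertible. -/
def polyball : Set (Tuple n H) :=
  {X | (∀ s t, s ≠ t → ∀ a b, Commute (X s a) (X t b)) ∧
    (∀ i, ‖∑ j, X i j * star (X i j)‖ < 1) ∧
    IsStrictlyPositive (defectMap X 1)}

/-- `X_{i,α} = X_{i,j_1} ⋯ X_{i,j_p}` for the word `α = g_{j_1} ⋯ g_{j_p}`. -/
def wordOp (X : Tuple n H) (i : Fin k) (α : List (Fin (n i))) : H →L[ℂ] H :=
  (α.map (X i)).prod

/-- `X_{1,α_1} ⋯ X_{k,α_k}`. -/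
def monomial (X : Tuple n H) (α : Word n) : H →L[ℂ] H :=
  (List.ofFn fun i => wordOp X i (α i)).prod

/-- `X_{1,β_1}^* ⋯ X_{k,β_k}^*`. -/
def monomialStar (X : Tuple n H) (β : Word n) : H →L[ℂ] H :=
  (List.ofFn fun i => star (wordOp X i (β i))).prod

end Polyball

/-! ### The Fock space and the universal model -/

section Fock

variable {k : ℕ} (n : Fin k → ℕ)

/-- The Hilbert space `F²(H_{n_1}) ⊗ ⋯ ⊗ F²(H_{n_k})`, described by its orthonormal basis
`e_α = e^1_{α_1} ⊗ ⋯ ⊗ e^k_{α_k}`. -/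
abbrev Fock : Type := lp (fun _ : Word n => ℂ) 2

variable {n}

/-- The basis vector `e_α`. -/
def basisVec (α : Word n) : Fock n := lp.single 2 α (1 : ℂ)

lemma orthonormal_basisVec : Orthonormal ℂ (basisVec (n := n)) := by
  classical
  rw [orthonormal_iff_ite]
  intro α β
  simp only [basisVec, lp.inner_single_left, lp.single_apply]
  by_cases h : α = β
  · subst h; simp
  · simp [h]

/-- `(α_1, …, g_j α_i, …, α_k)`. -/
def consAt (i : Fin k) (j : Fin (n i)) (α : Word n) : Word n :=
  Function.update α i (j :: α i)

lemma consAt_injective (i : Fin k) (j : Fin (n i)) : Function.Injective (consAt (n := n) i j) := by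
  intro α β h
  funext l
  have hl := congrFun h l
  by_cases hli : l = i
  · subst hli
    simpa [consAt] using hl
  · simpa [consAt, hli] using hl

/-- The left creation operator `S_{i,j}` on `F²(H_{n_1}) ⊗ ⋯ ⊗ F²(H_{n_k})`: the isometry with
`S_{i,j} e_α = e_{(α_1, …, g_j α_i, …, α_k)}`. -/
def creation (i : Fin k) (j : Fin (n i)) : Fock n →L[ℂ] Fock n :=
  (orthonormal_basisVec.comp _ (consAt_injective i j)).orthogonalFamily.linearIsometry
    |>.toContinuousLinearMap

lemma creation_basisVec (i : Fin k) (j : Fin (n i)) (α : Word n) :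
    creation i j (basisVec α) = basisVec (consAt i j α) := by
  have := (orthonormal_basisVec.comp _ (consAt_injective i j)).orthogonalFamily
    |>.linearIsometry_apply_single (i := α) (1 : ℂ)
  simp only [one_smul, LinearIsometry.toSpanSingleton_apply, Function.comp_apply] at this
  exact this

variable (n) in
/-- The universal model `S = {S_{i,j}}`. -/
def universalModel : Tuple n (Fock n) := fun i j => creation i j

variable (n) in
/-- The polyball algebra `𝒜_n`: the norm closed non-selfadjoint algebra generated by the
`S_{i,j}` and the identity. -/
def polyballAlgebra : Subalgebra ℂ (Fock n →L[ℂ] Fock n) :=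
  (Algebra.adjoin ℂ {T | ∃ i j, T = creation (n := n) i j}).topologicalClosure

end Fock

/-! ### Minimal tensor products and the space `𝒫` -/

section Spaces

variable (E : Type*) [NormedAddCommGroup E] [InnerProductSpace ℂ E]

/-- `B(E) ⊗_min M` for an operator space `M ⊆ B(H)`: the norm closure in `B(E ⊗ H)` of the span of
the operators `B ⊗ T`, `B ∈ B(E)`, `T ∈ M`. -/
def minTensor {H : Type*} [NormedAddCommGroup H] [InnerProductSpace ℂ H]
    (M : Set (H →L[ℂ] H)) : Submodule ℂ (HTensor E H →L[ℂ] HTensor E H) :=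
  (Submodule.span ℂ {R | ∃ B : E →L[ℂ] E, ∃ T ∈ M, R = opTensor B T}).topologicalClosure

/-- `𝒫`, the norm closure of `span {f^* g : f, g ∈ B(E) ⊗_min 𝒜_n}`. -/
def toeplitzSpace {k : ℕ} (n : Fin k → ℕ) :
    Submodule ℂ (HTensor E (Fock n) →L[ℂ] HTensor E (Fock n)) :=
  (Submodule.span ℂ {R | ∃ f ∈ minTensor E (polyballAlgebra n : Set (Fock n →L[ℂ] Fock n)),
    ∃ g ∈ minTensor E (polyballAlgebra n : Set (Fock n →L[ℂ] Fock n)),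
      R = star f * g}).topologicalClosure

end Spaces

/-! ### The Berezin transform -/

section Berezin

variable {k : ℕ} {n : Fin k → ℕ} {H : Type*}
  [NormedAddCommGroup H] [InnerProductSpace ℂ H] [CompleteSpace H]

/-- The Berezin kernel `K_X h = ∑_β e_β ⊗ Δ_X(I)^{1/2} X_{1,β_1}^* ⋯ X_{k,β_k}^* h`.
For `X` in the polyball `Δ_X(I)` is invertible, so that its range is all of `H`, and the series is
summable in the operator norm (the summands have pairwise orthogonal ranges and
`∑_β X_β Δ_X(I) X_β^*` converges in norm because each `X_i` is a strict row contraction). -/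
def berezinKernel (X : Tuple n H) : H →L[ℂ] HTensor (Fock n) H :=
  ∑' β : Word n, tensorLeft H (basisVec β) ∘L (CFC.sqrt (defectMap X 1) * monomialStar X β)

/-- The extended Berezin transform `(I_E ⊗ K_X^*) (A ⊗ I_H) (I_E ⊗ K_X)`. -/
def berezin {E : Type*} [NormedAddCommGroup E] [InnerProductSpace ℂ E]
    (X : Tuple n H) (A : HTensor E (Fock n) →L[ℂ] HTensor E (Fock n)) :
    HTensor E H →L[ℂ] HTensor E H :=
  opTensor (.id ℂ E) (ContinuousLinearMap.adjoint (berezinKernel X)) ∘L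
    (assocU E (Fock n) H).toContinuousLinearEquiv.toContinuousLinearMap ∘L
    opTensor A (.id ℂ H) ∘L
    (assocU E (Fock n) H).symm.toContinuousLinearEquiv.toContinuousLinearMap ∘L
    opTensor (.id ℂ E) (berezinKernel X)

end Berezin

/-! ### Free `k`-pluriharmonic functions -/

/-- A complex Hilbert space, with its structure bundled. -/
structure HilbSp : Type (v + 1) where
  /-- the underlying type -/
  carrier : Type v
  [normed : NormedAddCommGroup carrier]
  [innerProd : InnerProductSpace ℂ carrier]
  [complete : CompleteSpace carrier]

attribute [instance] HilbSp.normed HilbSp.innerProd HilbSp.complete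

section Series

variable {V : Type*} [AddCommGroup V] [TopologicalSpace V]

/-- Convergence of a series indexed by `ℤ`: the series over `m ≥ 0` and over `m < 0` both
converge (as ordinary series), and `s` is the sum of their sums. -/
def HasIntSum (f : ℤ → V) (s : V) : Prop :=
  ∃ s₁ s₂ : V,
    Tendsto (fun N : ℕ => ∑ p ∈ Finset.range N, f (p : ℤ)) atTop (𝓝 s₁) ∧
    Tendsto (fun N : ℕ => ∑ p ∈ Finset.range N, f (-((p : ℤ) + 1))) atTop (𝓝 s₂) ∧
    s = s₁ + s₂

/-- `∑_{m_1 ∈ ℤ} ⋯ ∑_{m_k ∈ ℤ} f (m_1, …, m_k)` converges, as an iterated series, to `s`. -/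
def HasIterSum : (k : ℕ) → ((Fin k → ℤ) → V) → V → Prop
  | 0, f, s => s = f Fin.elim0
  | k + 1, f, s => ∃ g : ℤ → V,
      (∀ m, HasIterSum k (fun m' => f (Fin.cons m m')) (g m)) ∧ HasIntSum g s

lemma HasIntSum.add [ContinuousAdd V] {f g : ℤ → V} {s t : V} (hf : HasIntSum f s)
    (hg : HasIntSum g t) : HasIntSum (fun m => f m + g m) (s + t) := by
  obtain ⟨s₁, s₂, h₁, h₂, rfl⟩ := hf
  obtain ⟨t₁, t₂, h₃, h₄, rfl⟩ := hg
  refine ⟨s₁ + t₁, s₂ + t₂, ?_, ?_, by abel⟩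
  · simpa only [Finset.sum_add_distrib] using h₁.add h₃
  · simpa only [Finset.sum_add_distrib] using h₂.add h₄

lemma HasIntSum.smul [Module ℂ V] [ContinuousConstSMul ℂ V] (c : ℂ) {f : ℤ → V} {s : V}
    (hf : HasIntSum f s) : HasIntSum (fun m => c • f m) (c • s) := by
  obtain ⟨s₁, s₂, h₁, h₂, rfl⟩ := hf
  refine ⟨c • s₁, c • s₂, ?_, ?_, smul_add _ _ _⟩
  · simpa only [Finset.smul_sum] using h₁.const_smul c
  · simpa only [Finset.smul_sum] using h₂.const_smul c

lemma HasIterSum.add [ContinuousAdd V] : ∀ {k : ℕ} {f g : (Fin k → ℤ) → V} {s t : V},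
    HasIterSum k f s → HasIterSum k g t → HasIterSum k (fun m => f m + g m) (s + t)
  | 0, _, _, _, _, hf, hg => by
      simp only [HasIterSum] at hf hg ⊢
      rw [hf, hg]
  | _ + 1, _, _, _, _, ⟨u, hu, hs⟩, ⟨v, hv, ht⟩ =>
      ⟨fun m => u m + v m, fun m => (hu m).add (hv m), hs.add ht⟩

lemma HasIterSum.smul [Module ℂ V] [ContinuousConstSMul ℂ V] (c : ℂ) :
    ∀ {k : ℕ} {f : (Fin k → ℤ) → V} {s : V},
    HasIterSum k f s → HasIterSum k (fun m => c • f m) (c • s)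
  | 0, _, _, hf => by
      simp only [HasIterSum] at hf ⊢
      rw [hf]
  | _ + 1, _, _, ⟨u, hu, hs⟩ =>
      ⟨fun m => c • u m, fun m => (hu m).smul c, hs.smul c⟩

lemma HasIntSum.zero : HasIntSum (fun _ => (0 : V)) 0 :=
  ⟨0, 0, by simpa using tendsto_const_nhds, by simpa using tendsto_const_nhds, by simp⟩

lemma HasIterSum.zero : ∀ {k : ℕ}, HasIterSum k (fun _ => (0 : V)) 0
  | 0 => rfl
  | _ + 1 => ⟨fun _ => 0, fun _ => HasIterSum.zero, HasIntSum.zero⟩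

end Series

section Pluriharmonic

variable {k : ℕ} (n : Fin k → ℕ) (E : Type u) [NormedAddCommGroup E] [InnerProductSpace ℂ E]

/-- Families of coefficients `A_{(α;β)} ∈ B(E)`. (Only those with `|α_i| = m_i^-`, `|β_i| = m_i^+`
for some `m ∈ ℤ^k` enter the series below.) -/
abbrev Coeff : Type u := Word n → Word n → (E →L[ℂ] E)

variable {n E}

section

variable {H : Type*} [NormedAddCommGroup H] [InnerProductSpace ℂ H] [CompleteSpace H]

/-- The homogeneous part of multidegree `m`: the finite sum, over `|α_i| = m_i^-` and
`|β_i| = m_i^+`, of `A_{(α;β)} ⊗ X_{1,α_1} ⋯ X_{k,α_k} X_{1,β_1}^* ⋯ X_{k,β_k}^*`. -/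
def homPart (C : Coeff n E) (X : Tuple n H) (m : Fin k → ℤ) : HTensor E H →L[ℂ] HTensor E H :=
  ∑ α : ∀ i, Fin (-(m i)).toNat → Fin (n i), ∑ β : ∀ i, Fin (m i).toNat → Fin (n i),
    opTensor (C (fun i => List.ofFn (α i)) (fun i => List.ofFn (β i)))
      (monomial X (fun i => List.ofFn (α i)) * monomialStar X (fun i => List.ofFn (β i)))

/-- The series with coefficients `C` converges at `X`, in the operator norm topology, to `T`. -/
def SeriesAt (C : Coeff n E) (X : Tuple n H) (T : HTensor E H →L[ℂ] HTensor E H) : Prop :=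
  HasIterSum k (homPart C X) T

lemma homPart_add (C D : Coeff n E) (X : Tuple n H) (m : Fin k → ℤ) :
    homPart (C + D) X m = homPart C X m + homPart D X m := by
  simp only [homPart, Pi.add_apply, opTensor_add_left, Finset.sum_add_distrib]

lemma homPart_smul (c : ℂ) (C : Coeff n E) (X : Tuple n H) (m : Fin k → ℤ) :
    homPart (c • C) X m = c • homPart C X m := by
  simp only [homPart, Pi.smul_apply, opTensor_smul_left, Finset.smul_sum]

lemma SeriesAt.add {C D : Coeff n E} {X : Tuple n H} {T R : HTensor E H →L[ℂ] HTensor E H}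
    (hT : SeriesAt C X T) (hR : SeriesAt D X R) : SeriesAt (C + D) X (T + R) := by
  have h : homPart (C + D) X = fun m => homPart C X m + homPart D X m :=
    funext fun m => homPart_add C D X m
  unfold SeriesAt
  rw [h]
  exact HasIterSum.add hT hR

lemma SeriesAt.smul (c : ℂ) {C : Coeff n E} {X : Tuple n H} {T : HTensor E H →L[ℂ] HTensor E H}
    (hT : SeriesAt C X T) : SeriesAt (c • C) X (c • T) := by
  have h : homPart (c • C) X = fun m => c • homPart C X m :=
    funext fun m => homPart_smul c C X m
  unfold SeriesAt
  rw [h]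
  exact HasIterSum.smul c hT

lemma seriesAt_zero (X : Tuple n H) : SeriesAt (0 : Coeff n E) X 0 := by
  have h : homPart (0 : Coeff n E) X = fun _ => 0 := by
    funext m
    simpa using homPart_smul (0 : ℂ) (0 : Coeff n E) X m
  unfold SeriesAt
  rw [h]
  exact HasIterSum.zero

/-- `F` is given on `B_n(H)` by the series with coefficients `C`. -/
def Represents (C : Coeff n E) (F : polyball n H → (HTensor E H →L[ℂ] HTensor E H)) : Prop :=
  ∀ X : polyball n H, SeriesAt C X.1 (F X)

/-- `F` has a continuous extension, in the operator norm topology, to the closed polyball. -/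
def HasContExt (F : polyball n H → (HTensor E H →L[ℂ] HTensor E H)) : Prop :=
  ∃ G : closure (polyball n H) → (HTensor E H →L[ℂ] HTensor E H), Continuous G ∧
    ∀ X : polyball n H, G ⟨X.1, subset_closure X.2⟩ = F X

end

/-- The series with coefficients `C` converges in the operator norm topology at every point of
`B_n(H)`, for every Hilbert space `H`. -/
def ConvergesOnPolyball (C : Coeff n E) : Prop :=
  ∀ H : HilbSp.{v}, ∀ X ∈ polyball n H.carrier, ∃ T, SeriesAt C X T

/-- `F(rS)`, `0 ≤ r < 1`, the value at `rS` of the series with coefficients `C`, converges in the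
operator norm to `A` as `r → 1`. -/
def RadialLimit (C : Coeff n E) (A : HTensor E (Fock n) →L[ℂ] HTensor E (Fock n)) : Prop :=
  ∃ G : ℝ → (HTensor E (Fock n) →L[ℂ] HTensor E (Fock n)),
    (∀ r ∈ Set.Ico (0 : ℝ) 1, SeriesAt C ((r : ℂ) • universalModel n) (G r)) ∧
    Tendsto G (𝓝[<] 1) (𝓝 A)

variable (n E) in
/-- Functions on the abstract polyball `B_n = {B_n(H) : H a Hilbert space}`, with values in
`B(E ⊗ H)` on `B_n(H)`. -/
abbrev PolyballFun : Type (max u (v + 1)) :=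
  ∀ H : HilbSp.{v}, polyball n H.carrier → (HTensor E H.carrier →L[ℂ] HTensor E H.carrier)

variable (n E) in
/-- The space of free `k`-pluriharmonic functions on `B_n` with coefficients in `B(E)` which, for
every Hilbert space `H`, extend continuously to the closed polyball `B_n(H)^-`. -/
def PHc : Submodule ℂ (PolyballFun.{u, v} n E) where
  carrier := {F | (∃ C : Coeff n E, ∀ H, Represents C (F H)) ∧ ∀ H, HasContExt (F H)}
  zero_mem' := ⟨⟨0, fun _ X => seriesAt_zero X.1⟩,
    fun _ => ⟨fun _ => 0, continuous_const, fun _ => rfl⟩⟩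
  add_mem' := by
    rintro F F' ⟨⟨C, hC⟩, hF⟩ ⟨⟨C', hC'⟩, hF'⟩
    refine ⟨⟨C + C', fun H X => (hC H X).add (hC' H X)⟩, fun H => ?_⟩
    obtain ⟨G, hG, hGF⟩ := hF H
    obtain ⟨G', hG', hGF'⟩ := hF' H
    refine ⟨fun X => G X + G' X, hG.add hG', fun X => ?_⟩
    exact congrArg₂ (· + ·) (hGF X) (hGF' X)
  smul_mem' := by
    rintro c F ⟨⟨C, hC⟩, hF⟩
    refine ⟨⟨c • C, fun H X => (hC H X).smul c⟩, fun H => ?_⟩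
    obtain ⟨G, hG, hGF⟩ := hF H
    refine ⟨fun X => c • G X, hG.const_smul c, fun X => ?_⟩
    exact congrArg (c • ·) (hGF X)

end Pluriharmonic

/-- The operator on the Hilbert space `K ⊕ ⋯ ⊕ K` (`d` summands) with operator matrix `[A_{ij}]`. -/
def opMatrix {K : Type*} [NormedAddCommGroup K] [InnerProductSpace ℂ K] {d : ℕ}
    (A : Matrix (Fin d) (Fin d) (K →L[ℂ] K)) :
    PiLp 2 (fun _ : Fin d => K) →L[ℂ] PiLp 2 (fun _ : Fin d => K) :=
  (PiLp.continuousLinearEquiv 2 ℂ (fun _ : Fin d => K)).symm.toContinuousLinearMap ∘L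
    ContinuousLinearMap.pi fun i => ∑ j, A i j ∘L PiLp.proj 2 (fun _ : Fin d => K) j

end

end RegularPolyball

open RegularPolyball

/-!
The link between functions on the polyball and operators on `E ⊗ F²` is the Berezin kernel `K_X`.
The sum `∑_β X_β Δ_X(I) X_β^*` telescopes to `I` (`sum_monomial_conj_defect`), so `K_X` is an
isometry (`inner_berezinKernel`); its adjoint intertwines the universal model `S` with `X`
(`berezinKernel_adjoint_intertwine`). Hence the Berezin transform is completely contractive
(`norm_opMatrix_berezin_le`) and sends `B ⊗ S_α S_β^*` to `B ⊗ X_α X_β^*` (`berezin_monomial`).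

The products `S_α^* S_β` reduce to `0` or to `S_γ S_δ^*` where, in each coordinate, `γ` or `δ` is
empty. So `𝒫` is the closed span of such normal-form monomials
(`toeplitzSpace_le_closure_polySpan`, `polySpan_le_toeplitzSpace`), and their coefficients can be
read off from the matrix entries at the pairs `(e_α, e_β)` of basis vectors (`coeffOf_monomial`).

For `A ∈ 𝒫` let `coeffOf A` be the family of its matrix entries. Averaging over the torus bounds
every homogeneous part of the associated series on the polyball by `‖A‖`
(`norm_homPart_coeffOf_le`). Every point of the polyball has the form `ρ Y` with `ρ < 1` and `Y`
in the polyball (`exists_smul_mem_polyball`), and the homogeneous part of degree `m` at `ρ Y`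
carries the factor `ρ^{|m_1| + ⋯ + |m_k|}`. The series therefore converges absolutely, and its sum
is the Berezin transform of `A` (`seriesAt_berezin`). Approximation by polynomials also shows that
this function extends continuously to the closed polyball (`hasContExt_berezin`) and that its
values at `r S` tend to `A` (`tendsto_berezin`).

Conversely, if the values `F(r S)` of a free pluriharmonic function converge to `A`, then `A ∈ 𝒫`
because `𝒫` is closed and contains the homogeneous parts at `r S`
(`RadialLimit.mem_toeplitzSpace`), and the matrix entries of `A` are the coefficients of `F`
(`RadialLimit.coeffOf_eq`); hence `F` is the Berezin transform of `A` (`RadialLimit.eq_berezin`).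
Convergence of `F(r S)` follows from a continuous extension on a single Hilbert space `H` that
contains an isometric copy `V F²` of the Fock space: the path `r V S V^*` ends in the closed
polyball of `H`, and compression by `V` turns the values of `F` along it into the values `F(r S)`
(`exists_radialLimit_of_hasContExt`). Every infinite-dimensional `H` contains such a copy.

The Berezin transform is thus a linear bijection from `𝒫` onto the functions with a continuous
extension, and `Φ` is its inverse. It is completely isometric since it is completely contractive
and the radial limits recover the matrix norms over `𝒫` (`isLUB_norm_opMatrix_berezin`).
-/

namespace RegularPolyball

noncomputable section

/-! ### Operators on Hilbert tensor products -/

section HilbertTensorLemmas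

variable {E F G E' F' G' E'' F'' : Type*}
  [NormedAddCommGroup E] [InnerProductSpace ℂ E] [NormedAddCommGroup F] [InnerProductSpace ℂ F]
  [NormedAddCommGroup G] [InnerProductSpace ℂ G]
  [NormedAddCommGroup E'] [InnerProductSpace ℂ E'] [NormedAddCommGroup F'] [InnerProductSpace ℂ F']
  [NormedAddCommGroup G'] [InnerProductSpace ℂ G']
  [NormedAddCommGroup E''] [InnerProductSpace ℂ E'']
  [NormedAddCommGroup F''] [InnerProductSpace ℂ F'']

/-- The elementary tensor `x ⊗ y` in the Hilbert tensor product. -/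
def hmul (x : E) (y : F) : HTensor E F := inclT E F (x ⊗ₜ[ℂ] y)

lemma inner_hmul (x x' : E) (y y' : F) :
    inner ℂ (hmul x y) (hmul x' y') = inner ℂ x x' * inner ℂ y y' := by
  rw [hmul, hmul, LinearIsometry.inner_map_map, TensorProduct.inner_tmul]

lemma opTensor_hmul (S : E →L[ℂ] E') (T : F →L[ℂ] F') (x : E) (y : F) :
    opTensor S T (hmul x y) = hmul (S x) (T y) := by
  rw [hmul, opTensor_inclT, TensorProduct.mapL_tmul]; rfl

lemma tensorLeft_apply (x : E) (y : F) : tensorLeft F x y = hmul x y := rfl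

/-- Bounded operators on `E ⊗ F` that agree on elementary tensors are equal. -/
lemma hmul_ext {Z : Type*} [NormedAddCommGroup Z] [NormedSpace ℂ Z] {T T' : HTensor E F →L[ℂ] Z}
    (h : ∀ x y, T (hmul x y) = T' (hmul x y)) : T = T' := by
  apply ContinuousLinearMap.coeFn_injective
  refine denseRange_inclT.equalizer T.continuous T'.continuous (funext fun z => ?_)
  induction z with
  | zero => simp
  | tmul x y => exact h x y
  | add a b ha hb =>
    simp only [Function.comp_apply, map_add] at ha hb ⊢
    rw [ha, hb]

lemma opTensor_comp (S' : E' →L[ℂ] E'') (S : E →L[ℂ] E') (T' : F' →L[ℂ] F'') (T : F →L[ℂ] F') :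
    opTensor (S' ∘L S) (T' ∘L T) = opTensor S' T' ∘L opTensor S T :=
  hmul_ext fun x y => by simp [opTensor_hmul]

lemma opTensor_mul (S' S : E →L[ℂ] E) (T' T : F →L[ℂ] F) :
    opTensor (S' * S) (T' * T) = opTensor S' T' * opTensor S T :=
  opTensor_comp S' S T' T

lemma opTensor_id : opTensor (.id ℂ E) (.id ℂ F) = .id ℂ (HTensor E F) :=
  hmul_ext fun x y => by simp [opTensor_hmul]

lemma hmul_add_right (x : E) (y y' : F) : hmul x (y + y') = hmul x y + hmul x y' := by
  simp only [hmul, TensorProduct.tmul_add, map_add]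

lemma hmul_smul_right (c : ℂ) (x : E) (y : F) : hmul x (c • y) = c • hmul x y := by
  simp only [hmul, TensorProduct.tmul_smul, map_smul]

lemma norm_opTensor_le (S : E →L[ℂ] E') (T : F →L[ℂ] F') : ‖opTensor S T‖ ≤ ‖S‖ * ‖T‖ := by
  refine ContinuousLinearMap.opNorm_le_bound _ (by positivity) fun z => ?_
  refine denseRange_inclT.induction_on (p := fun z => ‖opTensor S T z‖ ≤ ‖S‖ * ‖T‖ * ‖z‖) z
    (isClosed_le (by fun_prop) (by fun_prop)) fun w => ?_
  rw [opTensor_inclT, LinearIsometry.norm_map, LinearIsometry.norm_map]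
  exact (ContinuousLinearMap.le_opNorm _ _).trans
    (mul_le_mul_of_nonneg_right (TensorProduct.norm_mapL_le S T) (norm_nonneg _))

/-- `opTensor` as a continuous bilinear map. -/
def opTensorL (E E' F F' : Type*)
    [NormedAddCommGroup E] [InnerProductSpace ℂ E] [NormedAddCommGroup F] [InnerProductSpace ℂ F]
    [NormedAddCommGroup E'] [InnerProductSpace ℂ E']
    [NormedAddCommGroup F'] [InnerProductSpace ℂ F'] :
    (E →L[ℂ] E') →L[ℂ] (F →L[ℂ] F') →L[ℂ] (HTensor E F →L[ℂ] HTensor E' F') :=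
  LinearMap.mkContinuous₂ (LinearMap.mk₂ ℂ opTensor opTensor_add_left opTensor_smul_left
    (fun S T T' => hmul_ext fun x y => by
      simp [opTensor_hmul, hmul_add_right])
    (fun c S T => hmul_ext fun x y => by
      simp [opTensor_hmul, hmul_smul_right])) 1 fun S T => by
        simpa using norm_opTensor_le S T

lemma opTensorL_apply (S : E →L[ℂ] E') (T : F →L[ℂ] F') :
    opTensorL E E' F F' S T = opTensor S T := rfl

lemma opTensor_zero_right (S : E →L[ℂ] E') : opTensor S (0 : F →L[ℂ] F') = 0 :=
  (opTensorL E E' F F' S).map_zero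

lemma opTensor_zero_left (T : F →L[ℂ] F') : opTensor (0 : E →L[ℂ] E') T = 0 := by
  rw [← opTensorL_apply, map_zero, _root_.zero_apply]

lemma opTensor_smul_right (c : ℂ) (S : E →L[ℂ] E') (T : F →L[ℂ] F') :
    opTensor S (c • T) = c • opTensor S T :=
  (opTensorL E E' F F' S).map_smul c T

lemma hmul_inner_ext {z z' : HTensor E F}
    (h : ∀ x y, inner ℂ (hmul x y) z = inner ℂ (hmul x y) z') : z = z' := by
  have : innerSL ℂ z = innerSL ℂ z' := hmul_ext fun x y => by
    have := congrArg (starRingEnd ℂ) (h x y)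
    simpa only [innerSL_apply_apply, inner_conj_symm] using this
  refine ext_inner_right ℂ fun w => ?_
  exact DFunLike.congr_fun this w

lemma adjoint_opTensor [CompleteSpace E] [CompleteSpace F] [CompleteSpace E'] [CompleteSpace F']
    (S : E →L[ℂ] E') (T : F →L[ℂ] F') :
    (opTensor S T).adjoint = opTensor S.adjoint T.adjoint := by
  refine hmul_ext fun x y => hmul_inner_ext fun x' y' => ?_
  rw [ContinuousLinearMap.adjoint_inner_right, opTensor_hmul, opTensor_hmul, inner_hmul,
    inner_hmul, ContinuousLinearMap.adjoint_inner_right, ContinuousLinearMap.adjoint_inner_right]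

lemma star_opTensor [CompleteSpace E] [CompleteSpace F] (S : E →L[ℂ] E) (T : F →L[ℂ] F) :
    star (opTensor S T) = opTensor (star S) (star T) :=
  adjoint_opTensor S T

/-- The operator `x ↦ x ⊗ y`. -/
def tensorRight (E : Type*) [NormedAddCommGroup E] [InnerProductSpace ℂ E] (y : F) :
    E →L[ℂ] HTensor E F :=
  (inclT E F).toContinuousLinearMap ∘L (TensorProduct.mkL ℂ E F).flip y

lemma tensorRight_apply (y : F) (x : E) : tensorRight E y x = hmul x y := rfl

lemma hmul_ext₂ {Z : Type*} [NormedAddCommGroup Z] [NormedSpace ℂ Z]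
    {T T' : HTensor (HTensor E F) G →L[ℂ] Z}
    (h : ∀ x y z, T (hmul (hmul x y) z) = T' (hmul (hmul x y) z)) : T = T' := by
  refine hmul_ext fun w z => ?_
  have h' : T ∘L tensorRight (HTensor E F) z = T' ∘L tensorRight (HTensor E F) z :=
    hmul_ext fun x y => h x y z
  exact DFunLike.congr_fun h' w

lemma assocU_hmul (x : E) (y : F) (z : G) :
    assocU E F G (hmul (hmul x y) z) = hmul x (hmul y z) := by
  unfold assocU
  exact LinearEquiv.extendOfIsometry_eq (f := TensorProduct.assoc ℂ E F G)
    (e₁ := (inclT (HTensor E F) G).toLinearMap ∘ₗ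
      TensorProduct.map (inclT E F).toLinearMap (LinearMap.id (R := ℂ) (M := G)))
    (e₂ := (inclT E (HTensor F G)).toLinearMap ∘ₗ
      TensorProduct.map (LinearMap.id (R := ℂ) (M := E)) (inclT F G).toLinearMap)
    denseRange_assoc_left denseRange_assoc_right _ ((x ⊗ₜ y) ⊗ₜ z)

/-- `assocU` as a bounded operator. -/
def assocL (E F G : Type*) [NormedAddCommGroup E] [InnerProductSpace ℂ E]
    [NormedAddCommGroup F] [InnerProductSpace ℂ F] [NormedAddCommGroup G] [InnerProductSpace ℂ G] :
    HTensor (HTensor E F) G →L[ℂ] HTensor E (HTensor F G) :=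
  (assocU E F G).toContinuousLinearEquiv.toContinuousLinearMap

/-- The inverse of `assocU` as a bounded operator. -/
def assocSymmL (E F G : Type*) [NormedAddCommGroup E] [InnerProductSpace ℂ E]
    [NormedAddCommGroup F] [InnerProductSpace ℂ F] [NormedAddCommGroup G] [InnerProductSpace ℂ G] :
    HTensor E (HTensor F G) →L[ℂ] HTensor (HTensor E F) G :=
  (assocU E F G).symm.toContinuousLinearEquiv.toContinuousLinearMap

lemma assocL_hmul (x : E) (y : F) (z : G) :
    assocL E F G (hmul (hmul x y) z) = hmul x (hmul y z) := assocU_hmul x y z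

lemma assocL_comp_symm : assocL E F G ∘L assocSymmL E F G = .id ℂ _ :=
  ContinuousLinearMap.ext fun z => (assocU E F G).apply_symm_apply z

lemma assocL_adjoint : (assocL E F G).adjoint = assocSymmL E F G :=
  LinearIsometryEquiv.adjoint_eq_symm (assocU E F G)

lemma assocSymmL_adjoint : (assocSymmL E F G).adjoint = assocL E F G := by
  rw [← assocL_adjoint, ContinuousLinearMap.adjoint_adjoint]

lemma assocL_opTensor (S : E →L[ℂ] E') (T : F →L[ℂ] F') (R : G →L[ℂ] G') :
    assocL E' F' G' ∘L opTensor (opTensor S T) R =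
      opTensor S (opTensor T R) ∘L assocL E F G := by
  refine hmul_ext₂ fun x y z => ?_
  simp only [ContinuousLinearMap.comp_apply, opTensor_hmul, assocL_hmul]

end HilbertTensorLemmas

/-! ### Iterated series over `ℤ^k` -/

section IterSum

variable {V W : Type*} [AddCommGroup V] [TopologicalSpace V] [AddCommGroup W] [TopologicalSpace W]

lemma HasIntSum.unique [T2Space V] {f : ℤ → V} {s t : V} (hs : HasIntSum f s)
    (ht : HasIntSum f t) : s = t := by
  obtain ⟨s₁, s₂, h₁, h₂, rfl⟩ := hs
  obtain ⟨t₁, t₂, h₃, h₄, rfl⟩ := ht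
  rw [tendsto_nhds_unique h₁ h₃, tendsto_nhds_unique h₂ h₄]

lemma HasIterSum.unique [T2Space V] : ∀ {k : ℕ} {f : (Fin k → ℤ) → V} {s t : V},
    HasIterSum k f s → HasIterSum k f t → s = t
  | 0, _, _, _, hs, ht => by
    simp only [HasIterSum] at hs ht
    rw [hs, ht]
  | _ + 1, _, _, _, ⟨u, hu, hs⟩, ⟨v, hv, ht⟩ => by
    have : u = v := funext fun m => (hu m).unique (hv m)
    subst this
    exact hs.unique ht

lemma HasIntSum.map {f : ℤ → V} {s : V} (hf : HasIntSum f s) (L : V →+ W) (hL : Continuous L) :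
    HasIntSum (fun m => L (f m)) (L s) := by
  obtain ⟨s₁, s₂, h₁, h₂, rfl⟩ := hf
  refine ⟨L s₁, L s₂, ?_, ?_, map_add _ _ _⟩
  · simpa only [map_sum, Function.comp_def] using (hL.tendsto _).comp h₁
  · simpa only [map_sum, Function.comp_def] using (hL.tendsto _).comp h₂

lemma HasIterSum.map (L : V →+ W) (hL : Continuous L) : ∀ {k : ℕ} {f : (Fin k → ℤ) → V} {s : V},
    HasIterSum k f s → HasIterSum k (fun m => L (f m)) (L s)
  | 0, _, _, hf => by
    simp only [HasIterSum] at hf ⊢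
    rw [hf]
  | _ + 1, _, _, ⟨u, hu, hs⟩ =>
    ⟨fun m => L (u m), fun m => (hu m).map L hL, hs.map L hL⟩

lemma HasIntSum.mem [ContinuousAdd V] (P : AddSubgroup V) (hP : IsClosed (P : Set V))
    {f : ℤ → V} {s : V} (hf : HasIntSum f s) (h : ∀ m, f m ∈ P) : s ∈ P := by
  obtain ⟨s₁, s₂, h₁, h₂, rfl⟩ := hf
  exact P.add_mem (hP.mem_of_tendsto h₁ (.of_forall fun N => P.sum_mem fun p _ => h _))
    (hP.mem_of_tendsto h₂ (.of_forall fun N => P.sum_mem fun p _ => h _))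

lemma HasIterSum.mem [ContinuousAdd V] (P : AddSubgroup V) (hP : IsClosed (P : Set V)) :
    ∀ {k : ℕ} {f : (Fin k → ℤ) → V} {s : V}, HasIterSum k f s → (∀ m, f m ∈ P) → s ∈ P
  | 0, _, _, hf, h => by
    simp only [HasIterSum] at hf
    rw [hf]
    exact h _
  | _ + 1, _, _, ⟨_, hu, hs⟩, h => hs.mem P hP fun m => (hu m).mem P hP fun m' => h _

end IterSum

section Summable

variable {V : Type*} [NormedAddCommGroup V] [CompleteSpace V]

lemma hasIntSum_of_summable {f : ℤ → V} (hf : Summable f) : HasIntSum f (∑' m, f m) := by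
  have h1 : Summable fun p : ℕ => f p := hf.comp_injective Nat.cast_injective
  have h2 : Summable fun p : ℕ => f (-((p : ℤ) + 1)) :=
    hf.comp_injective fun p q h => by simpa using h
  exact ⟨_, _, h1.hasSum.tendsto_sum_nat, h2.hasSum.tendsto_sum_nat,
    (h1.hasSum.of_nat_of_neg_add_one h2.hasSum).tsum_eq⟩

/-- An absolutely convergent multiple series converges as an iterated series, to the same sum. -/
lemma hasIterSum_of_summable : ∀ {k : ℕ} {f : (Fin k → ℤ) → V}, Summable f →
    HasIterSum k f (∑' m, f m)
  | 0, f, _ => by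
    simp only [HasIterSum]
    rw [tsum_eq_single Fin.elim0 fun m hm => absurd (Subsingleton.elim _ _) hm]
  | k + 1, f, hf => by
    have hf' : Summable (f ∘ Fin.consEquiv fun _ : Fin (k + 1) => ℤ) :=
      (Equiv.summable_iff _).mpr hf
    have hfib := hf'.prod_factor
    refine ⟨fun m => ∑' m', f (Fin.cons m m'), fun m => hasIterSum_of_summable (hfib m), ?_⟩
    have h2 : ∑' m, f m = ∑' m, ∑' m', f (Fin.cons m m') := by
      rw [← (Fin.consEquiv fun _ : Fin (k + 1) => ℤ).tsum_eq f]
      exact hf'.tsum_prod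
    rw [h2]
    exact hasIntSum_of_summable hf'.prod

lemma summable_prod_fin {ι : Type*} : ∀ {k : ℕ} {f : Fin k → ι → ℝ}, (∀ i a, 0 ≤ f i a) →
    (∀ i, Summable (f i)) → Summable fun m : Fin k → ι => ∏ i, f i (m i)
  | 0, _, _, _ => (hasSum_fintype _).summable
  | k + 1, f, h0, hf => by
    rw [← (Fin.consEquiv fun _ : Fin (k + 1) => ι).summable_iff]
    have := (hf 0).mul_of_nonneg
      (summable_prod_fin (fun i a => h0 (Fin.succ i) a) fun i => hf i.succ)
      (fun a => h0 0 a) fun m => Finset.prod_nonneg fun i _ => h0 _ _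
    refine this.congr fun p => ?_
    simp [Fin.consEquiv, Fin.prod_univ_succ]

lemma summable_pow_natAbs {r : ℝ} (h0 : 0 ≤ r) (h1 : r < 1) :
    Summable fun m : ℤ => r ^ m.natAbs := by
  have h := summable_geometric_of_lt_one h0 h1
  refine Summable.of_nat_of_neg (by simpa using h) (by simpa using h)

end Summable

/-! ### Fourier coefficients on the torus -/

lemma integral_fourier_haar (m : ℤ) :
    ∫ t : AddCircle (1 : ℝ), fourier m t ∂AddCircle.haarAddCircle = if m = 0 then 1 else 0 := by
  have h := (orthonormal_iff_ite.mp (orthonormal_fourier (T := 1))) 0 m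
  rw [MeasureTheory.ContinuousMap.inner_toLp] at h
  simpa [eq_comm] using h

lemma integral_prod_fourier {k : ℕ} (m : Fin k → ℤ) :
    ∫ t : Fin k → AddCircle (1 : ℝ), ∏ i, fourier (m i) (t i)
      ∂(MeasureTheory.Measure.pi fun _ => AddCircle.haarAddCircle) = if m = 0 then 1 else 0 := by
  rw [MeasureTheory.integral_fintype_prod_eq_prod
    (f := fun (i : Fin k) (t : AddCircle (1 : ℝ)) => (fourier (m i) t : ℂ))]
  simp only [integral_fourier_haar]
  by_cases h : m = 0
  · simp [h]
  · obtain ⟨i, hi⟩ := Function.ne_iff.mp h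
    rw [if_neg h]
    exact Finset.prod_eq_zero (Finset.mem_univ i) (if_neg hi)

/-- The coefficients of a trigonometric polynomial on `𝕋^k` with values in a normed space are
bounded by its supremum norm. -/
lemma norm_coeff_le_of_trigPoly {V : Type*} [NormedAddCommGroup V] [NormedSpace ℂ V]
    [CompleteSpace V] {k : ℕ} (s : Finset (Fin k → ℤ)) (c : (Fin k → ℤ) → V) (M : ℝ)
    (h : ∀ z : Fin k → Circle, ‖∑ m ∈ s, (∏ i, (z i : ℂ) ^ (m i)) • c m‖ ≤ M) {m₀ : Fin k → ℤ}
    (hm₀ : m₀ ∈ s) : ‖c m₀‖ ≤ M := by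
  classical
  set μ : MeasureTheory.Measure (Fin k → AddCircle (1 : ℝ)) :=
    MeasureTheory.Measure.pi fun _ => AddCircle.haarAddCircle with hμ
  set φ : (Fin k → AddCircle (1 : ℝ)) → V := fun t =>
    (∏ i, fourier (-m₀ i) (t i)) • ∑ m ∈ s, (∏ i, fourier (m i) (t i)) • c m with hφ
  have hφ' : φ = fun t => ∑ m ∈ s, (∏ i, fourier ((m - m₀) i) (t i)) • c m := by
    funext t
    simp only [hφ, Finset.smul_sum, smul_smul, ← Finset.prod_mul_distrib, ← fourier_add,
      Pi.sub_apply]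
    refine Finset.sum_congr rfl fun m _ => ?_
    congr 1
    refine Finset.prod_congr rfl fun i _ => ?_
    congr 2
    ring
  -- The integral against the character of degree `-m₀` isolates the coefficient of degree `m₀`.
  have key : ∫ t, φ t ∂μ = c m₀ := by
    rw [hφ', MeasureTheory.integral_finsetSum]
    · simp only [integral_smul_const, hμ, integral_prod_fourier, sub_eq_zero]
      simp [hm₀]
    · intro m _
      refine Continuous.integrable_of_hasCompactSupport (by fun_prop)
        (HasCompactSupport.of_compactSpace _)
  have hb : ∀ t, ‖φ t‖ ≤ M := fun t => by
    have h1 := h fun i => AddCircle.toCircle (t i)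
    have h2 : ∀ m : Fin k → ℤ, (∏ i, fourier (m i) (t i)) =
        ∏ i, ((AddCircle.toCircle (t i) : Circle) : ℂ) ^ (m i) := fun m =>
      Finset.prod_congr rfl fun i _ => by
        rw [fourier_apply, AddCircle.toCircle_zsmul, Circle.coe_zpow]
    simp only [hφ, norm_smul, norm_prod, fourier_apply, Circle.norm_coe, Finset.prod_const_one,
      one_mul]
    simpa only [← h2, fourier_apply] using h1
  rw [← key]
  simpa using MeasureTheory.norm_integral_le_of_norm_le_const (μ := μ) (.of_forall hb)

/-! ### Operator matrices -/

section OpMatrix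

variable {K L : Type*} [NormedAddCommGroup K] [InnerProductSpace ℂ K]
  [NormedAddCommGroup L] [InnerProductSpace ℂ L] {d : ℕ}

lemma opMatrix_apply (A : Matrix (Fin d) (Fin d) (K →L[ℂ] K)) (x : PiLp 2 fun _ : Fin d => K)
    (i : Fin d) : opMatrix A x i = ∑ j, A i j (x j) := by
  simp [opMatrix]

/-- Compressing an operator `T` along isometries with pairwise orthogonal ranges, block by block,
does not increase the norm. -/
lemma norm_opMatrix_compress_le [CompleteSpace K] [CompleteSpace L] (R : Fin d → K →L[ℂ] L)
    (hR : ∀ i j x y, inner ℂ (R i x) (R j y) = if i = j then inner ℂ x y else 0) (T : L →L[ℂ] L) :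
    ‖opMatrix (Matrix.of fun i j => (R i).adjoint ∘L T ∘L R j)‖ ≤ ‖T‖ := by
  set J : (PiLp 2 fun _ : Fin d => K) →L[ℂ] L :=
    ∑ j, R j ∘L PiLp.proj 2 (fun _ : Fin d => K) j with hJdef
  have hJ : ∀ x, J x = ∑ j, R j (x j) := fun x => by simp [hJdef, sum_apply]
  have hJn : ∀ x, ‖J x‖ = ‖x‖ := fun x => by
    have : inner ℂ (J x) (J x) = inner ℂ x x := by
      rw [hJ, PiLp.inner_apply, sum_inner]
      refine Finset.sum_congr rfl fun i _ => ?_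
      rw [inner_sum]
      simp [hR]
    rw [@norm_eq_sqrt_re_inner ℂ, this, ← @norm_eq_sqrt_re_inner ℂ]
  have hop : opMatrix (Matrix.of fun i j => (R i).adjoint ∘L T ∘L R j) = J.adjoint ∘L T ∘L J := by
    refine ContinuousLinearMap.ext fun x => ext_inner_left ℂ fun y => ?_
    rw [ContinuousLinearMap.comp_apply, ContinuousLinearMap.adjoint_inner_right, hJ y,
      PiLp.inner_apply, sum_inner]
    refine Finset.sum_congr rfl fun i _ => ?_
    rw [opMatrix_apply, ContinuousLinearMap.comp_apply, hJ x]
    simp only [Matrix.of_apply, ContinuousLinearMap.comp_apply, map_sum, inner_sum,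
      ContinuousLinearMap.adjoint_inner_right]
  have hJ1 : ‖J‖ ≤ 1 := J.opNorm_le_bound zero_le_one fun x => by rw [hJn, one_mul]
  rw [hop]
  calc ‖J.adjoint ∘L T ∘L J‖ ≤ ‖J.adjoint‖ * ‖T ∘L J‖ := ContinuousLinearMap.opNorm_comp_le _ _
    _ ≤ ‖J.adjoint‖ * (‖T‖ * ‖J‖) := by gcongr; exact ContinuousLinearMap.opNorm_comp_le _ _
    _ ≤ 1 * (‖T‖ * 1) := by
      have : ‖J.adjoint‖ ≤ 1 := by simpa using hJ1
      gcongr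
    _ = ‖T‖ := by ring

/-- The inclusion of the `i`-th summand of `K ⊕ ⋯ ⊕ K`. -/
def inclusionL (K : Type*) [NormedAddCommGroup K] [InnerProductSpace ℂ K] {d : ℕ} (i : Fin d) :
    K →L[ℂ] PiLp 2 fun _ : Fin d => K :=
  (PiLp.continuousLinearEquiv 2 ℂ (fun _ : Fin d => K)).symm.toContinuousLinearMap ∘L
    ContinuousLinearMap.single ℂ (fun _ : Fin d => K) i

lemma inclusionL_apply (i j : Fin d) (x : K) :
    inclusionL K i x j = if j = i then x else 0 := by
  simp [inclusionL]

lemma inner_inclusionL (i j : Fin d) (x y : K) :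
    inner ℂ (inclusionL K i x) (inclusionL K j y) = if i = j then inner ℂ x y else 0 := by
  rw [PiLp.inner_apply]
  simp only [inclusionL_apply]
  rw [Finset.sum_eq_single i]
  · rw [if_pos rfl]
    split_ifs <;> simp
  · intro l _ hl
    simp [hl]
  · simp

lemma inner_inclusionL_left (i : Fin d) (x : K) (y : PiLp 2 fun _ : Fin d => K) :
    inner ℂ (inclusionL K i x) y = inner ℂ x (y i) := by
  rw [PiLp.inner_apply]
  simp only [inclusionL_apply]
  rw [Finset.sum_eq_single i]
  · simp
  · intro l _ hl
    simp [hl]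
  · simp

lemma inclusionL_adjoint_comp [CompleteSpace K] (A : Matrix (Fin d) (Fin d) (K →L[ℂ] K))
    (i j : Fin d) : (inclusionL K i).adjoint ∘L opMatrix A ∘L inclusionL K j = A i j := by
  refine ContinuousLinearMap.ext fun x => ext_inner_left ℂ fun y => ?_
  rw [ContinuousLinearMap.comp_apply, ContinuousLinearMap.adjoint_inner_right,
    inner_inclusionL_left, ContinuousLinearMap.comp_apply, opMatrix_apply]
  simp only [inclusionL_apply, apply_ite, map_zero, Finset.sum_ite_eq', Finset.mem_univ, if_true]

set_option synthInstance.maxHeartbeats 200000 in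
lemma continuous_opMatrix :
    Continuous fun A : Matrix (Fin d) (Fin d) (K →L[ℂ] K) => opMatrix A := by
  have h : (fun A : Matrix (Fin d) (Fin d) (K →L[ℂ] K) => opMatrix A) = fun A =>
      ∑ i, ∑ j, inclusionL K i ∘L A i j ∘L PiLp.proj 2 (fun _ : Fin d => K) j := by
    funext A
    ext x l
    rw [opMatrix_apply]
    simp [sum_apply, inclusionL_apply]
  rw [h]
  refine continuous_finsetSum _ fun i _ => continuous_finsetSum _ fun j _ => ?_
  exact continuous_const.clm_comp ((continuous_apply_apply i j).clm_comp continuous_const)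

end OpMatrix

/-! ### Ordered products over `Fin k` -/

section OfFn

variable {k : ℕ}

lemma prod_ofFn_succ {M : Type*} [Monoid M] (f : Fin (k + 1) → M) :
    (List.ofFn f).prod = f 0 * (List.ofFn fun i : Fin k => f i.succ).prod := by
  rw [List.ofFn_succ, List.prod_cons]

lemma commute_prod_ofFn {M : Type*} [Monoid M] {k : ℕ} {f : Fin k → M} {x : M}
    (h : ∀ i, Commute x (f i)) : Commute x (List.ofFn f).prod :=
  Commute.list_prod_right _ _ fun y hy => by
    obtain ⟨i, rfl⟩ := (List.mem_ofFn' f y).mp hy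
    exact h i

/-- Distributivity, for products of non-commuting sums. -/
lemma sum_piFinset_prod_ofFn {R : Type*} [Semiring R] : ∀ {k : ℕ} {α : Fin k → Type*}
    (s : ∀ i, Finset (α i)) (f : ∀ i, α i → R),
    ∑ β ∈ Fintype.piFinset s, (List.ofFn fun i => f i (β i)).prod =
      (List.ofFn fun i => ∑ b ∈ s i, f i b).prod
  | 0, α, s, f => by
    have : Fintype.piFinset s = Finset.univ := by
      ext x
      simp
    rw [this]
    simp
  | k + 1, α, s, f => by
    rw [prod_ofFn_succ, ← sum_piFinset_prod_ofFn (fun i : Fin k => s i.succ), Finset.sum_mul_sum,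
      ← Finset.sum_product']
    symm
    refine Finset.sum_bij' (fun p _ => Fin.cons p.1 p.2) (fun β _ => (β 0, fun i => β i.succ))
      ?_ ?_ ?_ ?_ ?_
    · rintro ⟨a, b⟩ h
      simp only [Finset.mem_product, Fintype.mem_piFinset] at h ⊢
      exact Fin.cases h.1 h.2
    · intro β h
      simp only [Finset.mem_product, Fintype.mem_piFinset] at h ⊢
      exact ⟨h 0, fun i => h i.succ⟩
    · rintro ⟨a, b⟩ _
      simp
    · intro β _
      exact Fin.cons_self_tail β
    · rintro ⟨a, b⟩ _
      rw [prod_ofFn_succ]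
      simp

lemma prod_ofFn_mul_prod_ofFn {M : Type*} [Monoid M] : ∀ {k : ℕ} {f g : Fin k → M},
    (∀ i j, i ≠ j → Commute (f i) (g j)) →
    (List.ofFn f).prod * (List.ofFn g).prod = (List.ofFn fun i => f i * g i).prod
  | 0, f, g, _ => by simp
  | k + 1, f, g, h => by
    have h1 : Commute (g 0) (List.ofFn fun i : Fin k => f i.succ).prod :=
      commute_prod_ofFn fun i => (h _ _ (Fin.succ_ne_zero i)).symm
    rw [prod_ofFn_succ, prod_ofFn_succ, prod_ofFn_succ (fun i => f i * g i),
      ← prod_ofFn_mul_prod_ofFn (fun i j hij => h i.succ j.succ (by simpa using hij)),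
      mul_assoc, ← mul_assoc _ (g 0), ← h1.eq]
    simp only [mul_assoc]

lemma star_prod_ofFn {M : Type*} [Monoid M] [StarMul M] : ∀ {k : ℕ} {f : Fin k → M},
    (∀ i j, i ≠ j → Commute (f i) (f j)) →
    star (List.ofFn f).prod = (List.ofFn fun i => star (f i)).prod
  | 0, f, _ => by simp
  | k + 1, f, h => by
    rw [prod_ofFn_succ, prod_ofFn_succ, ← star_prod_ofFn (fun i j hij => h _ _ (by simpa using hij)),
      ← star_mul]
    congr 1
    exact (commute_prod_ofFn fun i => h _ _ (Fin.succ_ne_zero i).symm).eq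

lemma prod_ofFn_update_mul {M : Type*} [Monoid M] : ∀ {k : ℕ} (f : Fin k → M) (i : Fin k) (a : M),
    (∀ l, l ≠ i → Commute a (f l)) →
    (List.ofFn (Function.update f i (a * f i))).prod = a * (List.ofFn f).prod
  | 0, _, i, _, _ => i.elim0
  | k + 1, f, i, a, h => by
    rw [prod_ofFn_succ, prod_ofFn_succ f]
    refine Fin.cases (fun h => ?_) (fun i h => ?_) i h
    · simp [mul_assoc]
    · have h1 : (fun l : Fin k => Function.update f i.succ (a * f i.succ) l.succ) =
          Function.update (fun l => f l.succ) i (a * f i.succ) := by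
        funext l
        by_cases hl : l = i
        · subst hl; simp
        · simp [hl]
      rw [h1, prod_ofFn_update_mul (fun l => f l.succ) i a (fun l hl => h _ (by simpa using hl)),
        Function.update_of_ne (Fin.succ_ne_zero i).symm, ← mul_assoc, ← mul_assoc,
        (h 0 (Fin.succ_ne_zero i).symm).eq]

variable {V : Type*} [AddCommGroup V] [Module ℂ V]

/-- A property of vectors preserved by every factor is preserved by the ordered product. -/
lemma prod_ofFn_induction (p : V → Prop) : ∀ {k : ℕ} (T : Fin k → Module.End ℂ V)
    (_ : ∀ i y, p y → p (T i y)) {y : V} (_ : p y), p ((List.ofFn T).prod y)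
  | 0, T, _, y, hy => by simpa using hy
  | k + 1, T, hT, y, hy => by
    rw [prod_ofFn_succ]
    exact hT 0 _ (prod_ofFn_induction p (fun i : Fin k => T i.succ) (fun i => hT _) hy)

/-- An ordered product of families of endomorphisms converges, jointly with the vector it is applied
to, if each factor does. -/
lemma tendsto_prod_ofFn [TopologicalSpace V] {ι : Type*} {l : Filter ι} : ∀ {k : ℕ}
    (T : Fin k → ι → Module.End ℂ V) (T' : Fin k → Module.End ℂ V)
    (_ : ∀ i (f : ι → V) (y : V), Tendsto f l (𝓝 y) → Tendsto (fun t => T i t (f t)) l (𝓝 (T' i y)))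
    {f : ι → V} {y : V} (_ : Tendsto f l (𝓝 y)),
    Tendsto (fun t => (List.ofFn fun i => T i t).prod (f t)) l (𝓝 ((List.ofFn T').prod y))
  | 0, T, T', _, f, y, hf => by simpa using hf
  | k + 1, T, T', hT, f, y, hf => by
    simp only [prod_ofFn_succ]
    exact hT 0 _ _ (tendsto_prod_ofFn (fun i : Fin k => T i.succ) (fun i => T' i.succ)
      (fun i => hT _) hf)

lemma norm_prod_ofFn_apply_le {V : Type*} [NormedAddCommGroup V] [NormedSpace ℂ V] : ∀ {k : ℕ}
    (T : Fin k → Module.End ℂ V) (c : Fin k → ℝ) (_ : ∀ i, 0 ≤ c i)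
    (_ : ∀ i y, ‖T i y‖ ≤ c i * ‖y‖) (y : V), ‖(List.ofFn T).prod y‖ ≤ (∏ i, c i) * ‖y‖
  | 0, T, c, _, _, y => by simp
  | k + 1, T, c, h0, hT, y => by
    rw [prod_ofFn_succ, Fin.prod_univ_succ, mul_assoc]
    exact (hT 0 _).trans (mul_le_mul_of_nonneg_left (norm_prod_ofFn_apply_le _
      (fun i : Fin k => c i.succ) (fun i => h0 _) (fun i => hT _) y) (h0 0))

end OfFn

/-! ### Words -/

section Words

/-- The words of length `p` in `a` letters. -/
def wordsLen (a p : ℕ) : Finset (List (Fin a)) :=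
  Finset.univ.map ⟨fun w : Fin p → Fin a => List.ofFn w, List.ofFn_injective⟩

lemma mem_wordsLen {a p : ℕ} {w : List (Fin a)} : w ∈ wordsLen a p ↔ w.length = p := by
  simp only [wordsLen, Finset.mem_map, Finset.mem_univ, true_and, Function.Embedding.coeFn_mk]
  constructor
  · rintro ⟨f, rfl⟩
    simp
  · rintro rfl
    exact ⟨w.get, List.ofFn_get w⟩

lemma sum_wordsLen_succ {V : Type*} [AddCommMonoid V] {a p : ℕ} (f : List (Fin a) → V) :
    ∑ w ∈ wordsLen a (p + 1), f w = ∑ j, ∑ w ∈ wordsLen a p, f (j :: w) := by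
  rw [← Finset.sum_product']
  symm
  refine Finset.sum_bij (fun q _ => q.1 :: q.2) ?_ ?_ ?_ fun _ _ => rfl
  · rintro ⟨j, w⟩ h
    simpa [mem_wordsLen] using h
  · rintro ⟨j, w⟩ _ ⟨j', w'⟩ _ h
    simpa using h
  · rintro w h
    rw [mem_wordsLen] at h
    obtain ⟨j, w, rfl⟩ := List.exists_cons_of_length_eq_add_one h
    exact ⟨(j, w), by simpa [mem_wordsLen] using h, rfl⟩

variable {k : ℕ} {n : Fin k → ℕ}

lemma sum_ofFn_eq_sum_piFinset {V : Type*} [AddCommMonoid V] (p : Fin k → ℕ) (f : Word n → V) :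
    ∑ α : ∀ i, Fin (p i) → Fin (n i), f (fun i => List.ofFn (α i)) =
      ∑ α ∈ Fintype.piFinset fun i => wordsLen (n i) (p i), f α := by
  refine Finset.sum_bij (fun α _ i => List.ofFn (α i)) ?_ ?_ ?_ fun _ _ => rfl
  · intro α _
    simp [Fintype.mem_piFinset, mem_wordsLen]
  · intro α _ β _ h
    funext i
    exact List.ofFn_injective (congrFun h i)
  · intro w hw
    have h : ∀ i, ∃ f : Fin (p i) → Fin (n i), List.ofFn f = w i := fun i => by
      have := Fintype.mem_piFinset.mp hw i
      simpa [wordsLen] using this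
    choose f hf using h
    exact ⟨f, Finset.mem_univ _, funext hf⟩

end Words

/-! ### Monomials -/

section Monomial

variable {k : ℕ} {n : Fin k → ℕ} {H : Type*} [NormedAddCommGroup H] [InnerProductSpace ℂ H]

lemma wordOp_cons (X : Tuple n H) (i : Fin k) (j : Fin (n i)) (w : List (Fin (n i))) :
    wordOp X i (j :: w) = X i j * wordOp X i w := by
  simp [wordOp]

lemma commute_wordOp {X : Tuple n H} {T : H →L[ℂ] H} {i : Fin k} (h : ∀ j, Commute T (X i j))
    (w : List (Fin (n i))) : Commute T (wordOp X i w) :=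
  Commute.list_prod_right _ _ fun y hy => by
    obtain ⟨j, _, rfl⟩ := List.mem_map.mp hy
    exact h j

lemma monomial_nil (X : Tuple n H) : monomial X (fun _ => []) = 1 := by
  simp [monomial, wordOp]

lemma monomial_consAt {X : Tuple n H}
    (hX : ∀ s t, s ≠ t → ∀ a b, Commute (X s a) (X t b)) (i : Fin k) (j : Fin (n i)) (β : Word n) :
    monomial X (consAt i j β) = X i j * monomial X β := by
  rw [monomial, monomial, ← prod_ofFn_update_mul (fun l => wordOp X l (β l)) i (X i j)
    fun l hl => commute_wordOp (fun b => hX i l hl.symm j b) _]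
  congr 2
  funext l
  by_cases hl : l = i
  · subst hl
    simp [consAt, wordOp_cons]
  · simp [consAt, hl]

end Monomial

/-! ### The maps `Φ_{X_i}` and the defect map -/

section Polyball

variable {k : ℕ} {n : Fin k → ℕ} {H : Type*} [NormedAddCommGroup H] [InnerProductSpace ℂ H]
  [CompleteSpace H]

lemma phi_apply (X : Tuple n H) (i : Fin k) (Y : H →L[ℂ] H) :
    Phi X i Y = ∑ j, X i j * Y * star (X i j) := by
  simp [Phi, LinearMap.sum_apply]

lemma phi_one (X : Tuple n H) (i : Fin k) : Phi X i 1 = ∑ j, X i j * star (X i j) := by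
  simp [phi_apply]

lemma re_inner_mul_star_apply (T : H →L[ℂ] H) (h : H) :
    RCLike.re (inner ℂ ((T * star T) h) h) = ‖star T h‖ ^ 2 := by
  rw [mul_apply_eq_comp, ContinuousLinearMap.star_eq_adjoint,
    ← ContinuousLinearMap.adjoint_inner_right, ← norm_sq_eq_re_inner]

lemma sum_norm_star_apply_sq_le {ι : Type*} (s : Finset ι) (T : ι → H →L[ℂ] H) (h : H) :
    ∑ j ∈ s, ‖star (T j) h‖ ^ 2 ≤ ‖∑ j ∈ s, T j * star (T j)‖ * ‖h‖ ^ 2 := by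
  calc ∑ j ∈ s, ‖star (T j) h‖ ^ 2
      = RCLike.re (inner ℂ ((∑ j ∈ s, T j * star (T j)) h) h) := by
        rw [sum_apply, sum_inner, map_sum]
        exact Finset.sum_congr rfl fun j _ => (re_inner_mul_star_apply _ _).symm
    _ ≤ ‖(∑ j ∈ s, T j * star (T j)) h‖ * ‖h‖ := re_inner_le_norm _ _
    _ ≤ ‖∑ j ∈ s, T j * star (T j)‖ * ‖h‖ * ‖h‖ := by
        gcongr
        exact ContinuousLinearMap.le_opNorm _ _
    _ = _ := by ring

/-- `‖Φ_{X_i}(Y)‖ ≤ ‖Φ_{X_i}(I)‖ ‖Y‖`, by Cauchy–Schwarz. -/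
lemma norm_phi_apply_le (X : Tuple n H) (i : Fin k) (Y : H →L[ℂ] H) :
    ‖Phi X i Y‖ ≤ ‖∑ j, X i j * star (X i j)‖ * ‖Y‖ := by
  set c := ‖∑ j, X i j * star (X i j)‖ with hc
  have hc0 : 0 ≤ c := norm_nonneg _
  refine ContinuousLinearMap.opNorm_le_of_re_inner_le (by positivity) fun h g hh hg => ?_
  rw [phi_apply, sum_apply, sum_inner, map_sum]
  have h1 : ∀ j, RCLike.re (inner ℂ ((X i j * Y * star (X i j)) h) g) ≤
      ‖Y‖ * (‖star (X i j) h‖ * ‖star (X i j) g‖) := fun j => by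
    rw [mul_assoc, mul_apply_eq_comp, ← ContinuousLinearMap.adjoint_inner_right]
    refine (re_inner_le_norm _ _).trans ?_
    rw [← mul_assoc]
    exact mul_le_mul_of_nonneg_right (Y.le_opNorm _) (norm_nonneg _)
  have h2 : ∑ j, ‖star (X i j) h‖ * ‖star (X i j) g‖ ≤ c * ‖h‖ * ‖g‖ := by
    refine (Real.sum_mul_le_sqrt_mul_sqrt _ _ _).trans ?_
    have e : ∀ f : H, √(∑ j, ‖star (X i j) f‖ ^ 2) ≤ √c * ‖f‖ := fun f => by
      rw [← Real.sqrt_sq (norm_nonneg f), ← Real.sqrt_mul hc0]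
      exact Real.sqrt_le_sqrt (sum_norm_star_apply_sq_le _ _ _)
    calc _ ≤ (√c * ‖h‖) * (√c * ‖g‖) := mul_le_mul (e h) (e g) (Real.sqrt_nonneg _) (by positivity)
      _ = √c * √c * ‖h‖ * ‖g‖ := by ring
      _ = c * ‖h‖ * ‖g‖ := by rw [Real.mul_self_sqrt hc0]
  calc _ ≤ ∑ j, ‖Y‖ * (‖star (X i j) h‖ * ‖star (X i j) g‖) := Finset.sum_le_sum fun j _ => h1 j
    _ = ‖Y‖ * ∑ j, ‖star (X i j) h‖ * ‖star (X i j) g‖ := by rw [Finset.mul_sum]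
    _ ≤ ‖Y‖ * (c * ‖h‖ * ‖g‖) := by gcongr
    _ = _ := by rw [hh, hg]; ring

lemma norm_phi_pow_apply_le (X : Tuple n H) (i : Fin k) (p : ℕ) (Y : H →L[ℂ] H) :
    ‖(Phi X i ^ p) Y‖ ≤ ‖∑ j, X i j * star (X i j)‖ ^ p * ‖Y‖ := by
  induction p generalizing Y with
  | zero => simp
  | succ p ih =>
    rw [pow_succ, Module.End.mul_apply, pow_succ, mul_assoc]
    exact (ih _).trans (mul_le_mul_of_nonneg_left (norm_phi_apply_le X i Y) (by positivity))

lemma commute_phi {X : Tuple n H} (hX : ∀ s t, s ≠ t → ∀ a b, Commute (X s a) (X t b))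
    {s t : Fin k} (hst : s ≠ t) : Commute (Phi X s) (Phi X t) := by
  refine Commute.sum_left _ _ _ fun a _ => Commute.sum_right _ _ _ fun b _ => ?_
  refine LinearMap.ext fun Y => ?_
  simp only [Module.End.mul_apply, LinearMap.mulLeftRight_apply]
  have h1 := (hX s t hst a b).eq
  have h2 : star (X t b) * star (X s a) = star (X s a) * star (X t b) := by
    rw [← star_mul, ← star_mul, h1]
  calc X s a * (X t b * Y * star (X t b)) * star (X s a)
      = (X s a * X t b) * Y * (star (X t b) * star (X s a)) := by simp only [mul_assoc]
    _ = (X t b * X s a) * Y * (star (X s a) * star (X t b)) := by rw [h1, h2]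
    _ = _ := by simp only [mul_assoc]

/-- `Φ_{X_i}^p(Y) = ∑ X_{i,w} Y X_{i,w}^*`, the sum over the words of length `p`. -/
lemma sum_wordsLen_conj (X : Tuple n H) (i : Fin k) (p : ℕ) :
    ∑ w ∈ wordsLen (n i) p, LinearMap.mulLeftRight ℂ (wordOp X i w, star (wordOp X i w)) =
      Phi X i ^ p := by
  induction p with
  | zero =>
    have : wordsLen (n i) 0 = {[]} := by
      ext w
      simp [mem_wordsLen]
    rw [this, Finset.sum_singleton, pow_zero]
    refine LinearMap.ext fun Y => ?_
    simp [wordOp]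
  | succ p ih =>
    rw [sum_wordsLen_succ, pow_succ', ← ih, Phi, Finset.sum_mul_sum]
    refine Finset.sum_congr rfl fun j _ => Finset.sum_congr rfl fun w _ => LinearMap.ext fun Y => ?_
    simp [wordOp, mul_assoc]

lemma prod_mulLeftRight_apply {A : Type*} [Ring A] [Algebra ℂ A] [StarRing A] : ∀ {k : ℕ}
    (a : Fin k → A) (Y : A),
    (List.ofFn fun i => LinearMap.mulLeftRight ℂ (a i, star (a i))).prod Y =
      (List.ofFn a).prod * Y * star (List.ofFn a).prod
  | 0, a, Y => by simp
  | k + 1, a, Y => by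
    rw [prod_ofFn_succ, prod_ofFn_succ a, Module.End.mul_apply, prod_mulLeftRight_apply,
      LinearMap.mulLeftRight_apply, star_mul]
    simp only [mul_assoc]

/-- A sum over tuples of words factors into an ordered product of the one-variable sums. -/
lemma sum_monomial_conj (X : Tuple n H) (s : ∀ i, Finset (List (Fin (n i)))) (Y : H →L[ℂ] H) :
    ∑ β ∈ Fintype.piFinset s, monomial X β * Y * star (monomial X β) =
      (List.ofFn fun i => ∑ w ∈ s i,
        LinearMap.mulLeftRight ℂ (wordOp X i w, star (wordOp X i w))).prod Y := by
  rw [← sum_piFinset_prod_ofFn, LinearMap.sum_apply]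
  exact Finset.sum_congr rfl fun β _ => (prod_mulLeftRight_apply _ _).symm

/-- The words of length less than `N` in `a` letters. -/
def wordsLT (a N : ℕ) : Finset (List (Fin a)) := (Finset.range N).biUnion (wordsLen a)

lemma mem_wordsLT {a N : ℕ} {w : List (Fin a)} : w ∈ wordsLT a N ↔ w.length < N := by
  simp [wordsLT, mem_wordsLen]

lemma sum_wordsLT_conj (X : Tuple n H) (i : Fin k) (N : ℕ) :
    ∑ w ∈ wordsLT (n i) N, LinearMap.mulLeftRight ℂ (wordOp X i w, star (wordOp X i w)) =
      ∑ p ∈ Finset.range N, Phi X i ^ p := by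
  rw [wordsLT, Finset.sum_biUnion]
  · exact Finset.sum_congr rfl fun p _ => sum_wordsLen_conj X i p
  · intro p _ q _ hpq
    refine Finset.disjoint_left.mpr fun w hw hw' => hpq ?_
    rw [mem_wordsLen] at hw hw'
    exact hw.symm.trans hw'

/-- The partial sums of `∑_β X_β Δ_X(I) X_β^*` over the words of length less than `N` telescope. -/
lemma sum_monomial_conj_defect {X : Tuple n H}
    (hX : ∀ s t, s ≠ t → ∀ a b, Commute (X s a) (X t b)) (N : ℕ) :
    ∑ β ∈ Fintype.piFinset fun i => wordsLT (n i) N,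
      monomial X β * defectMap X 1 * star (monomial X β) =
      (List.ofFn fun i => 1 - Phi X i ^ N).prod 1 := by
  rw [sum_monomial_conj, defectMap, ← Module.End.mul_apply, prod_ofFn_mul_prod_ofFn]
  · congr 3
    funext i
    rw [sum_wordsLT_conj, geom_sum_mul_neg]
  · intro i j hij
    rw [sum_wordsLT_conj]
    refine Commute.sum_left _ _ _ fun p _ => ?_
    exact (Commute.one_right _).sub_right ((commute_phi hX hij).pow_left p)

/-- Strictness of the row contractions makes the telescoped sum tend to the identity; with
`sum_monomial_conj_defect` this is the isometry property of the Berezin kernel. -/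
lemma tendsto_prod_one_sub_phi_pow {X : Tuple n H} (hX : ∀ i, ‖∑ j, X i j * star (X i j)‖ < 1) :
    Tendsto (fun N : ℕ => (List.ofFn fun i => 1 - Phi X i ^ N).prod (1 : H →L[ℂ] H)) atTop
      (𝓝 1) := by
  have h := tendsto_prod_ofFn (l := (atTop : Filter ℕ)) (V := H →L[ℂ] H)
    (fun i N => 1 - Phi X i ^ N) (fun _ => 1) (fun i f y hf => by
      have h1 : Tendsto (fun N => (Phi X i ^ N) (f N)) atTop (𝓝 0) := by
        refine squeeze_zero_norm (fun N => norm_phi_pow_apply_le X i N (f N)) ?_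
        simpa using (tendsto_pow_atTop_nhds_zero_of_lt_one (norm_nonneg _) (hX i)).mul hf.norm
      simpa using hf.sub h1) (tendsto_const_nhds (x := (1 : H →L[ℂ] H)))
  simpa using h

lemma norm_sum_monomial_mul_star_le (X : Tuple n H) (p : Fin k → ℕ) :
    ‖∑ β ∈ Fintype.piFinset fun i => wordsLen (n i) (p i), monomial X β * star (monomial X β)‖ ≤
      ∏ i, ‖∑ j, X i j * star (X i j)‖ ^ p i := by
  have h := sum_monomial_conj X (fun i => wordsLen (n i) (p i)) 1
  simp only [mul_one, sum_wordsLen_conj] at h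
  rw [h]
  refine (norm_prod_ofFn_apply_le _ (fun i => ‖∑ j, X i j * star (X i j)‖ ^ p i)
    (fun i => by positivity) (fun i => norm_phi_pow_apply_le X i (p i)) 1).trans ?_
  refine mul_le_of_le_one_right (Finset.prod_nonneg fun i _ => by positivity) ?_
  exact ContinuousLinearMap.norm_id_le

/-- `X_{1,β_1}^* ⋯ X_{k,β_k}^*` is the adjoint of `X_{1,β_1} ⋯ X_{k,β_k}`, although the order of the
factors is not reversed, because different components commute. -/
lemma monomialStar_eq_star {X : Tuple n H}
    (hX : ∀ s t, s ≠ t → ∀ a b, Commute (X s a) (X t b)) (β : Word n) :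
    monomialStar X β = star (monomial X β) := by
  refine (star_prod_ofFn fun i j hij => ?_).symm
  exact commute_wordOp (fun b => (commute_wordOp (fun a => hX j i hij.symm b a) _).symm) _

/-! ### Points of the polyball -/

lemma one_sub_phi_apply (X : Tuple n H) (i : Fin k) (Y : H →L[ℂ] H) :
    (1 - Phi X i) Y = Y - ∑ j, X i j * Y * star (X i j) := by
  rw [LinearMap.sub_apply, phi_apply, Module.End.one_apply]

lemma continuous_defectMap_one : Continuous fun X : Tuple n H => defectMap X 1 := by
  refine continuous_iff_continuousAt.mpr fun X => ?_
  refine tendsto_prod_ofFn (l := 𝓝 X) (fun i Z => 1 - Phi Z i) (fun i => 1 - Phi X i)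
    (fun i f y hf => ?_) tendsto_const_nhds
  simp only [one_sub_phi_apply]
  refine hf.sub (tendsto_finsetSum _ fun j _ => ?_)
  have h : Tendsto (fun Z : Tuple n H => Z i j) (𝓝 X) (𝓝 (X i j)) :=
    tendsto_pi_nhds.mp (tendsto_pi_nhds.mp tendsto_id i) j
  exact (h.mul hf).mul h.star

/-- Self-adjointness of the defect holds for every tuple, so that near a point of the polyball only
strict positivity has to be controlled. -/
lemma isSelfAdjoint_defectMap_one (X : Tuple n H) : IsSelfAdjoint (defectMap X 1) := by
  refine prod_ofFn_induction IsSelfAdjoint _ (fun i Y hY => ?_) (IsSelfAdjoint.one _)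
  rw [one_sub_phi_apply]
  refine hY.sub ?_
  exact isSelfAdjoint_sum _ fun j _ => hY.conjugate _

/-- Strict positivity is an open condition on self-adjoint elements. -/
lemma IsStrictlyPositive.eventually {A : Type*} [CStarAlgebra A] [PartialOrder A]
    [StarOrderedRing A] {a : A} (ha : IsStrictlyPositive a) :
    ∀ᶠ b in 𝓝 a, IsSelfAdjoint b → IsStrictlyPositive b := by
  nontriviality A
  obtain ⟨r, hr, hra⟩ : ∃ r > 0, algebraMap ℝ A r ≤ a :=
    (CFC.exists_pos_algebraMap_le_iff ha.isSelfAdjoint).2 fun x hx => ha.spectrum_pos hx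
  filter_upwards [Metric.ball_mem_nhds a hr] with b hb hbs
  have hs : IsSelfAdjoint (b - a) := hbs.sub ha.isSelfAdjoint
  have h1 := hs.neg_algebraMap_norm_le_self
  have hlt : ‖b - a‖ < r := by rwa [← dist_eq_norm]
  have h2 : algebraMap ℝ A (r - ‖b - a‖) ≤ b := by
    have := add_le_add hra h1
    rw [map_sub, sub_eq_add_neg]
    simpa using this
  exact (isStrictlyPositive_algebraMap (sub_pos.mpr hlt)).of_le h2

/-- The polyball is open among the tuples with commuting components, so that every point of it
is of the form `ρ Y` with `ρ < 1` and `Y` in the polyball. -/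
lemma exists_smul_mem_polyball {X : Tuple n H} (hX : X ∈ polyball n H) :
    ∃ ρ : ℝ, 0 < ρ ∧ ρ < 1 ∧ ∃ Y ∈ polyball n H, X = (ρ : ℂ) • Y := by
  have hc : Continuous fun t : ℝ => (t : ℂ) • X := by fun_prop
  have h1 : ((1 : ℝ) : ℂ) • X = X := by simp
  have e1 : ∀ᶠ t : ℝ in 𝓝 1, ∀ i, ‖∑ j, ((t : ℂ) • X) i j * star (((t : ℂ) • X) i j)‖ < 1 := by
    refine eventually_all.mpr fun i => ?_
    have hc' : Continuous fun t : ℝ => ‖∑ j, ((t : ℂ) • X) i j * star (((t : ℂ) • X) i j)‖ := by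
      simp only [Pi.smul_apply]
      fun_prop
    refine hc'.continuousAt.eventually_lt continuousAt_const ?_
    simpa using hX.2.1 i
  have e2 : ∀ᶠ t : ℝ in 𝓝 1, IsStrictlyPositive (defectMap ((t : ℂ) • X) 1) := by
    have hc' : Continuous fun t : ℝ => defectMap ((t : ℂ) • X) 1 := continuous_defectMap_one.comp hc
    have := hc'.tendsto 1
    simp only [Complex.ofReal_one, one_smul] at this
    filter_upwards [this.eventually (IsStrictlyPositive.eventually hX.2.2)] with t ht
    exact ht (isSelfAdjoint_defectMap_one _)
  obtain ⟨t, ⟨ht1, ht2⟩, ht⟩ := (((e1.and e2).filter_mono nhdsWithin_le_nhds).and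
    (self_mem_nhdsWithin : Set.Ioi (1 : ℝ) ∈ 𝓝[>] 1)).exists
  have ht0 : (0 : ℝ) < t := zero_lt_one.trans ht
  refine ⟨t⁻¹, inv_pos.mpr ht0, inv_lt_one_of_one_lt₀ ht, (t : ℂ) • X, ⟨?_, ht1, ht2⟩, ?_⟩
  · intro s s' hs a b
    exact ((hX.1 s s' hs a b).smul_left (t : ℂ)).smul_right (t : ℂ)
  · rw [smul_smul, ← Complex.ofReal_mul, inv_mul_cancel₀ ht0.ne', Complex.ofReal_one, one_smul]

/-- The gauge action of the torus on tuples. -/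
def rotate (z : Fin k → Circle) (X : Tuple n H) : Tuple n H := fun i j => (z i : ℂ) • X i j

lemma rotate_mem_polyball {X : Tuple n H} (hX : X ∈ polyball n H) (z : Fin k → Circle) :
    rotate z X ∈ polyball n H := by
  have hz : ∀ i (Y : H →L[ℂ] H) j, rotate z X i j * Y * star (rotate z X i j) =
      X i j * Y * star (X i j) := fun i Y j => by
    have h1 : ((starRingEnd ℂ) (z i : ℂ)) * (z i : ℂ) = 1 := by
      rw [← Complex.normSq_eq_conj_mul_self]
      simp
    simp only [rotate, star_smul, smul_mul_assoc, mul_smul_comm, smul_smul]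
    rw [show star (z i : ℂ) * (z i : ℂ) = 1 from h1, one_smul]
  have hphi : ∀ i, Phi (rotate z X) i = Phi X i := fun i => by
    refine LinearMap.ext fun Y => ?_
    simp only [phi_apply, hz]
  refine ⟨fun s t hst a b => ((hX.1 s t hst a b).smul_left _).smul_right _, fun i => ?_, ?_⟩
  · rw [← phi_one, hphi, phi_one]
    exact hX.2.1 i
  · simp only [defectMap, hphi]
    exact hX.2.2

/-- Doubly commuting strict row contractions form a point of the polyball: the defect is the
product of the commuting positive invertible operators `I - ∑ j, X_{i,j} X_{i,j}^*`. -/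
lemma mem_polyball_of_doublyCommute {X : Tuple n H}
    (h1 : ∀ s t, s ≠ t → ∀ a b, Commute (X s a) (X t b))
    (h2 : ∀ s t, s ≠ t → ∀ a b, Commute (X s a) (star (X t b)))
    (h3 : ∀ i, ‖∑ j, X i j * star (X i j)‖ < 1) : X ∈ polyball n H := by
  refine ⟨h1, h3, ?_⟩
  set Q : Fin k → H →L[ℂ] H := fun i => 1 - ∑ j, X i j * star (X i j) with hQ
  have hQpos : ∀ i, IsStrictlyPositive (Q i) := fun i => by
    have hsa : IsSelfAdjoint (∑ j, X i j * star (X i j)) :=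
      isSelfAdjoint_sum _ fun j _ => IsSelfAdjoint.mul_star_self _
    have hle := hsa.le_algebraMap_norm_self
    refine (isStrictlyPositive_algebraMap (A := H →L[ℂ] H) (sub_pos.mpr (h3 i))).of_le ?_
    rw [map_sub, map_one]
    exact sub_le_sub_left hle 1
  have hXQ : ∀ s t, s ≠ t → ∀ a, Commute (X s a) (Q t) := fun s t hst a =>
    (Commute.one_right _).sub_right (Commute.sum_right _ _ _ fun b _ =>
      (h1 s t hst a b).mul_right (h2 s t hst a b))
  have hQQ : ∀ s t, s ≠ t → Commute (Q s) (Q t) := fun s t hst => by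
    refine (Commute.one_left _).sub_left (Commute.sum_left _ _ _ fun a _ => ?_)
    refine (hXQ s t hst a).mul_left ?_
    have := (hXQ s t hst a).star_star
    rwa [(hQpos t).isSelfAdjoint.star_eq] at this
  -- The induction runs over all lists `e` of distinct indices, so that the claim passes to the
  -- list without its first entry.
  have key : ∀ (l : ℕ) (e : Fin l → Fin k), Function.Injective e →
      (List.ofFn fun i => 1 - Phi X (e i)).prod 1 = (List.ofFn fun i => Q (e i)).prod ∧
      IsStrictlyPositive (List.ofFn fun i => Q (e i)).prod := by
    intro l
    induction l with
    | zero => intro e _; simp [isStrictlyPositive_one]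
    | succ l ih =>
      intro e he
      obtain ⟨ih1, ih2⟩ := ih (fun i => e i.succ) (he.comp (Fin.succ_injective _))
      have hne : ∀ i : Fin l, e 0 ≠ e i.succ := fun i h => Fin.succ_ne_zero i (he h).symm
      rw [prod_ofFn_succ, prod_ofFn_succ fun i => Q (e i), Module.End.mul_apply, ih1]
      constructor
      · rw [one_sub_phi_apply, hQ, sub_mul, one_mul, Finset.sum_mul]
        congr 1
        refine Finset.sum_congr rfl fun j _ => ?_
        have hc : Commute (star (X (e 0) j)) (List.ofFn fun i : Fin l => Q (e i.succ)).prod :=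
          commute_prod_ofFn fun i => by
            have := (hXQ _ _ (hne i) j).star_star
            rwa [(hQpos _).isSelfAdjoint.star_eq] at this
        rw [mul_assoc, ← hc.eq, ← mul_assoc]
      · exact ((hQpos _).commute_iff ih2).mp (commute_prod_ofFn fun i => hQQ _ _ (hne i))
  obtain ⟨e1, e2⟩ := key k id Function.injective_id
  rw [defectMap]
  exact e1.symm ▸ e2

end Polyball

/-! ### The universal model -/

section Fock

variable {k : ℕ} {n : Fin k → ℕ}

lemma eq_consAt {α : Word n} {i : Fin k} {j : Fin (n i)} {w : List (Fin (n i))}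
    (h : α i = j :: w) : α = consAt i j (Function.update α i w) := by
  simp [consAt, ← h]

lemma sum_length_consAt (i : Fin k) (j : Fin (n i)) (α : Word n) :
    ∑ l, (consAt i j α l).length = (∑ l, (α l).length) + 1 := by
  have h1 := Finset.add_sum_erase _ (fun l => (consAt i j α l).length) (Finset.mem_univ i)
  have h2 := Finset.add_sum_erase _ (fun l => (α l).length) (Finset.mem_univ i)
  have h3 : ∑ l ∈ Finset.univ.erase i, (consAt i j α l).length =
      ∑ l ∈ Finset.univ.erase i, (α l).length :=
    Finset.sum_congr rfl fun l hl => by simp [consAt, Finset.ne_of_mem_erase hl]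
  simp only [consAt, Function.update_self, List.length_cons] at h1 h3 ⊢
  omega

/-- Words are generated from the empty word by adjoining letters on the left. -/
lemma word_induction {p : Word n → Prop} (nil : p fun _ => [])
    (cons : ∀ i j α, p α → p (consAt i j α)) (α : Word n) : p α := by
  induction hN : ∑ i, (α i).length generalizing α with
  | zero =>
    have : α = fun _ => [] := by
      funext i
      simpa using (Finset.sum_eq_zero_iff.mp hN) i (Finset.mem_univ i)
    rw [this]
    exact nil
  | succ N ih =>
    obtain ⟨i, hi⟩ : ∃ i, α i ≠ [] := by
      by_contra! h
      simp [h] at hN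
    obtain ⟨j, w, hw⟩ := List.exists_cons_of_ne_nil hi
    rw [eq_consAt hw] at hN ⊢
    rw [sum_length_consAt] at hN
    exact cons i j _ (ih _ (Nat.succ_injective hN))

lemma inner_basisVec_apply (α : Word n) (x : Fock n) : inner ℂ (basisVec α) x = x α := by
  rw [basisVec, lp.inner_single_left]
  simp

lemma inner_basisVec (α β : Word n) :
    inner ℂ (basisVec α) (basisVec β) = if α = β then (1 : ℂ) else 0 :=
  orthonormal_iff_ite.mp orthonormal_basisVec α β

lemma fock_ext {x y : Fock n} (h : ∀ α, inner ℂ (basisVec α) x = inner ℂ (basisVec α) y) :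
    x = y := by
  ext α
  simpa only [inner_basisVec_apply] using h α

lemma basisVec_clm_ext {Z : Type*} [NormedAddCommGroup Z] [NormedSpace ℂ Z]
    {T T' : Fock n →L[ℂ] Z} (h : ∀ α, T (basisVec α) = T' (basisVec α)) : T = T' := by
  ext x
  have hx := lp.hasSum_single (p := 2) (by simp) x
  have e : ∀ α, lp.single 2 α (x α) = x α • (basisVec α : Fock n) := fun α => by
    rw [basisVec, ← lp.single_smul]
    simp
  simp only [e] at hx
  refine (hx.mapL T).unique ?_
  simpa only [map_smul, h] using hx.mapL T'

lemma consAt_comm {i i' : Fin k} (h : i ≠ i') (j : Fin (n i)) (j' : Fin (n i')) (α : Word n) :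
    consAt i j (consAt i' j' α) = consAt i' j' (consAt i j α) := by
  simp only [consAt]
  rw [Function.update_comm h, Function.update_of_ne h, Function.update_of_ne h.symm]

lemma commute_creation {i i' : Fin k} (h : i ≠ i') (j : Fin (n i)) (j' : Fin (n i')) :
    Commute (creation (n := n) i j) (creation i' j') :=
  basisVec_clm_ext fun α => by
    simp only [mul_apply_eq_comp, creation_basisVec, consAt_comm h]

lemma star_creation_consAt (i : Fin k) (j : Fin (n i)) (α : Word n) :
    star (creation i j) (basisVec (consAt i j α)) = basisVec α := by
  refine fock_ext fun β => ?_
  rw [ContinuousLinearMap.star_eq_adjoint, ContinuousLinearMap.adjoint_inner_right,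
    creation_basisVec, inner_basisVec, inner_basisVec]
  simp [(consAt_injective i j).eq_iff]

lemma star_creation_of_notMem {i : Fin k} {j : Fin (n i)} {α : Word n}
    (h : ∀ β, consAt i j β ≠ α) : star (creation i j) (basisVec α) = 0 := by
  refine fock_ext fun β => ?_
  rw [ContinuousLinearMap.star_eq_adjoint, ContinuousLinearMap.adjoint_inner_right,
    creation_basisVec, inner_basisVec, inner_zero_right, if_neg (h β)]

lemma star_creation_mul_creation (i : Fin k) (j j' : Fin (n i)) :
    star (creation (n := n) i j) * creation i j' = if j = j' then 1 else 0 := by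
  refine basisVec_clm_ext fun α => ?_
  rw [mul_apply_eq_comp, creation_basisVec]
  split_ifs with h
  · subst h
    rw [star_creation_consAt]
    rfl
  · rw [star_creation_of_notMem fun β hβ => h ?_]
    · rfl
    · have := congrFun hβ i
      simp only [consAt, Function.update_self, List.cons.injEq] at this
      exact this.1

/-- The components of the universal model doubly commute. -/
lemma commute_creation_star {i i' : Fin k} (h : i ≠ i') (j : Fin (n i)) (j' : Fin (n i')) :
    Commute (creation (n := n) i j) (star (creation i' j')) := by
  refine basisVec_clm_ext fun α => ?_
  rw [mul_apply_eq_comp, mul_apply_eq_comp, creation_basisVec]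
  by_cases hα : ∃ β, consAt i' j' β = α
  · obtain ⟨β, rfl⟩ := hα
    rw [star_creation_consAt, consAt_comm h, star_creation_consAt, creation_basisVec]
  · push Not at hα
    rw [star_creation_of_notMem hα, map_zero, star_creation_of_notMem fun β hβ => ?_]
    refine hα (Function.update α i' (β i')) ?_
    have h1 := congrFun hβ i'
    simp only [consAt, Function.update_self, Function.update_of_ne h.symm] at h1
    simp [consAt, h1]

/-- The `i`-th component of the universal model is a row contraction: `∑ j, S_{i,j} S_{i,j}^*` is a
projection. -/
lemma norm_sum_creation_mul_star_le (i : Fin k) :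
    ‖∑ j, creation (n := n) i j * star (creation i j)‖ ≤ 1 := by
  set P := ∑ j, creation (n := n) i j * star (creation i j) with hP
  have hsa : star P = P := by
    rw [hP, star_sum]
    exact Finset.sum_congr rfl fun j _ => by simp
  have hid : P * P = P := by
    rw [hP, Finset.sum_mul_sum]
    refine Finset.sum_congr rfl fun j _ => ?_
    have : ∀ j', creation (n := n) i j * star (creation i j) *
        (creation i j' * star (creation i j')) =
        if j = j' then creation i j * star (creation i j') else 0 := fun j' => by
      rw [mul_assoc, ← mul_assoc (star _), star_creation_mul_creation]
      split_ifs <;> simp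
    simp [this]
  have h := CStarRing.norm_star_mul_self (x := P)
  rw [hsa, hid] at h
  -- `‖P‖ = ‖P‖²` excludes `‖P‖ > 1`
  by_contra! hlt
  nlinarith

/-- The coordinatewise concatenation of words. -/
def concat (α β : Word n) : Word n := fun i => α i ++ β i

lemma consAt_concat (i : Fin k) (j : Fin (n i)) (α β : Word n) :
    concat (consAt i j α) β = consAt i j (concat α β) := by
  funext l
  by_cases hl : l = i
  · subst hl
    simp [concat, consAt]
  · simp [concat, consAt, hl]

lemma universalModel_commute (s t : Fin k) (h : s ≠ t) (a : Fin (n s)) (b : Fin (n t)) :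
    Commute (universalModel n s a) (universalModel n t b) :=
  commute_creation h a b

lemma monomial_universalModel_basisVec (α β : Word n) :
    monomial (universalModel n) α (basisVec β) = basisVec (concat α β) := by
  induction α using word_induction with
  | nil => rw [monomial_nil]; rfl
  | cons i j α ih =>
    rw [monomial_consAt universalModel_commute, mul_apply_eq_comp, ih, consAt_concat]
    exact creation_basisVec i j _

end Fock

/-! ### The Berezin kernel -/

section BerezinKernel

variable {k : ℕ} {n : Fin k → ℕ} {H : Type*} [NormedAddCommGroup H] [InnerProductSpace ℂ H]

lemma inner_hmul_basisVec (α β : Word n) (x y : H) :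
    inner ℂ (hmul (basisVec α) x) (hmul (basisVec β) y) = if α = β then inner ℂ x y else 0 := by
  rw [inner_hmul, inner_basisVec]
  split_ifs <;> simp

lemma hmul_basisVec_clm_ext {Z : Type*} [NormedAddCommGroup Z] [NormedSpace ℂ Z]
    {T T' : HTensor (Fock n) H →L[ℂ] Z}
    (h : ∀ α x, T (hmul (basisVec α) x) = T' (hmul (basisVec α) x)) : T = T' := by
  refine hmul_ext fun f x => ?_
  have h' : T ∘L tensorRight (Fock n) x = T' ∘L tensorRight (Fock n) x :=
    basisVec_clm_ext fun α => h α x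
  exact DFunLike.congr_fun h' f

lemma norm_sum_hmul_basisVec_sq (t : Finset (Word n)) (f : Word n → H) :
    ‖∑ β ∈ t, hmul (basisVec β) (f β)‖ ^ 2 = ∑ β ∈ t, ‖f β‖ ^ 2 := by
  rw [@norm_sq_eq_re_inner ℂ, sum_inner, map_sum]
  refine Finset.sum_congr rfl fun β hβ => ?_
  rw [inner_sum]
  simp only [inner_hmul_basisVec]
  rw [Finset.sum_ite_eq, if_pos hβ, ← norm_sq_eq_re_inner]

variable [CompleteSpace H]

/-- The `β`-th component of the Berezin kernel. -/
def kernelCoeff (X : Tuple n H) (β : Word n) : H →L[ℂ] H :=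
  CFC.sqrt (defectMap X 1) * monomialStar X β

lemma sum_norm_monomial_star_sq_le {X : Tuple n H} (t : Finset (Word n)) (h : H)
    (P : Finset (Fin k → ℕ)) (hP : ∀ β ∈ t, (fun i => (β i).length) ∈ P) :
    ∑ β ∈ t, ‖star (monomial X β) h‖ ^ 2 ≤
      (∑ p ∈ P, ∏ i, ‖∑ j, X i j * star (X i j)‖ ^ p i) * ‖h‖ ^ 2 := by
  classical
  rw [← Finset.sum_fiberwise_of_maps_to hP, Finset.sum_mul]
  refine Finset.sum_le_sum fun p _ => ?_
  calc ∑ β ∈ t with (fun i => (β i).length) = p, ‖star (monomial X β) h‖ ^ 2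
      ≤ ∑ β ∈ Fintype.piFinset fun i => wordsLen (n i) (p i), ‖star (monomial X β) h‖ ^ 2 := by
        refine Finset.sum_le_sum_of_subset_of_nonneg (fun β hβ => ?_) fun _ _ _ => by positivity
        rw [Fintype.mem_piFinset]
        intro i
        rw [mem_wordsLen]
        exact congrFun (Finset.mem_filter.mp hβ).2 i
    _ ≤ _ := (sum_norm_star_apply_sq_le _ _ h).trans
        (mul_le_mul_of_nonneg_right (norm_sum_monomial_mul_star_le X p) (by positivity))

/-- The series defining the Berezin kernel converges unconditionally in the operator norm: its
summands have orthogonal ranges, and `∑_β X_β X_β^*`, grouped by length, is dominated by a product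
of geometric series. -/
lemma summable_berezinKernel {X : Tuple n H} (hX : X ∈ polyball n H) :
    Summable fun β : Word n => tensorLeft H (basisVec β) ∘L kernelCoeff X β := by
  classical
  rw [summable_iff_vanishing_norm]
  intro ε hε
  set c : (Fin k → ℕ) → ℝ := fun p => ∏ i, ‖∑ j, X i j * star (X i j)‖ ^ p i with hc
  have hc0 : ∀ p, 0 ≤ c p := fun p => Finset.prod_nonneg fun i _ => by positivity
  have hcs : Summable c := summable_prod_fin (fun i p => by positivity)
    fun i => summable_geometric_of_lt_one (norm_nonneg _) (hX.2.1 i)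
  set D := CFC.sqrt (defectMap X 1) with hD
  -- `δ` bounds the tail of the geometric series, so that `(‖D‖ + 1)² δ = (ε / 2)²`.
  set δ : ℝ := (ε / 2 / (‖D‖ + 1)) ^ 2 with hδ
  have hD0 : 0 < ‖D‖ + 1 := by positivity
  obtain ⟨P, hP⟩ := summable_iff_vanishing_norm.mp hcs δ (by positivity)
  refine ⟨P.biUnion fun p => Fintype.piFinset fun i => wordsLen (n i) (p i), fun t ht => ?_⟩
  have hb : ∀ h : H, ‖(∑ β ∈ t, tensorLeft H (basisVec β) ∘L kernelCoeff X β) h‖ ≤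
      ε / 2 * ‖h‖ := fun h => by
    have hsq : ∑ β ∈ t, ‖star (monomial X β) h‖ ^ 2 ≤ δ * ‖h‖ ^ 2 := by
      refine (sum_norm_monomial_star_sq_le t h (t.image fun β i => (β i).length)
        fun β hβ => Finset.mem_image_of_mem _ hβ).trans ?_
      refine mul_le_mul_of_nonneg_right ?_ (by positivity)
      refine (le_abs_self _).trans (hP _ ?_).le
      refine Finset.disjoint_left.mpr fun p hp hpP => ?_
      obtain ⟨β, hβ, rfl⟩ := Finset.mem_image.mp hp
      refine Finset.disjoint_left.mp ht hβ (Finset.mem_biUnion.mpr ⟨_, hpP, ?_⟩)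
      simp [Fintype.mem_piFinset, mem_wordsLen]
    have hn : ‖(∑ β ∈ t, tensorLeft H (basisVec β) ∘L kernelCoeff X β) h‖ ^ 2 ≤
        (ε / 2 * ‖h‖) ^ 2 := by
      simp only [sum_apply, ContinuousLinearMap.comp_apply, tensorLeft_apply]
      rw [norm_sum_hmul_basisVec_sq]
      calc ∑ β ∈ t, ‖kernelCoeff X β h‖ ^ 2
          ≤ ∑ β ∈ t, ‖D‖ ^ 2 * ‖star (monomial X β) h‖ ^ 2 := by
            refine Finset.sum_le_sum fun β _ => ?_
            rw [kernelCoeff, monomialStar_eq_star hX.1, ← mul_pow]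
            exact pow_le_pow_left₀ (norm_nonneg _) (D.le_opNorm _) 2
        _ = ‖D‖ ^ 2 * ∑ β ∈ t, ‖star (monomial X β) h‖ ^ 2 := by rw [Finset.mul_sum]
        _ ≤ (‖D‖ + 1) ^ 2 * (δ * ‖h‖ ^ 2) := by
            refine mul_le_mul ?_ hsq (Finset.sum_nonneg fun _ _ => by positivity) (by positivity)
            exact pow_le_pow_left₀ (norm_nonneg _) (by linarith) 2
        _ = (ε / 2 * ‖h‖) ^ 2 := by
            rw [hδ]
            field_simp
    exact (sq_le_sq₀ (norm_nonneg _) (by positivity)).mp hn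
  exact (ContinuousLinearMap.opNorm_le_bound _ (by positivity) hb).trans_lt (by linarith)

lemma hasSum_berezinKernel {X : Tuple n H} (hX : X ∈ polyball n H) :
    HasSum (fun β : Word n => tensorLeft H (basisVec β) ∘L kernelCoeff X β) (berezinKernel X) :=
  (summable_berezinKernel hX).hasSum

lemma hasSum_berezinKernel_apply {X : Tuple n H} (hX : X ∈ polyball n H) (h : H) :
    HasSum (fun β : Word n => hmul (basisVec β) (kernelCoeff X β h)) (berezinKernel X h) :=
  (hasSum_berezinKernel hX).mapL (ContinuousLinearMap.apply ℂ (HTensor (Fock n) H) h)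

lemma star_kernelCoeff_mul_self {X : Tuple n H} (hX : X ∈ polyball n H) (β : Word n) :
    star (kernelCoeff X β) * kernelCoeff X β =
      monomial X β * defectMap X 1 * star (monomial X β) := by
  have h1 : CFC.sqrt (defectMap X 1) * CFC.sqrt (defectMap X 1) = defectMap X 1 :=
    CFC.sqrt_mul_sqrt_self _ hX.2.2.nonneg
  have h2 : star (CFC.sqrt (defectMap X 1)) = CFC.sqrt (defectMap X 1) :=
    (CFC.sqrt_nonneg _).isSelfAdjoint.star_eq
  rw [kernelCoeff, monomialStar_eq_star hX.1, star_mul, star_star, h2, mul_assoc,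
    ← mul_assoc _ _ (star _), h1, mul_assoc]

lemma tendsto_piFinset_wordsLT :
    Tendsto (fun N : ℕ => Fintype.piFinset fun i => wordsLT (n i) N) atTop atTop := by
  refine tendsto_atTop_finset_of_monotone (fun N M hNM β hβ => ?_) fun β => ?_
  · rw [Fintype.mem_piFinset] at hβ ⊢
    exact fun i => mem_wordsLT.mpr ((mem_wordsLT.mp (hβ i)).trans_le hNM)
  · refine ⟨(∑ i, (β i).length) + 1, ?_⟩
    rw [Fintype.mem_piFinset]
    intro i
    rw [mem_wordsLT, Nat.lt_succ_iff]
    exact Finset.single_le_sum (f := fun i => (β i).length) (fun _ _ => Nat.zero_le _)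
      (Finset.mem_univ i)

/-- The Berezin kernel at a point of the polyball is an isometry. -/
lemma inner_berezinKernel {X : Tuple n H} (hX : X ∈ polyball n H) (h g : H) :
    inner ℂ (berezinKernel X h) (berezinKernel X g) = inner ℂ h g := by
  have hlim := fun h => (hasSum_berezinKernel_apply hX h).comp tendsto_piFinset_wordsLT
  have h1 := (hlim h).inner (𝕜 := ℂ) (hlim g)
  have h2 : Tendsto (fun N : ℕ => inner ℂ h ((List.ofFn fun i => 1 - Phi X i ^ N).prod 1 g)) atTop
      (𝓝 (inner ℂ h g)) :=
    ((innerSL ℂ h).continuous.tendsto _).comp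
      (((ContinuousLinearMap.apply ℂ H g).continuous.tendsto _).comp
        (tendsto_prod_one_sub_phi_pow hX.2.1))
  refine tendsto_nhds_unique h1 (h2.congr fun N => ?_)
  rw [← sum_monomial_conj_defect hX.1, Function.comp_apply, Function.comp_apply, sum_inner,
    sum_apply, inner_sum]
  refine Finset.sum_congr rfl fun β hβ => ?_
  rw [inner_sum]
  simp only [inner_hmul_basisVec]
  rw [Finset.sum_ite_eq, if_pos hβ, ← star_kernelCoeff_mul_self hX, mul_apply_eq_comp,
    ContinuousLinearMap.star_eq_adjoint, ContinuousLinearMap.adjoint_inner_right]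

lemma berezinKernel_adjoint_comp_self {X : Tuple n H} (hX : X ∈ polyball n H) :
    (berezinKernel X).adjoint ∘L berezinKernel X = .id ℂ H :=
  ContinuousLinearMap.ext fun g => ext_inner_left ℂ fun h => by
    rw [ContinuousLinearMap.comp_apply, ContinuousLinearMap.adjoint_inner_right,
      inner_berezinKernel hX]
    rfl

lemma berezinKernel_adjoint_hmul {X : Tuple n H} (hX : X ∈ polyball n H) (β : Word n) (x : H) :
    (berezinKernel X).adjoint (hmul (basisVec β) x) =
      monomial X β (CFC.sqrt (defectMap X 1) x) := by
  refine ext_inner_right ℂ fun g => ?_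
  rw [ContinuousLinearMap.adjoint_inner_left]
  have h1 := (hasSum_berezinKernel_apply hX g).mapL (innerSL ℂ (hmul (basisVec β) x))
  simp only [innerSL_apply_apply, inner_hmul_basisVec] at h1
  have h2 : HasSum (fun β' => if β = β' then inner ℂ x (kernelCoeff X β' g) else 0)
      (inner ℂ x (kernelCoeff X β g)) := by
    convert hasSum_ite_eq β (inner ℂ x (kernelCoeff X β g)) using 2 with β'
    by_cases h : β = β'
    · subst h; simp
    · simp [h, Ne.symm h]
  have hD : IsSelfAdjoint (CFC.sqrt (defectMap X 1)) := (CFC.sqrt_nonneg _).isSelfAdjoint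
  rw [h1.unique h2, kernelCoeff, monomialStar_eq_star hX.1, mul_apply_eq_comp,
    ← ContinuousLinearMap.adjoint_inner_left, ← ContinuousLinearMap.star_eq_adjoint, hD.star_eq,
    ContinuousLinearMap.star_eq_adjoint, ContinuousLinearMap.adjoint_inner_right]

/-- The adjoint of the Berezin kernel intertwines the universal model with `X`. -/
lemma berezinKernel_adjoint_intertwine {X : Tuple n H} (hX : X ∈ polyball n H) (α : Word n) :
    (berezinKernel X).adjoint ∘L opTensor (monomial (universalModel n) α) (.id ℂ H) =
      monomial X α ∘L (berezinKernel X).adjoint := by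
  refine hmul_basisVec_clm_ext fun β x => ?_
  have hc : ∀ β, monomial X (concat α β) = monomial X α * monomial X β := fun β => by
    induction α using word_induction with
    | nil => rw [monomial_nil, one_mul]; rfl
    | cons i j α ih => rw [consAt_concat, monomial_consAt hX.1, ih, monomial_consAt hX.1, mul_assoc]
  rw [ContinuousLinearMap.comp_apply, opTensor_hmul, monomial_universalModel_basisVec,
    ContinuousLinearMap.comp_apply, ContinuousLinearMap.id_apply, berezinKernel_adjoint_hmul hX,
    berezinKernel_adjoint_hmul hX, hc, mul_apply_eq_comp]

/-- Compression by the Berezin kernel evaluates normal-form monomials at `X`. -/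
lemma berezinKernel_compress_monomial {X : Tuple n H} (hX : X ∈ polyball n H) (α β : Word n) :
    (berezinKernel X).adjoint ∘L opTensor (monomial (universalModel n) α *
      monomialStar (universalModel n) β) (.id ℂ H) ∘L berezinKernel X =
      monomial X α * monomialStar X β := by
  have h1 := congrArg ContinuousLinearMap.adjoint (berezinKernel_adjoint_intertwine hX β)
  rw [ContinuousLinearMap.adjoint_comp, ContinuousLinearMap.adjoint_comp,
    ContinuousLinearMap.adjoint_adjoint, adjoint_opTensor] at h1
  have hid : (ContinuousLinearMap.id ℂ H).adjoint = .id ℂ H := star_one (H →L[ℂ] H)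
  rw [hid] at h1
  have h2 : opTensor (monomial (universalModel n) α * monomialStar (universalModel n) β)
      (.id ℂ H) = opTensor (monomial (universalModel n) α) (.id ℂ H) ∘L
        opTensor (monomial (universalModel n) β).adjoint (.id ℂ H) := by
    rw [← opTensor_comp, monomialStar_eq_star universalModel_commute]
    rfl
  rw [h2, ContinuousLinearMap.comp_assoc, h1, ← ContinuousLinearMap.comp_assoc,
    berezinKernel_adjoint_intertwine hX, ContinuousLinearMap.comp_assoc,
    ← ContinuousLinearMap.comp_assoc _ (berezinKernel X), berezinKernel_adjoint_comp_self hX,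
    monomialStar_eq_star hX.1]
  rfl

end BerezinKernel

/-! ### The extended Berezin transform -/

section BerezinTransform

variable {k : ℕ} {n : Fin k → ℕ} {H : Type*} [NormedAddCommGroup H] [InnerProductSpace ℂ H]
  [CompleteSpace H] {E : Type*} [NormedAddCommGroup E] [InnerProductSpace ℂ E]

lemma berezin_opTensor (X : Tuple n H) (B : E →L[ℂ] E) (T : Fock n →L[ℂ] Fock n) :
    berezin X (opTensor B T) = opTensor B
      ((berezinKernel X).adjoint ∘L opTensor T (.id ℂ H) ∘L berezinKernel X) := by
  change opTensor (.id ℂ E) (ContinuousLinearMap.adjoint (berezinKernel X)) ∘L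
    assocL E (Fock n) H ∘L opTensor (opTensor B T) (.id ℂ H) ∘L
    assocSymmL E (Fock n) H ∘L opTensor (.id ℂ E) (berezinKernel X) = _
  rw [← ContinuousLinearMap.comp_assoc (assocL _ _ _), assocL_opTensor,
    ContinuousLinearMap.comp_assoc, ← ContinuousLinearMap.comp_assoc (assocL _ _ _),
    assocL_comp_symm, ContinuousLinearMap.id_comp, ← opTensor_comp, ← opTensor_comp]
  rfl

lemma berezin_monomial {X : Tuple n H} (hX : X ∈ polyball n H) (B : E →L[ℂ] E) (α β : Word n) :
    berezin X (opTensor B (monomial (universalModel n) α * monomialStar (universalModel n) β)) =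
      opTensor B (monomial X α * monomialStar X β) := by
  rw [berezin_opTensor, berezinKernel_compress_monomial hX]

/-- The isometry `E ⊗ H → (E ⊗ F) ⊗ H` induced by the Berezin kernel. -/
def berezinIso (E : Type*) [NormedAddCommGroup E] [InnerProductSpace ℂ E] (X : Tuple n H) :
    HTensor E H →L[ℂ] HTensor (HTensor E (Fock n)) H :=
  assocSymmL E (Fock n) H ∘L opTensor (.id ℂ E) (berezinKernel X)

variable [CompleteSpace E]

lemma berezin_eq (X : Tuple n H) (A : HTensor E (Fock n) →L[ℂ] HTensor E (Fock n)) :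
    berezin X A = (berezinIso E X).adjoint ∘L opTensor A (.id ℂ H) ∘L berezinIso E X := by
  have hid : (ContinuousLinearMap.id ℂ E).adjoint = .id ℂ E := star_one (E →L[ℂ] E)
  rw [berezinIso, ContinuousLinearMap.adjoint_comp, assocSymmL_adjoint, adjoint_opTensor, hid]
  rfl

lemma berezinIso_adjoint_comp_self {X : Tuple n H} (hX : X ∈ polyball n H) :
    (berezinIso E X).adjoint ∘L berezinIso E X = .id ℂ _ := by
  have hid : (ContinuousLinearMap.id ℂ E).adjoint = .id ℂ E := star_one (E →L[ℂ] E)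
  rw [berezinIso, ContinuousLinearMap.adjoint_comp, assocSymmL_adjoint, adjoint_opTensor, hid,
    ContinuousLinearMap.comp_assoc, ← ContinuousLinearMap.comp_assoc (assocL _ _ _),
    assocL_comp_symm, ContinuousLinearMap.id_comp, ← opTensor_comp,
    berezinKernel_adjoint_comp_self hX, ContinuousLinearMap.id_comp, opTensor_id]

/-- The Berezin transform is completely contractive: it is a compression of the amplification
`A ↦ A ⊗ I` by an isometry. -/
lemma norm_opMatrix_berezin_le {X : Tuple n H} (hX : X ∈ polyball n H) {d : ℕ}
    (A : Matrix (Fin d) (Fin d) (HTensor E (Fock n) →L[ℂ] HTensor E (Fock n))) :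
    ‖opMatrix (Matrix.of fun i j => berezin X (A i j))‖ ≤ ‖opMatrix A‖ := by
  set R : Fin d → HTensor E H →L[ℂ] HTensor (PiLp 2 fun _ : Fin d => HTensor E (Fock n)) H :=
    fun j => opTensor (inclusionL _ j) (.id ℂ H) ∘L berezinIso E X with hR
  have hid : (ContinuousLinearMap.id ℂ H).adjoint = .id ℂ H := star_one (H →L[ℂ] H)
  have hadj : ∀ i j, (inclusionL (HTensor E (Fock n)) (d := d) i).adjoint ∘L inclusionL _ j =
      if i = j then .id ℂ _ else 0 := fun i j => by
    refine ContinuousLinearMap.ext fun x => ext_inner_left ℂ fun y => ?_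
    rw [ContinuousLinearMap.comp_apply, ContinuousLinearMap.adjoint_inner_right,
      inner_inclusionL]
    split_ifs <;> simp
  have h1 : ∀ i j x y, inner ℂ (R i x) (R j y) = if i = j then inner ℂ x y else 0 := by
    intro i j x y
    rw [← ContinuousLinearMap.adjoint_inner_right, ← ContinuousLinearMap.comp_apply, hR]
    simp only
    rw [ContinuousLinearMap.adjoint_comp, adjoint_opTensor, hid, ContinuousLinearMap.comp_assoc,
      ← ContinuousLinearMap.comp_assoc (opTensor _ _), ← opTensor_comp, hadj,
      ContinuousLinearMap.id_comp]
    split_ifs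
    · rw [opTensor_id, ContinuousLinearMap.id_comp, berezinIso_adjoint_comp_self hX]
      rfl
    · rw [opTensor_zero_left]
      simp
  have h2 := norm_opMatrix_compress_le R h1 (opTensor (opMatrix A) (.id ℂ H))
  have h3 : ∀ i j, (R i).adjoint ∘L opTensor (opMatrix A) (.id ℂ H) ∘L R j = berezin X (A i j) := by
    intro i j
    rw [berezin_eq, ← inclusionL_adjoint_comp A i j, hR]
    simp only
    rw [ContinuousLinearMap.adjoint_comp, adjoint_opTensor, hid,
      ← ContinuousLinearMap.comp_assoc (opTensor (opMatrix A) _), ← opTensor_comp,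
      ContinuousLinearMap.comp_assoc, ← ContinuousLinearMap.comp_assoc (opTensor _ _),
      ← opTensor_comp, ContinuousLinearMap.id_comp, ContinuousLinearMap.id_comp]
  simp only [h3] at h2
  refine h2.trans ((norm_opTensor_le _ _).trans ?_)
  exact mul_le_of_le_one_right (norm_nonneg _) ContinuousLinearMap.norm_id_le

lemma berezin_add (X : Tuple n H) (A B : HTensor E (Fock n) →L[ℂ] HTensor E (Fock n)) :
    berezin X (A + B) = berezin X A + berezin X B := by
  simp only [berezin_eq, opTensor_add_left, ContinuousLinearMap.add_comp,
    ContinuousLinearMap.comp_add]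

lemma berezin_smul (X : Tuple n H) (c : ℂ) (A : HTensor E (Fock n) →L[ℂ] HTensor E (Fock n)) :
    berezin X (c • A) = c • berezin X A := by
  simp only [berezin_eq, opTensor_smul_left, ContinuousLinearMap.smul_comp,
    ContinuousLinearMap.comp_smul]

lemma norm_berezin_le {X : Tuple n H} (hX : X ∈ polyball n H)
    (A : HTensor E (Fock n) →L[ℂ] HTensor E (Fock n)) : ‖berezin X A‖ ≤ ‖A‖ := by
  have hV : ‖berezinIso E X‖ ≤ 1 := ContinuousLinearMap.opNorm_le_bound _ zero_le_one fun x => by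
    have : inner ℂ (berezinIso E X x) (berezinIso E X x) = inner ℂ x x := by
      rw [← ContinuousLinearMap.adjoint_inner_right, ← ContinuousLinearMap.comp_apply,
        berezinIso_adjoint_comp_self hX]
      rfl
    rw [@norm_eq_sqrt_re_inner ℂ, this, ← @norm_eq_sqrt_re_inner ℂ, one_mul]
  have hV' : ‖(berezinIso E X).adjoint‖ ≤ 1 := by simpa using hV
  rw [berezin_eq]
  calc _ ≤ ‖(berezinIso E X).adjoint‖ * (‖opTensor A (.id ℂ H)‖ * ‖berezinIso E X‖) :=
        (ContinuousLinearMap.opNorm_comp_le _ _).trans (mul_le_mul_of_nonneg_left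
          (ContinuousLinearMap.opNorm_comp_le _ _) (norm_nonneg _))
    _ ≤ 1 * ((‖A‖ * 1) * 1) := by
        gcongr
        refine (norm_opTensor_le _ _).trans ?_
        gcongr
        exact ContinuousLinearMap.norm_id_le
    _ = ‖A‖ := by ring

/-- The extended Berezin transform as a bounded linear map. -/
def berezinL (E : Type*) [NormedAddCommGroup E] [InnerProductSpace ℂ E] [CompleteSpace E]
    {X : Tuple n H} (hX : X ∈ polyball n H) :
    (HTensor E (Fock n) →L[ℂ] HTensor E (Fock n)) →L[ℂ] (HTensor E H →L[ℂ] HTensor E H) :=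
  LinearMap.mkContinuous
    { toFun := berezin X
      map_add' := berezin_add X
      map_smul' := berezin_smul X } 1 fun A => by
    simpa using norm_berezin_le hX A

lemma berezinL_apply {X : Tuple n H} (hX : X ∈ polyball n H)
    (A : HTensor E (Fock n) →L[ℂ] HTensor E (Fock n)) : berezinL E hX A = berezin X A := rfl

end BerezinTransform

/-! ### Coefficients of operators on `E ⊗ F²` -/

section Coefficients

variable {k : ℕ} {n : Fin k → ℕ}

/-- Pairs of words for which, in each coordinate, one of the two is empty. These index the
monomials `S_α S_β^*` in normal form. -/
def Reduced (α β : Word n) : Prop := ∀ i, α i = [] ∨ β i = []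

lemma commute_monomial_star {α β : Word n} (h : Reduced α β) :
    Commute (monomial (universalModel n) α) (star (monomial (universalModel n) β)) := by
  rw [← monomialStar_eq_star universalModel_commute]
  refine commute_prod_ofFn fun i => (commute_prod_ofFn fun l => ?_).symm
  by_cases hil : l = i
  · subst hil
    rcases h l with h | h
    · simp [h, wordOp]
    · simp [h, wordOp]
  · refine commute_wordOp (fun b => ?_) _
    rw [← star_star (universalModel n l b)]
    refine Commute.star_star ?_
    exact (commute_wordOp (fun a => (commute_creation_star (Ne.symm hil) a b).symm) _).symm

/-- The normal form of `S_α^* S_β`: common initial letters cancel, different ones give `0`. -/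
lemma star_monomial_mul_monomial (α β : Word n) :
    star (monomial (universalModel n) α) * monomial (universalModel n) β = 0 ∨
      ∃ γ δ : Word n, Reduced γ δ ∧
        star (monomial (universalModel n) α) * monomial (universalModel n) β =
          monomial (universalModel n) γ * monomialStar (universalModel n) δ := by
  induction hN : ∑ i, (α i).length generalizing α β with
  | zero =>
    have : α = fun _ => [] := by
      funext i
      simpa using (Finset.sum_eq_zero_iff.mp hN) i (Finset.mem_univ i)
    subst this
    refine .inr ⟨β, fun _ => [], fun _ => .inr rfl, ?_⟩
    rw [monomialStar_eq_star universalModel_commute, monomial_nil, star_one, one_mul, mul_one]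
  | succ N ih =>
    by_cases h : Reduced β α
    · refine .inr ⟨β, α, h, ?_⟩
      rw [monomialStar_eq_star universalModel_commute]
      exact (commute_monomial_star h).eq.symm
    · simp only [Reduced, not_forall, not_or] at h
      obtain ⟨i, hβ, hα⟩ := h
      obtain ⟨j, a, ha⟩ := List.exists_cons_of_ne_nil hα
      obtain ⟨j', b, hb⟩ := List.exists_cons_of_ne_nil hβ
      rw [eq_consAt ha] at hN
      rw [sum_length_consAt] at hN
      have hS := star_creation_mul_creation i j j'
      have hred : star (monomial (universalModel n) α) * monomial (universalModel n) β =
          star (monomial (universalModel n) (Function.update α i a)) *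
            (star (creation i j) * creation i j') *
            monomial (universalModel n) (Function.update β i b) := by
        conv_lhs => rw [eq_consAt ha, eq_consAt hb]
        rw [monomial_consAt universalModel_commute, monomial_consAt universalModel_commute,
          star_mul]
        simp only [mul_assoc]
        rfl
      rw [hred, hS]
      split_ifs with hj
      · rw [mul_one]
        exact ih _ _ (Nat.succ_injective hN)
      · left
        simp

lemma concat_left_injective (α : Word n) : Function.Injective (concat α) := fun _ _ h =>
  funext fun i => List.append_cancel_left (congrFun h i)

lemma concat_nil (α : Word n) : concat α (fun _ => []) = α := by
  funext i
  simp [concat]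

/-- Distinct normal-form monomials are separated by their matrix entries `⟨e_α, · e_β⟩` at reduced
pairs. -/
lemma inner_basisVec_monomial {α β γ δ : Word n} (h : Reduced α β) :
    inner ℂ (basisVec α) ((monomial (universalModel n) γ * monomialStar (universalModel n) δ)
      (basisVec β)) = if α = γ ∧ β = δ then (1 : ℂ) else 0 := by
  rw [monomialStar_eq_star universalModel_commute, mul_apply_eq_comp]
  have hin : ∀ x, inner ℂ (basisVec x) (star (monomial (universalModel n) δ) (basisVec β)) =
      if concat δ x = β then (1 : ℂ) else 0 := fun x => by
    rw [ContinuousLinearMap.star_eq_adjoint, ContinuousLinearMap.adjoint_inner_right,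
      monomial_universalModel_basisVec, inner_basisVec]
  by_cases hβ : ∃ x, concat δ x = β
  · obtain ⟨x, rfl⟩ := hβ
    have h1 : star (monomial (universalModel n) δ) (basisVec (concat δ x)) = basisVec x :=
      fock_ext fun y => by
        rw [hin, inner_basisVec]
        simp [(concat_left_injective δ).eq_iff]
    rw [h1, monomial_universalModel_basisVec, inner_basisVec]
    by_cases hα : α = concat γ x
    · subst hα
      have hx : x = fun _ => [] := funext fun i => by
        rcases h i with h | h
        · exact (List.append_eq_nil_iff.mp h).2
        · exact (List.append_eq_nil_iff.mp h).2
      subst hx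
      simp [concat_nil]
    · rw [if_neg hα, if_neg]
      rintro ⟨rfl, h2⟩
      refine hα (funext fun i => ?_)
      have h3 : x i = [] := by
        have := congrFun h2 i
        simpa [concat] using this
      simp [concat, h3]
  · have h1 : star (monomial (universalModel n) δ) (basisVec β) = 0 := fock_ext fun y => by
      rw [hin, inner_zero_right, if_neg fun hy => hβ ⟨y, hy⟩]
    rw [h1, map_zero, inner_zero_right, if_neg]
    rintro ⟨-, rfl⟩
    exact hβ ⟨fun _ => [], concat_nil _⟩

variable {E : Type*} [NormedAddCommGroup E] [InnerProductSpace ℂ E] [CompleteSpace E]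

/-- The matrix entries `(I ⊗ ⟨e_α|) A (I ⊗ |e_β⟩) ∈ B(E)` of an operator on `E ⊗ F²`. -/
def coeffOf (A : HTensor E (Fock n) →L[ℂ] HTensor E (Fock n)) : Coeff n E := fun α β =>
  (tensorRight E (basisVec α)).adjoint ∘L A ∘L tensorRight E (basisVec β)

lemma coeffOf_add (A B : HTensor E (Fock n) →L[ℂ] HTensor E (Fock n)) :
    coeffOf (A + B) = coeffOf A + coeffOf B := by
  funext α β
  simp only [coeffOf, ContinuousLinearMap.add_comp, ContinuousLinearMap.comp_add, Pi.add_apply]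

lemma coeffOf_smul (c : ℂ) (A : HTensor E (Fock n) →L[ℂ] HTensor E (Fock n)) :
    coeffOf (c • A) = c • coeffOf A := by
  funext α β
  simp only [coeffOf, ContinuousLinearMap.smul_comp, ContinuousLinearMap.comp_smul, Pi.smul_apply]

lemma coeffOf_zero : coeffOf (0 : HTensor E (Fock n) →L[ℂ] HTensor E (Fock n)) = 0 := by
  simpa using coeffOf_smul 0 (0 : HTensor E (Fock n) →L[ℂ] HTensor E (Fock n))

lemma continuous_coeffOf (α β : Word n) :
    Continuous fun A : HTensor E (Fock n) →L[ℂ] HTensor E (Fock n) => coeffOf A α β := by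
  unfold coeffOf
  exact continuous_const.clm_comp (continuous_id.clm_comp continuous_const)

lemma coeffOf_opTensor (B : E →L[ℂ] E) (T : Fock n →L[ℂ] Fock n) (α β : Word n) :
    coeffOf (opTensor B T) α β = inner ℂ (basisVec α) (T (basisVec β)) • B := by
  refine ContinuousLinearMap.ext fun x => ext_inner_left ℂ fun y => ?_
  rw [coeffOf, ContinuousLinearMap.comp_apply, ContinuousLinearMap.adjoint_inner_right,
    ContinuousLinearMap.comp_apply, tensorRight_apply, tensorRight_apply, opTensor_hmul,
    inner_hmul, _root_.smul_apply, inner_smul_right, mul_comm]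

lemma coeffOf_monomial (B : E →L[ℂ] E) {α β : Word n} (h : Reduced α β) (γ δ : Word n) :
    coeffOf (opTensor B (monomial (universalModel n) γ * monomialStar (universalModel n) δ)) α β =
      if α = γ ∧ β = δ then B else 0 := by
  rw [coeffOf_opTensor, inner_basisVec_monomial h]
  split_ifs <;> simp

end Coefficients

/-! ### Scaling -/

section Scale

variable {k : ℕ} {n : Fin k → ℕ} {H : Type*} [NormedAddCommGroup H] [InnerProductSpace ℂ H]

/-- The tuple `(c_1 X_1, …, c_k X_k)`. -/
def scale (c : Fin k → ℂ) (X : Tuple n H) : Tuple n H := fun i j => c i • X i j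

lemma prod_ofFn_smul {A : Type*} [Ring A] [Algebra ℂ A] : ∀ {k : ℕ} (c : Fin k → ℂ) (T : Fin k → A),
    (List.ofFn fun i => c i • T i).prod = (∏ i, c i) • (List.ofFn T).prod
  | 0, c, T => by simp
  | k + 1, c, T => by
    rw [prod_ofFn_succ, prod_ofFn_succ T, prod_ofFn_smul, Fin.prod_univ_succ, smul_mul_smul_comm]

lemma wordOp_scale (c : Fin k → ℂ) (X : Tuple n H) (i : Fin k) (w : List (Fin (n i))) :
    wordOp (scale c X) i w = c i ^ w.length • wordOp X i w := by
  induction w with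
  | nil => simp [wordOp]
  | cons j w ih =>
    rw [wordOp_cons, ih, wordOp_cons, scale, smul_mul_smul_comm, List.length_cons, pow_succ']

end Scale

/-! ### Homogeneous parts -/

section HomPart

variable {k : ℕ} {n : Fin k → ℕ} {E : Type u} [NormedAddCommGroup E] [InnerProductSpace ℂ E]
  {H : Type*} [NormedAddCommGroup H] [InnerProductSpace ℂ H] [CompleteSpace H]

/-- The words `α` with `|α_i| = m_i^-`. -/
def negWords (n : Fin k → ℕ) (m : Fin k → ℤ) : Finset (Word n) :=
  Fintype.piFinset fun i => wordsLen (n i) (-(m i)).toNat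

/-- The words `β` with `|β_i| = m_i^+`. -/
def posWords (n : Fin k → ℕ) (m : Fin k → ℤ) : Finset (Word n) :=
  Fintype.piFinset fun i => wordsLen (n i) (m i).toNat

lemma mem_negWords {m : Fin k → ℤ} {α : Word n} :
    α ∈ negWords n m ↔ ∀ i, (α i).length = (-(m i)).toNat := by
  simp [negWords, Fintype.mem_piFinset, mem_wordsLen]

lemma mem_posWords {m : Fin k → ℤ} {α : Word n} :
    α ∈ posWords n m ↔ ∀ i, (α i).length = (m i).toNat := by
  simp [posWords, Fintype.mem_piFinset, mem_wordsLen]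

lemma reduced_of_mem {m : Fin k → ℤ} {α β : Word n} (hα : α ∈ negWords n m)
    (hβ : β ∈ posWords n m) : Reduced α β := fun i => by
  have h1 := mem_negWords.mp hα i
  have h2 := mem_posWords.mp hβ i
  rw [← List.length_eq_zero_iff, ← List.length_eq_zero_iff]
  omega

lemma homPart_eq (C : Coeff n E) (X : Tuple n H) (m : Fin k → ℤ) :
    homPart C X m = ∑ α ∈ negWords n m, ∑ β ∈ posWords n m,
      opTensor (C α β) (monomial X α * monomialStar X β) := by
  rw [negWords, ← sum_ofFn_eq_sum_piFinset]
  refine Finset.sum_congr rfl fun α _ => ?_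
  rw [posWords, ← sum_ofFn_eq_sum_piFinset (fun i => (m i).toNat) fun β =>
    opTensor (C (fun i => List.ofFn (α i)) β) (monomial X (fun i => List.ofFn (α i)) *
      monomialStar X β)]

/-- Only the coefficients at reduced pairs of words enter the series. -/
lemma homPart_congr {C D : Coeff n E} (h : ∀ α β, Reduced α β → C α β = D α β)
    (X : Tuple n H) : homPart C X = homPart D X := by
  funext m
  rw [homPart_eq, homPart_eq]
  refine Finset.sum_congr rfl fun α hα => Finset.sum_congr rfl fun β hβ => ?_
  rw [h α β (reduced_of_mem hα hβ)]

/-- The multidegree of the monomial `S_γ S_δ^*`. -/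
def multidegree (γ δ : Word n) : Fin k → ℤ := fun i => (δ i).length - (γ i).length

lemma mem_words_iff_multidegree {γ δ : Word n} (h : Reduced γ δ) (m : Fin k → ℤ) :
    (γ ∈ negWords n m ∧ δ ∈ posWords n m) ↔ m = multidegree γ δ := by
  rw [mem_negWords, mem_posWords]
  constructor
  · rintro ⟨h1, h2⟩
    funext i
    have := h1 i
    have := h2 i
    simp only [multidegree]
    omega
  · rintro rfl
    have h' : ∀ i, (γ i).length = 0 ∨ (δ i).length = 0 := fun i => by
      simpa only [List.length_eq_zero_iff] using h i
    constructor <;> intro i <;> simp only [multidegree] <;> have := h' i <;> omega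

lemma homPart_coeffOf_monomial [CompleteSpace E] (B : E →L[ℂ] E) {γ δ : Word n}
    (h : Reduced γ δ) (X : Tuple n H) (m : Fin k → ℤ) :
    homPart (coeffOf (opTensor B (monomial (universalModel n) γ *
      monomialStar (universalModel n) δ))) X m =
      if m = multidegree γ δ then opTensor B (monomial X γ * monomialStar X δ) else 0 := by
  classical
  rw [homPart_eq]
  have h1 : ∀ α ∈ negWords n m, ∀ β ∈ posWords n m,
      opTensor (coeffOf (opTensor B (monomial (universalModel n) γ *
        monomialStar (universalModel n) δ)) α β) (monomial X α * monomialStar X β) =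
      if α = γ then (if β = δ then opTensor B (monomial X γ * monomialStar X δ) else 0) else 0 := by
    intro α hα β hβ
    rw [coeffOf_monomial B (reduced_of_mem hα hβ)]
    by_cases h1 : α = γ
    · by_cases h2 : β = δ
      · simp [h1, h2]
      · simp [h1, h2, opTensor_zero_left]
    · simp [h1, opTensor_zero_left]
  rw [Finset.sum_congr rfl fun α hα => Finset.sum_congr rfl fun β hβ => h1 α hα β hβ]
  simp only [Finset.sum_ite_irrel, Finset.sum_const_zero, Finset.sum_ite_eq']
  rw [← ite_and]
  exact if_congr (mem_words_iff_multidegree h m) rfl rfl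

lemma continuous_opTensor_monomial (B : E →L[ℂ] E) (α β : Word n) :
    Continuous fun X : Tuple n H => opTensor B (monomial X α * monomialStar X β) := by
  refine (opTensorL E E H H B).continuous.comp ?_
  have hw : ∀ i (w : List (Fin (n i))), Continuous fun X : Tuple n H => wordOp X i w := fun i w =>
    continuous_list_prod _ fun j _ => (continuous_apply j).comp (continuous_apply i)
  refine Continuous.mul ?_ ?_
  · simp only [monomial, List.ofFn_eq_map]
    exact continuous_list_prod _ fun i _ => hw i _
  · simp only [monomialStar, List.ofFn_eq_map]
    exact continuous_list_prod _ fun i _ => (hw i _).star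

lemma continuous_homPart (C : Coeff n E) (m : Fin k → ℤ) :
    Continuous fun X : Tuple n H => homPart C X m := by
  simp only [homPart_eq]
  exact continuous_finsetSum _ fun α _ => continuous_finsetSum _ fun β _ =>
    continuous_opTensor_monomial _ _ _

lemma continuous_homPart_coeffOf [CompleteSpace E] (X : Tuple n H) (m : Fin k → ℤ) :
    Continuous fun A : HTensor E (Fock n) →L[ℂ] HTensor E (Fock n) => homPart (coeffOf A) X m := by
  simp only [homPart_eq]
  refine continuous_finsetSum _ fun α _ => continuous_finsetSum _ fun β _ => ?_
  exact ((opTensorL E E H H).flip (monomial X α * monomialStar X β)).continuous.comp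
    (continuous_coeffOf α β)

lemma homPart_scale (C : Coeff n E) (c : Fin k → ℂ) (X : Tuple n H) (m : Fin k → ℤ) :
    homPart C (scale c X) m =
      (∏ i, c i ^ (-(m i)).toNat * star (c i) ^ (m i).toNat) • homPart C X m := by
  simp only [homPart_eq, Finset.smul_sum]
  refine Finset.sum_congr rfl fun α hα => Finset.sum_congr rfl fun β hβ => ?_
  rw [← opTensor_smul_right, monomial, monomialStar]
  simp only [wordOp_scale, star_smul]
  rw [prod_ofFn_smul, prod_ofFn_smul, smul_mul_smul_comm, ← Finset.prod_mul_distrib]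
  congr 2
  refine Finset.prod_congr rfl fun i _ => ?_
  rw [mem_negWords.mp hα i, mem_posWords.mp hβ i, star_pow]

lemma homPart_ofReal_smul (C : Coeff n E) (r : ℝ) (X : Tuple n H) (m : Fin k → ℤ) :
    homPart C ((r : ℂ) • X) m = (∏ i, (r : ℂ) ^ (m i).natAbs) • homPart C X m := by
  have h : (r : ℂ) • X = scale (fun _ => (r : ℂ)) X := rfl
  rw [h, homPart_scale]
  congr 1
  refine Finset.prod_congr rfl fun i _ => ?_
  rw [Complex.star_def, Complex.conj_ofReal, ← pow_add]
  congr 1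
  omega

/-- The homogeneous parts are the isotypic components of the gauge action of the torus. -/
lemma homPart_rotate (C : Coeff n E) (z : Fin k → Circle) (X : Tuple n H) (m : Fin k → ℤ) :
    homPart C (rotate z⁻¹ X) m = (∏ i, (z i : ℂ) ^ (m i)) • homPart C X m := by
  have h : rotate z⁻¹ X = scale (fun i => ((z⁻¹ i : Circle) : ℂ)) X := rfl
  rw [h, homPart_scale]
  congr 1
  refine Finset.prod_congr rfl fun i _ => ?_
  have h1 : star (((z⁻¹ i : Circle)) : ℂ) = (z i : ℂ) := by
    rw [Complex.star_def, ← Circle.coe_inv_eq_conj]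
    simp
  have h0 : (z i : ℂ) ≠ 0 := Circle.coe_ne_zero _
  rw [h1, Pi.inv_apply, Circle.coe_inv]
  rcases le_total 0 (m i) with hm | hm
  · lift m i to ℕ using hm with p
    simp
  · obtain ⟨p, hp⟩ := Int.exists_eq_neg_ofNat hm
    rw [hp]
    simp

end HomPart

/-! ### The space `𝒫` -/

section ToeplitzSpace

variable {k : ℕ} {n : Fin k → ℕ} {E : Type u} [NormedAddCommGroup E] [InnerProductSpace ℂ E]

/-- The span of the operators `B ⊗ S_α S_β^*` in normal form. -/
def polySpan (E : Type*) [NormedAddCommGroup E] [InnerProductSpace ℂ E] (n : Fin k → ℕ) :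
    Submodule ℂ (HTensor E (Fock n) →L[ℂ] HTensor E (Fock n)) :=
  Submodule.span ℂ {R | ∃ (B : E →L[ℂ] E) (γ δ : Word n), Reduced γ δ ∧
    R = opTensor B (monomial (universalModel n) γ * monomialStar (universalModel n) δ)}

lemma monomial_mem_polyballAlgebra (α : Word n) :
    monomial (universalModel n) α ∈ polyballAlgebra n := by
  refine Subalgebra.le_topologicalClosure _ ?_
  induction α using word_induction with
  | nil =>
    rw [monomial_nil]
    exact one_mem _
  | cons i j α ih =>
    rw [monomial_consAt universalModel_commute]
    exact mul_mem (Algebra.subset_adjoin ⟨i, j, rfl⟩) ih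

/-- `B ⊗_min 𝒜_n` is the closed span of the operators `B ⊗ S_α`. -/
lemma minTensor_polyballAlgebra_le :
    minTensor E (polyballAlgebra n : Set (Fock n →L[ℂ] Fock n)) ≤
      (Submodule.span ℂ {R | ∃ (B : E →L[ℂ] E) (α : Word n),
        R = opTensor B (monomial (universalModel n) α)}).topologicalClosure := by
  set M := Submodule.span ℂ {R | ∃ (B : E →L[ℂ] E) (α : Word n),
        R = opTensor B (monomial (universalModel n) α)} with hM
  refine Submodule.topologicalClosure_minimal _ (Submodule.span_le.mpr ?_)
    M.isClosed_topologicalClosure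
  rintro _ ⟨B, T, hT, rfl⟩
  have hcl : IsClosed {T : Fock n →L[ℂ] Fock n | opTensor B T ∈ M.topologicalClosure} :=
    M.isClosed_topologicalClosure.preimage (opTensorL E E (Fock n) (Fock n) B).continuous
  refine closure_minimal (fun T hT => ?_) hcl hT
  refine M.le_topologicalClosure ?_
  have hsub : (Algebra.adjoin ℂ {T | ∃ i j, T = creation (n := n) i j}).toSubmodule ≤
      Submodule.comap (opTensorL E E (Fock n) (Fock n) B).toLinearMap M := by
    rw [Algebra.adjoin_eq_span]
    refine Submodule.span_le.mpr fun T hT => ?_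
    obtain ⟨α, rfl⟩ : ∃ α, T = monomial (universalModel n) α := by
      induction hT using Submonoid.closure_induction_left with
      | one => exact ⟨fun _ => [], (monomial_nil _).symm⟩
      | mul_left x hx y hy ih =>
        obtain ⟨i, j, rfl⟩ := hx
        obtain ⟨α, rfl⟩ := ih
        exact ⟨consAt i j α, (monomial_consAt universalModel_commute i j α).symm⟩
    exact Submodule.subset_span ⟨B, α, rfl⟩
  exact hsub hT

variable [CompleteSpace E]

lemma star_mul_mem_closure_polySpan (B D : E →L[ℂ] E) (α β : Word n) :
    star (opTensor B (monomial (universalModel n) α)) *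
      opTensor D (monomial (universalModel n) β) ∈ (polySpan E n).topologicalClosure := by
  rw [star_opTensor, ← opTensor_mul]
  rcases star_monomial_mul_monomial α β with h | ⟨γ, δ, hred, h⟩
  · rw [h, opTensor_zero_right]
    exact zero_mem _
  · rw [h]
    exact Submodule.le_topologicalClosure _ (Submodule.subset_span ⟨_, γ, δ, hred, rfl⟩)

/-- If `f^* g` lies in a closed subspace for all `f`, `g` in two sets, then it does so for all
`f`, `g` in their closed spans. -/
lemma star_mul_mem_of_mem_closure_span {A : Type*} [CStarAlgebra A] {S T : Set A}
    {Q : Submodule ℂ A} (hQ : IsClosed (Q : Set A)) (h : ∀ f ∈ S, ∀ g ∈ T, star f * g ∈ Q)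
    {f g : A} (hf : f ∈ (Submodule.span ℂ S).topologicalClosure)
    (hg : g ∈ (Submodule.span ℂ T).topologicalClosure) : star f * g ∈ Q := by
  have h0 : ∀ f ∈ Submodule.span ℂ S, ∀ g ∈ Submodule.span ℂ T, star f * g ∈ Q := by
    intro f hf g hg
    induction hf using Submodule.span_induction with
    | zero => simp
    | add f f' _ _ h h' => rw [star_add, add_mul]; exact Q.add_mem h h'
    | smul c f _ h => rw [star_smul, smul_mul_assoc]; exact Q.smul_mem _ h
    | mem f hf =>
      induction hg using Submodule.span_induction with
      | zero => simp
      | add f f' _ _ h h' => rw [mul_add]; exact Q.add_mem h h'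
      | smul c f _ h => rw [mul_smul_comm]; exact Q.smul_mem _ h
      | mem g hg => exact h f hf g hg
  have h1 : ∀ f ∈ (Submodule.span ℂ S).topologicalClosure, ∀ g ∈ Submodule.span ℂ T,
      star f * g ∈ Q := fun f hf g hg =>
    closure_minimal (fun f hf => h0 f hf g hg)
      (hQ.preimage (continuous_star.mul continuous_const) : IsClosed {f | star f * g ∈ Q}) hf
  exact closure_minimal (fun g hg => h1 f hf g hg)
    (hQ.preimage (continuous_const.mul continuous_id) : IsClosed {g | star f * g ∈ Q}) hg

/-- Every element of `𝒫` is a norm limit of polynomials in normal form, since the products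
`S_α^* S_β` reduce to normal-form monomials. -/
lemma toeplitzSpace_le_closure_polySpan :
    toeplitzSpace E n ≤ (polySpan E n).topologicalClosure := by
  refine Submodule.topologicalClosure_minimal _ (Submodule.span_le.mpr ?_)
    (polySpan E n).isClosed_topologicalClosure
  rintro _ ⟨f, hf, g, hg, rfl⟩
  refine star_mul_mem_of_mem_closure_span (polySpan E n).isClosed_topologicalClosure ?_
    (minTensor_polyballAlgebra_le hf) (minTensor_polyballAlgebra_le hg)
  rintro _ ⟨B, α, rfl⟩ _ ⟨D, β, rfl⟩
  exact star_mul_mem_closure_polySpan B D α β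

lemma opTensor_monomial_mem_toeplitzSpace (B : E →L[ℂ] E) {γ δ : Word n} (h : Reduced γ δ) :
    opTensor B (monomial (universalModel n) γ * monomialStar (universalModel n) δ) ∈
      toeplitzSpace E n := by
  have hmem : ∀ (B : E →L[ℂ] E) (α : Word n), opTensor B (monomial (universalModel n) α) ∈
      minTensor E (polyballAlgebra n : Set (Fock n →L[ℂ] Fock n)) := fun B α =>
    Submodule.le_topologicalClosure _ (Submodule.subset_span
      ⟨B, _, monomial_mem_polyballAlgebra α, rfl⟩)
  refine Submodule.le_topologicalClosure _ (Submodule.subset_span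
    ⟨_, hmem 1 δ, _, hmem B γ, ?_⟩)
  rw [star_opTensor, ← opTensor_mul, star_one, one_mul,
    monomialStar_eq_star universalModel_commute, (commute_monomial_star h).eq]

lemma homPart_universalModel_mem_toeplitzSpace (C : Coeff n E) (r : ℝ) (m : Fin k → ℤ) :
    homPart C ((r : ℂ) • universalModel n) m ∈ toeplitzSpace E n := by
  rw [homPart_ofReal_smul, homPart_eq]
  exact Submodule.smul_mem _ _ (Submodule.sum_mem _ fun α hα => Submodule.sum_mem _ fun β hβ =>
    opTensor_monomial_mem_toeplitzSpace _ (reduced_of_mem hα hβ))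

lemma exists_polySpan_norm_sub_lt {A : HTensor E (Fock n) →L[ℂ] HTensor E (Fock n)}
    (hA : A ∈ toeplitzSpace E n) {ε : ℝ} (hε : 0 < ε) : ∃ p ∈ polySpan E n, ‖A - p‖ < ε := by
  have h : A ∈ closure (polySpan E n : Set _) := toeplitzSpace_le_closure_polySpan hA
  obtain ⟨p, hp, hd⟩ := Metric.mem_closure_iff.mp h ε hε
  exact ⟨p, hp, by rwa [← dist_eq_norm]⟩

/-! ### The homogeneous expansion of the Berezin transform -/

variable {H : Type*} [NormedAddCommGroup H] [InnerProductSpace ℂ H] [CompleteSpace H]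

/-- For a polynomial, the Berezin transform evaluates the polynomial. -/
lemma berezin_of_mem_polySpan (H : Type*) [NormedAddCommGroup H] [InnerProductSpace ℂ H]
    [CompleteSpace H] {p : HTensor E (Fock n) →L[ℂ] HTensor E (Fock n)} (hp : p ∈ polySpan E n) :
    ∃ s : Finset (Fin k → ℤ), (∀ X : Tuple n H, ∀ m ∉ s, homPart (coeffOf p) X m = 0) ∧
      ∀ X ∈ polyball n H, berezin X p = ∑ m ∈ s, homPart (coeffOf p) X m := by
  classical
  induction hp using Submodule.span_induction with
  | zero =>
    refine ⟨∅, fun X m _ => ?_, fun X hX => ?_⟩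
    · rw [coeffOf_zero]
      simpa using homPart_smul (0 : ℂ) (0 : Coeff n E) X m
    · rw [← berezinL_apply hX, map_zero, Finset.sum_empty]
  | mem p hp =>
    obtain ⟨B, γ, δ, h, rfl⟩ := hp
    refine ⟨{multidegree γ δ}, fun X m hm => ?_, fun X hX => ?_⟩
    · rw [homPart_coeffOf_monomial B h, if_neg (by simpa using hm)]
    · rw [Finset.sum_singleton, homPart_coeffOf_monomial B h, if_pos rfl, berezin_monomial hX]
  | add p q _ _ hp hq =>
    obtain ⟨s, hs, hs'⟩ := hp
    obtain ⟨t, ht, ht'⟩ := hq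
    refine ⟨s ∪ t, fun X m hm => ?_, fun X hX => ?_⟩
    · rw [Finset.mem_union, not_or] at hm
      rw [coeffOf_add, homPart_add, hs X m hm.1, ht X m hm.2, add_zero]
    · rw [← berezinL_apply hX, map_add, berezinL_apply, berezinL_apply, hs' X hX, ht' X hX]
      simp only [coeffOf_add, homPart_add, Finset.sum_add_distrib]
      congr 1
      · exact Finset.sum_subset Finset.subset_union_left fun m _ hm => hs X m hm
      · exact Finset.sum_subset Finset.subset_union_right fun m _ hm => ht X m hm
  | smul c p _ hp =>
    obtain ⟨s, hs, hs'⟩ := hp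
    refine ⟨s, fun X m hm => ?_, fun X hX => ?_⟩
    · rw [coeffOf_smul, homPart_smul, hs X m hm, smul_zero]
    · rw [← berezinL_apply hX, map_smul, berezinL_apply, hs' X hX, Finset.smul_sum]
      simp only [coeffOf_smul, homPart_smul]

/-- Homogeneous parts are bounded by the norm of the symbol: averaging the Berezin transform over
the torus orbit of `X` extracts the homogeneous part. -/
lemma norm_homPart_coeffOf_le {A : HTensor E (Fock n) →L[ℂ] HTensor E (Fock n)}
    (hA : A ∈ toeplitzSpace E n) {X : Tuple n H} (hX : X ∈ polyball n H) (m : Fin k → ℤ) :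
    ‖homPart (coeffOf A) X m‖ ≤ ‖A‖ := by
  refine closure_minimal
    (s := (polySpan E n : Set (HTensor E (Fock n) →L[ℂ] HTensor E (Fock n)))) (fun p hp => ?_)
    (isClosed_le (continuous_homPart_coeffOf X m).norm continuous_norm)
    (toeplitzSpace_le_closure_polySpan hA)
  obtain ⟨s, hs, hs'⟩ := berezin_of_mem_polySpan H hp
  by_cases hm : m ∈ s
  · refine norm_coeff_le_of_trigPoly s (homPart (coeffOf p) X) ‖p‖ (fun z => ?_) hm
    have hz := rotate_mem_polyball hX z⁻¹
    have h := norm_berezin_le hz p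
    rw [hs' _ hz] at h
    simpa only [homPart_rotate] using h
  · change ‖homPart (coeffOf p) X m‖ ≤ ‖p‖
    rw [hs X m hm, norm_zero]
    exact norm_nonneg _

/-- The total mass `∑_m ρ^{|m_1| + ⋯ + |m_k|}`. -/
def geomMass (k : ℕ) (ρ : ℝ) : ℝ := ∑' m : Fin k → ℤ, ∏ i, ρ ^ (m i).natAbs

lemma summable_geomMass (k : ℕ) {ρ : ℝ} (h0 : 0 ≤ ρ) (h1 : ρ < 1) :
    Summable fun m : Fin k → ℤ => ∏ i, ρ ^ (m i).natAbs :=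
  summable_prod_fin (f := fun _ (m : ℤ) => ρ ^ m.natAbs) (fun _ _ => by positivity)
    fun _ => summable_pow_natAbs h0 h1

/-- At a point `ρ Y` the homogeneous part of degree `m` gains the factor `ρ^{|m_1| + ⋯ + |m_k|}`,
which makes the series absolutely convergent for `ρ < 1`. -/
lemma norm_homPart_smul_le {A : HTensor E (Fock n) →L[ℂ] HTensor E (Fock n)}
    (hA : A ∈ toeplitzSpace E n) {Y : Tuple n H} (hY : Y ∈ polyball n H) {ρ : ℝ} (h0 : 0 ≤ ρ)
    (m : Fin k → ℤ) :
    ‖homPart (coeffOf A) ((ρ : ℂ) • Y) m‖ ≤ (∏ i, ρ ^ (m i).natAbs) * ‖A‖ := by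
  rw [homPart_ofReal_smul, norm_smul]
  refine mul_le_mul (le_of_eq ?_) (norm_homPart_coeffOf_le hA hY m) (norm_nonneg _) (by positivity)
  simp [norm_prod, abs_of_nonneg h0]

lemma summable_homPart {A : HTensor E (Fock n) →L[ℂ] HTensor E (Fock n)}
    (hA : A ∈ toeplitzSpace E n) {Y : Tuple n H} (hY : Y ∈ polyball n H) {ρ : ℝ} (h0 : 0 ≤ ρ)
    (h1 : ρ < 1) : Summable (homPart (coeffOf A) ((ρ : ℂ) • Y)) :=
  Summable.of_norm_bounded ((summable_geomMass k h0 h1).mul_right ‖A‖)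
    (norm_homPart_smul_le hA hY h0)

lemma polySpan_le_toeplitzSpace : polySpan E n ≤ toeplitzSpace E n := by
  refine Submodule.span_le.mpr ?_
  rintro _ ⟨B, γ, δ, h, rfl⟩
  exact opTensor_monomial_mem_toeplitzSpace B h

/-- For `A ∈ 𝒫`, the Berezin transform of `A` is the free pluriharmonic function whose
coefficients are the matrix entries of `A`. -/
theorem seriesAt_berezin {A : HTensor E (Fock n) →L[ℂ] HTensor E (Fock n)}
    (hA : A ∈ toeplitzSpace E n) {X : Tuple n H} (hX : X ∈ polyball n H) :
    SeriesAt (coeffOf A) X (berezin X A) := by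
  obtain ⟨ρ, h0, h1, Y, hY, rfl⟩ := exists_smul_mem_polyball hX
  have hs := summable_homPart hA hY h0.le h1
  suffices h : ∑' m, homPart (coeffOf A) ((ρ : ℂ) • Y) m = berezin ((ρ : ℂ) • Y) A by
    rw [← h]
    exact hasIterSum_of_summable hs
  -- Both sides are bounded linear in `A` and agree on polynomials; the bounds are `geomMass k ρ`
  -- and `1`.
  refine eq_of_forall_dist_le fun ε hε => ?_
  set c := geomMass k ρ with hc
  have hc0 : 0 ≤ c := tsum_nonneg fun m => Finset.prod_nonneg fun i _ => by positivity
  obtain ⟨p, hp, hAp⟩ := exists_polySpan_norm_sub_lt hA (ε := ε / (c + 1)) (by positivity)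
  have hp' := polySpan_le_toeplitzSpace hp
  obtain ⟨s, hs0, hs'⟩ := berezin_of_mem_polySpan H hp
  have e1 : ∑' m, homPart (coeffOf p) ((ρ : ℂ) • Y) m = berezin ((ρ : ℂ) • Y) p := by
    rw [hs' _ hX]
    exact tsum_eq_sum fun m hm => hs0 _ m hm
  have hd : ∀ m, homPart (coeffOf A) ((ρ : ℂ) • Y) m - homPart (coeffOf p) ((ρ : ℂ) • Y) m =
      homPart (coeffOf (A - p)) ((ρ : ℂ) • Y) m := fun m => by
    have : A = (A - p) + p := by abel
    conv_lhs => rw [this, coeffOf_add, homPart_add]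
    rw [add_sub_cancel_right]
  have hm := sub_mem hA hp'
  have e2 : ‖∑' m, homPart (coeffOf A) ((ρ : ℂ) • Y) m -
      ∑' m, homPart (coeffOf p) ((ρ : ℂ) • Y) m‖ ≤ c * ‖A - p‖ := by
    rw [← hs.tsum_sub (summable_homPart hp' hY h0.le h1)]
    simp only [hd]
    refine (tsum_of_norm_bounded ((summable_geomMass k h0.le h1).mul_right ‖A - p‖).hasSum
      (norm_homPart_smul_le hm hY h0.le)).trans (le_of_eq ?_)
    rw [tsum_mul_right]
    rfl
  have e3 : ‖berezin ((ρ : ℂ) • Y) p - berezin ((ρ : ℂ) • Y) A‖ ≤ ‖A - p‖ := by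
    rw [← berezinL_apply hX, ← berezinL_apply hX, ← map_sub, norm_sub_rev A]
    exact norm_berezin_le hX _
  rw [dist_eq_norm]
  calc _ = ‖(∑' m, homPart (coeffOf A) ((ρ : ℂ) • Y) m -
      ∑' m, homPart (coeffOf p) ((ρ : ℂ) • Y) m) +
      (berezin ((ρ : ℂ) • Y) p - berezin ((ρ : ℂ) • Y) A)‖ := by rw [e1]; congr 1; abel
    _ ≤ c * ‖A - p‖ + ‖A - p‖ := (norm_add_le _ _).trans (add_le_add e2 e3)
    _ = (c + 1) * ‖A - p‖ := by ring
    _ ≤ (c + 1) * (ε / (c + 1)) := by gcongr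
    _ = ε := by field_simp

/-- The Berezin transform of an element of `𝒫` extends continuously to the closed polyball. -/
lemma hasContExt_berezin {A : HTensor E (Fock n) →L[ℂ] HTensor E (Fock n)}
    (hA : A ∈ toeplitzSpace E n) : HasContExt fun X : polyball n H => berezin X.1 A := by
  have di : IsDenseInducing (Set.inclusion (subset_closure (s := polyball n H))) :=
    ⟨(Topology.IsEmbedding.inclusion _).isInducing, denseRange_inclusion_iff _ |>.mpr subset_rfl⟩
  set f : polyball n H → (HTensor E H →L[ℂ] HTensor E H) := fun X => berezin X.1 A with hf
  have hlim : ∀ x, ∃ c, Tendsto f (comap (Set.inclusion (subset_closure (s := polyball n H)))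
      (𝓝 x)) (𝓝 c) := fun x => by
    have : (comap (Set.inclusion (subset_closure (s := polyball n H))) (𝓝 x)).NeBot :=
      di.comap_nhds_neBot x
    refine cauchy_map_iff_exists_tendsto.mp (Metric.cauchy_iff.mpr ⟨inferInstance, fun ε hε => ?_⟩)
    obtain ⟨p, hp, hAp⟩ := exists_polySpan_norm_sub_lt hA (ε := ε / 4) (by positivity)
    obtain ⟨s, -, hs⟩ := berezin_of_mem_polySpan H hp
    have hc : Continuous fun X : closure (polyball n H) =>
        ∑ m ∈ s, homPart (coeffOf p) X.1 m :=
      continuous_finsetSum _ fun m _ => (continuous_homPart _ m).comp continuous_subtype_val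
    have hball := hc.continuousAt.preimage_mem_nhds (x := x) (Metric.ball_mem_nhds _
      (show 0 < ε / 4 by positivity))
    refine ⟨f '' _, image_mem_map (preimage_mem_comap hball), ?_⟩
    have hb : ∀ X : polyball n H, ‖f X - ∑ m ∈ s, homPart (coeffOf p) X.1 m‖ < ε / 4 :=
        fun X => by
      rw [← hs X.1 X.2, hf]
      simp only
      rw [← berezinL_apply X.2, ← berezinL_apply X.2, ← map_sub]
      exact (norm_berezin_le X.2 _).trans_lt hAp
    rintro _ ⟨X, hX, rfl⟩ _ ⟨Y, hY, rfl⟩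
    simp only [Set.mem_preimage, Metric.mem_ball, dist_eq_norm] at hX hY
    have hX' := hb X
    have hY' := hb Y
    rw [dist_eq_norm]
    set S : (Tuple n H) → (HTensor E H →L[ℂ] HTensor E H) :=
      fun Z => ∑ m ∈ s, homPart (coeffOf p) Z m with hS
    calc ‖f X - f Y‖ = ‖(f X - S X.1) + (S X.1 - S x.1) - ((f Y - S Y.1) + (S Y.1 - S x.1))‖ := by
          congr 1; abel
      _ ≤ (‖f X - S X.1‖ + ‖S X.1 - S x.1‖) + (‖f Y - S Y.1‖ + ‖S Y.1 - S x.1‖) :=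
          (norm_sub_le _ _).trans (add_le_add (norm_add_le _ _) (norm_add_le _ _))
      _ < (ε / 4 + ε / 4) + (ε / 4 + ε / 4) :=
          add_lt_add (add_lt_add hX' hX) (add_lt_add hY' hY)
      _ = ε := by ring
  exact ⟨di.extend f, di.continuous_extend hlim, fun X => di.extend_eq' hlim X⟩

end ToeplitzSpace

/-! ### Copies of the universal model in other Hilbert spaces -/

section Copies

variable {k : ℕ} {n : Fin k → ℕ}

/-- An operator intertwining two tuples intertwines their monomials. -/
lemma comp_monomial {H H' : Type*} [NormedAddCommGroup H] [InnerProductSpace ℂ H]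
    [NormedAddCommGroup H'] [InnerProductSpace ℂ H']
    {L : H →L[ℂ] H'} {X : Tuple n H} {Y : Tuple n H'} (h : ∀ i j, L ∘L X i j = Y i j ∘L L)
    (hX : ∀ s t, s ≠ t → ∀ a b, Commute (X s a) (X t b))
    (hY : ∀ s t, s ≠ t → ∀ a b, Commute (Y s a) (Y t b)) (α : Word n) :
    L ∘L monomial X α = monomial Y α ∘L L := by
  induction α using word_induction with
  | nil =>
    rw [monomial_nil, monomial_nil]
    rfl
  | cons i j α ih =>
    rw [monomial_consAt hX, monomial_consAt hY]
    change (L ∘L X i j) ∘L monomial X α = Y i j ∘L (monomial Y α ∘L L)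
    rw [h, ContinuousLinearMap.comp_assoc, ih]

variable {H : Type*} [NormedAddCommGroup H] [InnerProductSpace ℂ H] [CompleteSpace H]

/-- The copy `V S V^*` of the universal model on the range of `V : F² → H`. -/
def copyModel (V : Fock n →L[ℂ] H) : Tuple n H := fun i j =>
  V ∘L universalModel n i j ∘L V.adjoint

variable {V : Fock n →L[ℂ] H}

lemma conj_mul_conj (hV : V.adjoint ∘L V = .id ℂ _) (S T : Fock n →L[ℂ] Fock n) :
    (V ∘L S ∘L V.adjoint) * (V ∘L T ∘L V.adjoint) = V ∘L (S * T) ∘L V.adjoint := by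
  change V ∘L S ∘L (V.adjoint ∘L V) ∘L T ∘L V.adjoint = V ∘L S ∘L T ∘L V.adjoint
  rw [hV, ContinuousLinearMap.id_comp]

lemma star_conj (S : Fock n →L[ℂ] Fock n) :
    star (V ∘L S ∘L V.adjoint) = V ∘L star S ∘L V.adjoint := by
  simp only [ContinuousLinearMap.star_eq_adjoint, ContinuousLinearMap.adjoint_comp,
    ContinuousLinearMap.adjoint_adjoint, ContinuousLinearMap.comp_assoc]

lemma norm_le_one_of_adjoint_comp_self (hV : V.adjoint ∘L V = .id ℂ _) : ‖V‖ ≤ 1 :=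
  V.opNorm_le_bound zero_le_one fun x => by
    have : inner ℂ (V x) (V x) = inner ℂ x x := by
      rw [← ContinuousLinearMap.adjoint_inner_right, ← ContinuousLinearMap.comp_apply, hV]
      rfl
    rw [@norm_eq_sqrt_re_inner ℂ, this, ← @norm_eq_sqrt_re_inner ℂ, one_mul]

lemma copyModel_commute (hV : V.adjoint ∘L V = .id ℂ _) (s t : Fin k) (h : s ≠ t)
    (a : Fin (n s)) (b : Fin (n t)) : Commute (copyModel V s a) (copyModel V t b) := by
  rw [Commute, SemiconjBy, copyModel, copyModel, conj_mul_conj hV, conj_mul_conj hV,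
    (universalModel_commute s t h a b).eq]

lemma norm_conj_le (hV : V.adjoint ∘L V = .id ℂ _) (S : Fock n →L[ℂ] Fock n) :
    ‖V ∘L S ∘L V.adjoint‖ ≤ ‖S‖ := by
  have h1 := norm_le_one_of_adjoint_comp_self hV
  have h2 : ‖V.adjoint‖ ≤ 1 := by simpa using h1
  calc _ ≤ ‖V‖ * (‖S‖ * ‖V.adjoint‖) :=
        (ContinuousLinearMap.opNorm_comp_le _ _).trans (mul_le_mul_of_nonneg_left
          (ContinuousLinearMap.opNorm_comp_le _ _) (norm_nonneg _))
    _ ≤ 1 * (‖S‖ * 1) := by gcongr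
    _ = ‖S‖ := by ring

lemma smul_copyModel_mem_polyball (hV : V.adjoint ∘L V = .id ℂ _) {r : ℝ} (h0 : 0 ≤ r)
    (h1 : r < 1) : (r : ℂ) • copyModel V ∈ polyball n H := by
  refine mem_polyball_of_doublyCommute (fun s t hst a b => ?_) (fun s t hst a b => ?_) fun i => ?_
  · exact ((copyModel_commute hV s t hst a b).smul_left (r : ℂ)).smul_right (r : ℂ)
  · simp only [Pi.smul_apply, star_smul]
    refine Commute.smul_left (Commute.smul_right ?_ _) _
    rw [Commute, SemiconjBy, copyModel, copyModel, star_conj, conj_mul_conj hV, conj_mul_conj hV]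
    congr 2
    exact (commute_creation_star hst a b).eq
  · have hsum : ∑ j, ((r : ℂ) • copyModel V) i j * star (((r : ℂ) • copyModel V) i j) =
        ((r : ℂ) * (r : ℂ)) • (V ∘L (∑ j, creation i j * star (creation i j)) ∘L V.adjoint) := by
      rw [ContinuousLinearMap.finsetSum_comp, ContinuousLinearMap.comp_finsetSum,
        Finset.smul_sum]
      refine Finset.sum_congr rfl fun j _ => ?_
      simp only [Pi.smul_apply, star_smul]
      rw [smul_mul_smul_comm, copyModel, star_conj, conj_mul_conj hV]
      simp [universalModel]
    rw [hsum, norm_smul]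
    have h2 := (norm_conj_le hV _).trans (norm_sum_creation_mul_star_le (n := n) i)
    have h3 : ‖(r : ℂ) * (r : ℂ)‖ = r * r := by
      rw [norm_mul, Complex.norm_real, Real.norm_of_nonneg h0]
    rw [h3]
    calc _ ≤ r * r * 1 := by gcongr
      _ < 1 := by nlinarith

lemma copyModel_id : copyModel (.id ℂ (Fock n)) = universalModel n := by
  have hid : (ContinuousLinearMap.id ℂ (Fock n)).adjoint = .id ℂ _ :=
    star_one (Fock n →L[ℂ] Fock n)
  funext i j
  rw [copyModel, hid]
  rfl

lemma smul_universalModel_mem_polyball {r : ℝ} (h0 : 0 ≤ r) (h1 : r < 1) :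
    (r : ℂ) • universalModel n ∈ polyball n (Fock n) := by
  have hid : (ContinuousLinearMap.id ℂ (Fock n)).adjoint = .id ℂ _ :=
    star_one (Fock n →L[ℂ] Fock n)
  rw [← copyModel_id]
  exact smul_copyModel_mem_polyball (by rw [hid]; rfl) h0 h1

variable {E : Type u} [NormedAddCommGroup E] [InnerProductSpace ℂ E]

/-- The compression `T ↦ (I ⊗ V^*) T (I ⊗ V)` from `E ⊗ H` to `E ⊗ F²`. -/
def compress (V : Fock n →L[ℂ] H) (T : HTensor E H →L[ℂ] HTensor E H) :
    HTensor E (Fock n) →L[ℂ] HTensor E (Fock n) :=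
  opTensor (.id ℂ E) V.adjoint ∘L T ∘L opTensor (.id ℂ E) V

lemma continuous_compress (V : Fock n →L[ℂ] H) : Continuous (compress (E := E) V) :=
  continuous_const.clm_comp (continuous_id.clm_comp continuous_const)

lemma compress_add (V : Fock n →L[ℂ] H) (S T : HTensor E H →L[ℂ] HTensor E H) :
    compress V (S + T) = compress V S + compress V T := by
  simp only [compress, ContinuousLinearMap.add_comp, ContinuousLinearMap.comp_add]

/-- `compress` as an additive map. -/
def compressHom (E : Type*) [NormedAddCommGroup E] [InnerProductSpace ℂ E] (V : Fock n →L[ℂ] H) :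
    (HTensor E H →L[ℂ] HTensor E H) →+ (HTensor E (Fock n) →L[ℂ] HTensor E (Fock n)) :=
  AddMonoidHom.mk' (compress V) (compress_add V)

lemma compress_homPart (hV : V.adjoint ∘L V = .id ℂ _) (C : Coeff n E) (r : ℝ)
    (m : Fin k → ℤ) : compress V (homPart C ((r : ℂ) • copyModel V) m) =
      homPart C ((r : ℂ) • universalModel n) m := by
  have hX : ∀ s t, s ≠ t → ∀ a b, Commute (((r : ℂ) • copyModel V) s a)
      (((r : ℂ) • copyModel V) t b) := fun s t hst a b =>
    ((copyModel_commute hV s t hst a b).smul_left (r : ℂ)).smul_right (r : ℂ)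
  have hS : ∀ s t, s ≠ t → ∀ a b, Commute (((r : ℂ) • universalModel n) s a)
      (((r : ℂ) • universalModel n) t b) := fun s t hst a b =>
    ((universalModel_commute s t hst a b).smul_left (r : ℂ)).smul_right (r : ℂ)
  have hL : ∀ i j, V.adjoint ∘L ((r : ℂ) • copyModel V) i j =
      ((r : ℂ) • universalModel n) i j ∘L V.adjoint := fun i j => by
    simp only [Pi.smul_apply, ContinuousLinearMap.comp_smul, ContinuousLinearMap.smul_comp]
    rw [copyModel, ← ContinuousLinearMap.comp_assoc, hV, ContinuousLinearMap.id_comp]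
  have h1 := comp_monomial hL hX hS
  have h2 : ∀ β, monomialStar ((r : ℂ) • copyModel V) β ∘L V =
      V ∘L monomialStar ((r : ℂ) • universalModel n) β := fun β => by
    have := congrArg ContinuousLinearMap.adjoint (h1 β)
    rw [ContinuousLinearMap.adjoint_comp, ContinuousLinearMap.adjoint_comp,
      ContinuousLinearMap.adjoint_adjoint] at this
    rw [monomialStar_eq_star hX, monomialStar_eq_star hS]
    exact this
  have h3 : ∀ B : E →L[ℂ] E, ∀ α β, compress V (opTensor B (monomial ((r : ℂ) • copyModel V) α *
      monomialStar ((r : ℂ) • copyModel V) β)) =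
      opTensor B (monomial ((r : ℂ) • universalModel n) α *
        monomialStar ((r : ℂ) • universalModel n) β) := fun B α β => by
    rw [compress, ← opTensor_comp, ← opTensor_comp, ContinuousLinearMap.comp_id,
      ContinuousLinearMap.id_comp]
    congr 1
    change (V.adjoint ∘L monomial ((r : ℂ) • copyModel V) α) ∘L
      (monomialStar ((r : ℂ) • copyModel V) β ∘L V) = _
    rw [h1, h2, ContinuousLinearMap.comp_assoc, ← ContinuousLinearMap.comp_assoc V.adjoint, hV,
      ContinuousLinearMap.id_comp]
    rfl
  change compressHom E V _ = _
  simp only [homPart_eq, map_sum]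
  exact Finset.sum_congr rfl fun α _ => Finset.sum_congr rfl fun β _ => h3 _ α β

/-- Evaluating at the copy of `r S` and compressing evaluates at `r S`. -/
lemma seriesAt_compress (hV : V.adjoint ∘L V = .id ℂ _) {C : Coeff n E} {r : ℝ}
    {T : HTensor E H →L[ℂ] HTensor E H} (hT : SeriesAt C ((r : ℂ) • copyModel V) T) :
    SeriesAt C ((r : ℂ) • universalModel n) (compress V T) := by
  have h := HasIterSum.map (compressHom E V) (continuous_compress V) hT
  have e : (fun m => compressHom E V (homPart C ((r : ℂ) • copyModel V) m)) =
      homPart C ((r : ℂ) • universalModel n) := funext fun m => compress_homPart hV C r m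
  rw [e] at h
  exact h

lemma norm_opMatrix_compress_isometry_le [CompleteSpace E] (hV : V.adjoint ∘L V = .id ℂ _) {d : ℕ}
    (T : Matrix (Fin d) (Fin d) (HTensor E H →L[ℂ] HTensor E H)) :
    ‖opMatrix (Matrix.of fun i j => compress V (T i j))‖ ≤ ‖opMatrix T‖ := by
  have hid : (ContinuousLinearMap.id ℂ E).adjoint = .id ℂ E := star_one (E →L[ℂ] E)
  have hW : (opTensor (.id ℂ E) V).adjoint = opTensor (.id ℂ E) V.adjoint := by
    rw [adjoint_opTensor, hid]
  have h := norm_opMatrix_compress_le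
    (fun j : Fin d => inclusionL (HTensor E H) j ∘L opTensor (.id ℂ E) V) (fun i j x y => by
      rw [ContinuousLinearMap.comp_apply, ContinuousLinearMap.comp_apply, inner_inclusionL,
        ← ContinuousLinearMap.adjoint_inner_right, hW, ← ContinuousLinearMap.comp_apply,
        ← opTensor_comp, hV, ContinuousLinearMap.id_comp, opTensor_id]
      rfl) (opMatrix T)
  have e : ∀ i j, (inclusionL (HTensor E H) i ∘L opTensor (.id ℂ E) V).adjoint ∘L
      opMatrix T ∘L inclusionL (HTensor E H) j ∘L opTensor (.id ℂ E) V = compress V (T i j) := by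
    intro i j
    rw [compress, ← inclusionL_adjoint_comp T i j, ContinuousLinearMap.adjoint_comp, hW]
    simp only [ContinuousLinearMap.comp_assoc]
  simpa only [e] using h

/-- An orthonormal family indexed by the words gives an isometric copy of `F²`. -/
lemma exists_isometry_of_orthonormal {w : Word n → H} (hw : Orthonormal ℂ w) :
    ∃ V : Fock n →L[ℂ] H, V.adjoint ∘L V = .id ℂ _ := by
  refine ⟨hw.orthogonalFamily.linearIsometry.toContinuousLinearMap,
    ContinuousLinearMap.ext fun x => ext_inner_left ℂ fun y => ?_⟩
  rw [ContinuousLinearMap.comp_apply, ContinuousLinearMap.adjoint_inner_right]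
  exact LinearIsometry.inner_map_map _ y x

/-- Since the set of words is countable, every infinite-dimensional Hilbert space contains an
isometric copy of `F²`. -/
lemma exists_isometry_of_infinite (n : Fin k → ℕ) (hH : ¬ FiniteDimensional ℂ H) :
    ∃ V : Fock n →L[ℂ] H, V.adjoint ∘L V = .id ℂ _ := by
  obtain ⟨w, b, hb⟩ := exists_hilbertBasis ℂ H
  have hinf : Infinite w := by
    by_contra hfin
    rw [not_infinite_iff_finite] at hfin
    have : Fintype w := Fintype.ofFinite w
    have hd := b.dense_span
    have hfd : FiniteDimensional ℂ (Submodule.span ℂ (Set.range b)) :=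
      FiniteDimensional.span_of_finite ℂ (Set.finite_range b)
    rw [(Submodule.closed_of_finiteDimensional _).submodule_topologicalClosure_eq] at hd
    rw [hd] at hfd
    exact hH (Submodule.topEquiv.finiteDimensional)
  obtain ⟨f, hf⟩ := exists_injective_nat (Word n)
  exact exists_isometry_of_orthonormal
    (b.orthonormal.comp _ ((Infinite.natEmbedding w).injective.comp hf))

end Copies

/-! ### Radial limits -/

section RadialPath

variable {k : ℕ} {n : Fin k → ℕ}

lemma eventually_radius : ∀ᶠ r : ℝ in 𝓝[<] 1, r ∈ Set.Ico (0 : ℝ) 1 :=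
  Ico_mem_nhdsLT zero_lt_one

lemma tendsto_ofReal_smul {H : Type*} [NormedAddCommGroup H] [InnerProductSpace ℂ H]
    (X : Tuple n H) : Tendsto (fun r : ℝ => (r : ℂ) • X) (𝓝[<] 1) (𝓝 X) := by
  have hc : Continuous fun r : ℝ => (r : ℂ) • X := by fun_prop
  have := hc.tendsto 1
  rw [Complex.ofReal_one, one_smul] at this
  exact this.mono_left nhdsWithin_le_nhds

variable {E : Type u} [NormedAddCommGroup E] [InnerProductSpace ℂ E]
  {H : Type*} [NormedAddCommGroup H] [InnerProductSpace ℂ H] [CompleteSpace H]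
  {V : Fock n →L[ℂ] H}

/-- If a free pluriharmonic function extends continuously to the closed polyball of a Hilbert
space containing a copy `V S V^*` of the universal model, then it has a radial limit: the path
`r V S V^*` ends in the closed polyball. -/
lemma exists_radialLimit_of_hasContExt (hV : V.adjoint ∘L V = .id ℂ _) {C : Coeff n E}
    {F : polyball n H → (HTensor E H →L[ℂ] HTensor E H)} (hC : Represents C F)
    (hF : HasContExt F) : ∃ A, RadialLimit C A := by
  obtain ⟨G, hG, hGF⟩ := hF
  have hmem : ∀ r : Set.Icc (0 : ℝ) 1, ((r : ℝ) : ℂ) • copyModel V ∈ closure (polyball n H) := by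
    rintro ⟨r, h0, h1⟩
    rcases h1.lt_or_eq with h | rfl
    · exact subset_closure (smul_copyModel_mem_polyball hV h0 h)
    · rw [Complex.ofReal_one, one_smul]
      refine mem_closure_of_tendsto (tendsto_ofReal_smul (copyModel V)) ?_
      filter_upwards [eventually_radius] with r hr
      exact smul_copyModel_mem_polyball hV hr.1 hr.2
  -- The radius is clamped to `[0, 1]` so that the path is defined, and continuous, on all of `ℝ`.
  set g : ℝ → HTensor E (Fock n) →L[ℂ] HTensor E (Fock n) := fun r =>
    compress V (G ⟨_, hmem (Set.projIcc 0 1 zero_le_one r)⟩) with hg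
  have hgc : Continuous g := by
    refine (continuous_compress V).comp (hG.comp (Continuous.subtype_mk ?_ _))
    have : Continuous fun r : ℝ => ((Set.projIcc (0 : ℝ) 1 zero_le_one r : ℝ) : ℂ) :=
      Complex.continuous_ofReal.comp (continuous_subtype_val.comp continuous_projIcc)
    exact this.smul continuous_const
  refine ⟨g 1, g, fun r hr => ?_, (hgc.tendsto 1).mono_left nhdsWithin_le_nhds⟩
  have hproj : Set.projIcc (0 : ℝ) 1 zero_le_one r = ⟨r, hr.1, hr.2.le⟩ :=
    Set.projIcc_of_mem _ ⟨hr.1, hr.2.le⟩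
  have hX := smul_copyModel_mem_polyball hV hr.1 hr.2
  have e : g r = compress V (F ⟨_, hX⟩) := by
    rw [hg, ← hGF]
    simp only [hproj]
  rw [e]
  exact seriesAt_compress hV (hC ⟨_, hX⟩)

end RadialPath

section Radial

variable {k : ℕ} {n : Fin k → ℕ} {E : Type u} [NormedAddCommGroup E] [InnerProductSpace ℂ E]
  [CompleteSpace E]

lemma tendsto_berezin_of_mem_polySpan {p : HTensor E (Fock n) →L[ℂ] HTensor E (Fock n)}
    (hp : p ∈ polySpan E n) :
    Tendsto (fun r : ℝ => berezin ((r : ℂ) • universalModel n) p) (𝓝[<] 1) (𝓝 p) := by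
  induction hp using Submodule.span_induction with
  | zero =>
    refine tendsto_const_nhds.congr fun r => ?_
    simpa using (berezin_smul ((r : ℂ) • universalModel n) 0
      (0 : HTensor E (Fock n) →L[ℂ] HTensor E (Fock n))).symm
  | mem p hp =>
    obtain ⟨B, γ, δ, -, rfl⟩ := hp
    have h := ((continuous_opTensor_monomial B γ δ).tendsto (universalModel n)).comp
      (tendsto_ofReal_smul (universalModel n))
    refine h.congr' ?_
    filter_upwards [eventually_radius] with r hr
    rw [berezin_monomial (smul_universalModel_mem_polyball hr.1 hr.2)]
    rfl
  | add p q _ _ hp hq =>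
    refine (hp.add hq).congr fun r => ?_
    rw [berezin_add]
  | smul c p _ hp =>
    refine (hp.const_smul c).congr fun r => ?_
    rw [berezin_smul]

/-- Elements of `𝒫` are recovered as radial limits of their Berezin transforms at the universal
model: this holds for polynomials, and the transforms are uniformly contractive. -/
lemma tendsto_berezin {A : HTensor E (Fock n) →L[ℂ] HTensor E (Fock n)}
    (hA : A ∈ toeplitzSpace E n) :
    Tendsto (fun r : ℝ => berezin ((r : ℂ) • universalModel n) A) (𝓝[<] 1) (𝓝 A) := by
  rw [Metric.tendsto_nhds]
  intro ε hε
  obtain ⟨p, hp, hAp⟩ := exists_polySpan_norm_sub_lt hA (ε := ε / 3) (by positivity)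
  filter_upwards [eventually_radius, Metric.tendsto_nhds.mp (tendsto_berezin_of_mem_polySpan hp)
    (ε / 3) (by positivity)] with r hr hrp
  have hmem := smul_universalModel_mem_polyball (n := n) hr.1 hr.2
  rw [dist_eq_norm] at hrp ⊢
  have h1 : ‖berezin ((r : ℂ) • universalModel n) A - berezin ((r : ℂ) • universalModel n) p‖ ≤
      ‖A - p‖ := by
    rw [← berezinL_apply hmem, ← berezinL_apply hmem, ← map_sub]
    exact norm_berezin_le hmem _
  calc _ = ‖(berezin ((r : ℂ) • universalModel n) A - berezin ((r : ℂ) • universalModel n) p) +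
        (berezin ((r : ℂ) • universalModel n) p - p) - (A - p)‖ := by congr 1; abel
    _ ≤ ‖A - p‖ + ‖berezin ((r : ℂ) • universalModel n) p - p‖ + ‖A - p‖ :=
        (norm_sub_le _ _).trans (add_le_add ((norm_add_le _ _).trans
          (add_le_add h1 le_rfl)) le_rfl)
    _ < ε / 3 + ε / 3 + ε / 3 := by linarith
    _ = ε := by ring

lemma radialLimit_coeffOf {A : HTensor E (Fock n) →L[ℂ] HTensor E (Fock n)}
    (hA : A ∈ toeplitzSpace E n) : RadialLimit (coeffOf A) A :=
  ⟨fun r => berezin ((r : ℂ) • universalModel n) A,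
    fun _ hr => seriesAt_berezin hA (smul_universalModel_mem_polyball hr.1 hr.2),
    tendsto_berezin hA⟩

lemma coeffOf_sum {ι : Type*} (s : Finset ι)
    (T : ι → HTensor E (Fock n) →L[ℂ] HTensor E (Fock n)) (α β : Word n) :
    coeffOf (∑ i ∈ s, T i) α β = ∑ i ∈ s, coeffOf (T i) α β := by
  classical
  induction s using Finset.induction_on with
  | empty => simp [coeffOf_zero]
  | insert i s hi ih => rw [Finset.sum_insert hi, Finset.sum_insert hi, coeffOf_add, ← ih]; rfl

lemma coeffOf_homPart (C : Coeff n E) {α β : Word n} (h : Reduced α β) (r : ℝ) (m : Fin k → ℤ) :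
    coeffOf (homPart C ((r : ℂ) • universalModel n) m) α β =
      if m = multidegree α β then (∏ i, (r : ℂ) ^ (m i).natAbs) • C α β else 0 := by
  classical
  rw [homPart_ofReal_smul, coeffOf_smul, homPart_eq, Pi.smul_apply, Pi.smul_apply]
  have h1 : coeffOf (∑ γ ∈ negWords n m, ∑ δ ∈ posWords n m, opTensor (C γ δ)
      (monomial (universalModel n) γ * monomialStar (universalModel n) δ)) α β =
      if m = multidegree α β then C α β else 0 := by
    simp only [coeffOf_sum, coeffOf_monomial _ h, ite_and, Finset.sum_ite_irrel,
      Finset.sum_const_zero, Finset.sum_ite_eq]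
    rw [← ite_and]
    exact if_congr (mem_words_iff_multidegree h m) rfl rfl
  rw [h1]
  split_ifs <;> simp

/-- Taking a matrix entry of the value at `r S` picks out a single term of the iterated series. -/
lemma coeffOf_of_seriesAt {C : Coeff n E} {r : ℝ}
    {T : HTensor E (Fock n) →L[ℂ] HTensor E (Fock n)}
    (hT : SeriesAt C ((r : ℂ) • universalModel n) T) {α β : Word n} (h : Reduced α β) :
    coeffOf T α β = (∏ i, (r : ℂ) ^ (multidegree α β i).natAbs) • C α β := by
  classical
  have h1 := HasIterSum.map (AddMonoidHom.mk' (fun T : HTensor E (Fock n) →L[ℂ] _ => coeffOf T α β)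
    fun S T => by rw [coeffOf_add]; rfl) (continuous_coeffOf α β) hT
  simp only [AddMonoidHom.mk'_apply, coeffOf_homPart C h] at h1
  have h2 : HasSum (fun m : Fin k → ℤ => if m = multidegree α β then
      (∏ i, (r : ℂ) ^ (m i).natAbs) • C α β else 0)
      ((∏ i, (r : ℂ) ^ (multidegree α β i).natAbs) • C α β) := by
    convert hasSum_ite_eq (multidegree α β)
      ((∏ i, (r : ℂ) ^ (multidegree α β i).natAbs) • C α β) using 2 with m
    by_cases hm : m = multidegree α β <;> simp [hm]
  have h3 := hasIterSum_of_summable h2.summable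
  rw [h2.tsum_eq] at h3
  exact h1.unique h3

/-- A radial limit lies in `𝒫`: the homogeneous parts at `r S` are finite sums of normal-form
monomials, and `𝒫` is closed. -/
lemma RadialLimit.mem_toeplitzSpace {C : Coeff n E}
    {A : HTensor E (Fock n) →L[ℂ] HTensor E (Fock n)} (h : RadialLimit C A) :
    A ∈ toeplitzSpace E n := by
  obtain ⟨G, hG, hlim⟩ := h
  have hcl : IsClosed (toeplitzSpace E n : Set (HTensor E (Fock n) →L[ℂ] HTensor E (Fock n))) :=
    Submodule.isClosed_topologicalClosure _
  refine hcl.mem_of_tendsto hlim ?_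
  filter_upwards [eventually_radius] with r hr
  exact HasIterSum.mem (toeplitzSpace E n).toAddSubgroup hcl (hG r hr)
    fun m => homPart_universalModel_mem_toeplitzSpace C r m

/-- The matrix entries of a radial limit are the coefficients of the series, at the normal-form
pairs; the other values of `C` do not enter the series. -/
lemma RadialLimit.coeffOf_eq {C : Coeff n E}
    {A : HTensor E (Fock n) →L[ℂ] HTensor E (Fock n)} (h : RadialLimit C A) {α β : Word n}
    (hαβ : Reduced α β) : coeffOf A α β = C α β := by
  obtain ⟨G, hG, hlim⟩ := h
  have h1 := ((continuous_coeffOf α β).tendsto A).comp hlim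
  have hc : Continuous fun r : ℝ => (∏ i, (r : ℂ) ^ (multidegree α β i).natAbs) • C α β := by
    fun_prop
  have h2 := (hc.tendsto 1).mono_left (nhdsWithin_le_nhds (s := Set.Iio 1))
  simp only [Complex.ofReal_one, one_pow, Finset.prod_const_one, one_smul] at h2
  refine tendsto_nhds_unique h1 (h2.congr' ?_)
  filter_upwards [eventually_radius] with r hr
  exact (coeffOf_of_seriesAt (hG r hr) hαβ).symm

variable {H : Type*} [NormedAddCommGroup H] [InnerProductSpace ℂ H] [CompleteSpace H]

lemma RadialLimit.seriesAt_berezin {C : Coeff n E}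
    {A : HTensor E (Fock n) →L[ℂ] HTensor E (Fock n)} (h : RadialLimit C A) {X : Tuple n H}
    (hX : X ∈ polyball n H) : SeriesAt C X (berezin X A) := by
  have := RegularPolyball.seriesAt_berezin h.mem_toeplitzSpace hX
  rwa [SeriesAt, homPart_congr fun α β hαβ => h.coeffOf_eq hαβ] at this

/-- A series with a radial limit `A` represents the Berezin transform of `A`, by uniqueness of
iterated sums. -/
lemma RadialLimit.eq_berezin {C : Coeff n E}
    {A : HTensor E (Fock n) →L[ℂ] HTensor E (Fock n)} (h : RadialLimit C A)
    {F : polyball n H → (HTensor E H →L[ℂ] HTensor E H)} (hF : Represents C F) (X : polyball n H) :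
    F X = berezin X.1 A :=
  HasIterSum.unique (hF X) (h.seriesAt_berezin X.2)

variable {V : Fock n →L[ℂ] H}

/-- The values on `H` determine those at the universal model. -/
lemma compress_berezin (hV : V.adjoint ∘L V = .id ℂ _)
    {A : HTensor E (Fock n) →L[ℂ] HTensor E (Fock n)} (hA : A ∈ toeplitzSpace E n) {r : ℝ}
    (h0 : 0 ≤ r) (h1 : r < 1) :
    compress V (berezin ((r : ℂ) • copyModel V) A) = berezin ((r : ℂ) • universalModel n) A :=
  HasIterSum.unique (seriesAt_compress hV
    (seriesAt_berezin hA (smul_copyModel_mem_polyball hV h0 h1)))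
    (seriesAt_berezin hA (smul_universalModel_mem_polyball h0 h1))

/-- The radial limit of any series representing the Berezin transform of `A ∈ 𝒫` on a Hilbert
space that contains a copy of `F²` is `A`. -/
lemma radialLimit_of_represents_berezin (hV : V.adjoint ∘L V = .id ℂ _)
    {A : HTensor E (Fock n) →L[ℂ] HTensor E (Fock n)} (hA : A ∈ toeplitzSpace E n) {C : Coeff n E}
    (hC : Represents C fun X : polyball n H => berezin X.1 A) : RadialLimit C A := by
  refine ⟨fun r => berezin ((r : ℂ) • universalModel n) A, fun r hr => ?_, tendsto_berezin hA⟩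
  simp only [← compress_berezin hV hA hr.1 hr.2]
  exact seriesAt_compress hV (hC ⟨_, smul_copyModel_mem_polyball hV hr.1 hr.2⟩)

end Radial

/-! ### The isomorphism with `𝒫` -/

section Isomorphism

variable {k : ℕ} (n : Fin k → ℕ) (E : Type u) [NormedAddCommGroup E] [InnerProductSpace ℂ E]
  [CompleteSpace E]

/-- The Fock space, lifted to the universe `v`. -/
def liftedFock {k : ℕ} (n : Fin k → ℕ) : HilbSp.{v} where
  carrier := lp (fun _ : ULift.{v} (Word n) => ℂ) 2

lemma orthonormal_lp_single (ι : Type*) [DecidableEq ι] :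
    Orthonormal ℂ fun i : ι => (lp.single 2 i (1 : ℂ) : lp (fun _ : ι => ℂ) 2) := by
  rw [orthonormal_iff_ite]
  intro i j
  rw [lp.inner_single_left, lp.single_apply]
  by_cases h : i = j
  · subst h; simp
  · simp [h]

/-- Some Hilbert space in the universe `v` contains a copy of `F²`, whatever the universe `v`. -/
lemma exists_isometry_liftedFock :
    ∃ V : Fock n →L[ℂ] (liftedFock.{v} n).carrier, V.adjoint ∘L V = .id ℂ _ := by
  classical
  exact exists_isometry_of_orthonormal (H := lp (fun _ : ULift.{v} (Word n) => ℂ) 2)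
    ((orthonormal_lp_single (ULift.{v} (Word n))).comp _ ULift.up_injective)

/-- The inverse of `Φ`: the element `A ∈ 𝒫` is sent to its Berezin transform. -/
def berezinPHc : toeplitzSpace E n →ₗ[ℂ] PHc.{u, v} n E where
  toFun A := ⟨fun _ X => berezin X.1 A.1,
    ⟨coeffOf A.1, fun _ X => seriesAt_berezin A.2 X.2⟩, fun _ => hasContExt_berezin A.2⟩
  map_add' A B := Subtype.ext (funext fun _ => funext fun X => berezin_add X.1 A.1 B.1)
  map_smul' c A := Subtype.ext (funext fun _ => funext fun X => berezin_smul X.1 c A.1)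

lemma berezinPHc_injective : Function.Injective (berezinPHc.{u, v} n E) := fun A B h => by
  obtain ⟨V, hV⟩ := exists_isometry_liftedFock.{v} n
  have h1 : ∀ X : polyball n (liftedFock.{v} n).carrier, berezin X.1 A.1 = berezin X.1 B.1 :=
    fun X => congrFun (congrFun (congrArg Subtype.val h) (liftedFock.{v} n)) X
  refine Subtype.ext (tendsto_nhds_unique (tendsto_berezin A.2)
    ((tendsto_berezin B.2).congr' ?_))
  filter_upwards [eventually_radius] with r hr
  rw [← compress_berezin hV A.2 hr.1 hr.2, ← compress_berezin hV B.2 hr.1 hr.2,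
    h1 ⟨_, smul_copyModel_mem_polyball hV hr.1 hr.2⟩]

lemma berezinPHc_surjective : Function.Surjective (berezinPHc.{u, v} n E) := fun F => by
  obtain ⟨V, hV⟩ := exists_isometry_liftedFock.{v} n
  obtain ⟨C, hC⟩ := F.2.1
  obtain ⟨A, hA⟩ := exists_radialLimit_of_hasContExt hV (hC (liftedFock.{v} n))
    (F.2.2 (liftedFock.{v} n))
  refine ⟨⟨A, hA.mem_toeplitzSpace⟩, Subtype.ext (funext fun K => funext fun X => ?_)⟩
  exact (hA.eq_berezin (hC K) X).symm

variable {n E} in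
/-- The Berezin transform is completely isometric: the matrix norm of a matrix over `𝒫` is the
supremum of the matrix norms of its Berezin transforms. -/
lemma isLUB_norm_opMatrix_berezin {d : ℕ} (A : Matrix (Fin d) (Fin d) (toeplitzSpace E n)) :
    IsLUB {x : ℝ | ∃ (H : HilbSp.{v}) (X : polyball n H.carrier),
        x = ‖opMatrix (Matrix.of fun i j => berezin X.1 (A i j).1)‖}
      ‖opMatrix (Matrix.of fun i j => (A i j).1)‖ := by
  obtain ⟨V, hV⟩ := exists_isometry_liftedFock.{v} n
  constructor
  · rintro _ ⟨H, X, rfl⟩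
    exact norm_opMatrix_berezin_le X.2 (Matrix.of fun i j => (A i j).1)
  · intro b hb
    have hlim : Tendsto (fun r : ℝ => ‖opMatrix (Matrix.of fun i j =>
        berezin ((r : ℂ) • universalModel n) (A i j).1)‖) (𝓝[<] 1)
        (𝓝 ‖opMatrix (Matrix.of fun i j => (A i j).1)‖) := by
      refine Tendsto.norm ((continuous_opMatrix.tendsto _).comp ?_)
      exact tendsto_pi_nhds.mpr fun i => tendsto_pi_nhds.mpr fun j => tendsto_berezin (A i j).2
    refine le_of_tendsto hlim ?_
    filter_upwards [eventually_radius] with r hr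
    simp only [← compress_berezin hV (A _ _).2 hr.1 hr.2]
    exact (norm_opMatrix_compress_isometry_le hV (Matrix.of fun i j =>
      berezin ((r : ℂ) • copyModel V) (A i j).1)).trans
      (hb ⟨liftedFock.{v} n, ⟨_, smul_copyModel_mem_polyball hV hr.1 hr.2⟩, rfl⟩)

end Isomorphism

end

end RegularPolyball

theorem mainTheorem4 {k : ℕ} (hk : 0 < k) (n : Fin k → ℕ) (hn : ∀ i, 0 < n i)
    (E : Type u) [NormedAddCommGroup E] [InnerProductSpace ℂ E] [CompleteSpace E] :
    (∀ (H : Type v) [NormedAddCommGroup H] [InnerProductSpace ℂ H] [CompleteSpace H],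
      ¬ FiniteDimensional ℂ H →
      ∀ F : polyball n H → (HTensor E H →L[ℂ] HTensor E H),
        (∀ X, F X ∈ minTensor E (Set.univ : Set (H →L[ℂ] H))) →
        List.TFAE [
          ∃ C : Coeff n E, ConvergesOnPolyball.{u, v} C ∧ Represents C F ∧ ∃ A, RadialLimit C A,
          ∃ A ∈ toeplitzSpace E n, ∀ X, F X = berezin X.1 A,
          (∃ C : Coeff n E, ConvergesOnPolyball.{u, v} C ∧ Represents C F) ∧ HasContExt F] ∧
        ∀ A ∈ toeplitzSpace E n, (∀ X, F X = berezin X.1 A) →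
          ∀ C : Coeff n E, ConvergesOnPolyball.{u, v} C → Represents C F → RadialLimit C A) ∧
    ∃ Φ : PHc.{u, v} n E ≃ₗ[ℂ] toeplitzSpace E n,
      (∀ F : PHc.{u, v} n E,
        (∀ (H : HilbSp.{v}) (X : polyball n H.carrier), F.1 H X = berezin X.1 (Φ F).1) ∧
        ∀ C : Coeff n E, (∀ H, Represents C (F.1 H)) → RadialLimit C (Φ F).1) ∧
      ∀ (d : ℕ) (F : Matrix (Fin d) (Fin d) (PHc.{u, v} n E)),
        IsLUB {x : ℝ | ∃ (H : HilbSp.{v}) (X : polyball n H.carrier),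
            x = ‖opMatrix (Matrix.of fun i j => (F i j).1 H X)‖}
          ‖opMatrix (Matrix.of fun i j => (Φ (F i j)).1)‖ := by
  refine ⟨fun H _ _ _ hH F _ => ?_, ?_⟩
  · obtain ⟨V, hV⟩ := exists_isometry_of_infinite n hH
    refine ⟨?_, fun A hA hF C _ hC => ?_⟩
    · tfae_have 1 → 2 := by
        rintro ⟨C, -, hC, A, hA⟩
        exact ⟨A, hA.mem_toeplitzSpace, hA.eq_berezin hC⟩
      tfae_have 2 → 1 := by
        rintro ⟨A, hA, hF⟩
        refine ⟨coeffOf A, fun K X hX => ⟨_, seriesAt_berezin hA hX⟩, fun X => ?_, A,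
          radialLimit_coeffOf hA⟩
        rw [hF]
        exact seriesAt_berezin hA X.2
      tfae_have 2 → 3 := by
        rintro ⟨A, hA, hF⟩
        obtain rfl : F = fun X => berezin X.1 A := funext hF
        exact ⟨⟨coeffOf A, fun K X hX => ⟨_, seriesAt_berezin hA hX⟩,
          fun X => seriesAt_berezin hA X.2⟩, hasContExt_berezin hA⟩
      tfae_have 3 → 1 := by
        rintro ⟨⟨C, hconv, hC⟩, hF⟩
        exact ⟨C, hconv, hC, exists_radialLimit_of_hasContExt hV hC hF⟩
      tfae_finish
    · obtain rfl : F = fun X => berezin X.1 A := funext hF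
      exact radialLimit_of_represents_berezin hV hA hC
  · obtain ⟨V, hV⟩ := exists_isometry_liftedFock.{v} n
    set Ψ : toeplitzSpace E n ≃ₗ[ℂ] PHc.{u, v} n E := LinearEquiv.ofBijective
      (berezinPHc n E) ⟨berezinPHc_injective n E, berezinPHc_surjective n E⟩ with hΨ
    have hF : ∀ (F : PHc.{u, v} n E) (H : HilbSp.{v}) (X : polyball n H.carrier),
        F.1 H X = berezin X.1 (Ψ.symm F).1 := fun F H X =>
      congrFun (congrFun (congrArg Subtype.val (Ψ.apply_symm_apply F).symm) H) X
    refine ⟨Ψ.symm, fun F => ⟨hF F, fun C hC => ?_⟩, fun d F => ?_⟩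
    · refine radialLimit_of_represents_berezin hV (Ψ.symm F).2 fun X => ?_
      have h := hC (liftedFock.{v} n) X
      rw [hF] at h
      exact h
    · simp only [hF]
      exact isLUB_norm_opMatrix_berezin fun i j => Ψ.symm (F i j)
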